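/- Let $S^3=\{(z,w)\in\mathbb{C}^2 : z\bar z+w\bar w=1\}$ with its round metric $g_1$ induced from $\mathbb{C}^2=\mathbb{R}^4$, let $X_{(z,w)}=(iz,iw)$ be the Hopf vector field, $\mathcal{V}$ the line field spanned by $X$ and $\mathcal{H}$ its $g_1$-orthogonal complement. For $\epsilon>0$ let $g_\epsilon$ be the Riemannian metric on $S^3$ for which $\mathcal{V}$ and $\mathcal{H}$ are orthogonal, $g_\epsilon=\epsilon\, g_1$ on $\mathcal{H}$ and $g_\epsilon=\epsilon^2 g_1$ on $\mathcal{V}$; for $\epsilon\neq 1$ the Riemannian manifold $(S^3,g_\epsilon)$ is called a (three-dimensional) Berger sphere. A smooth foliation of a Riemannian manifold is *metric* if its leaves are locally equidistant: every point has arbitrarily small open neighbourhoods $U$, each containing a smaller open neighbourhood $U'$ of the point, such that for all $x,y\in U'$ and every $x'$ in the plaque of $x$ in $U'$, the points $x$ and $x'$ have the same Riemannian distance to the plaque of $y$ in $U$. (The plaque of a point in an open set $U$ is the connected component, in the leaf topology, of the intersection of its leaf with $U$ that contains it.) The foliation is *homogeneous* if locally its leaves are orbits of an isometric group action; for one-dimensional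 leaves this means that near every point there is a smooth local $\mathbb{R}$-action by isometries whose orbits are regular curves running in the leaves. **Theorem.** Let $\epsilon>0$, $\epsilon\neq 1$. Every one-dimensional smooth metric foliation of the Berger sphere $(S^3,g_\epsilon)$ is homogeneous. -/

import Mathlib

open scoped ContDiff Topology

noncomputable section

namespace Berger

/-- The unit three-sphere `{(z, w) ∈ ℂ² | z z̄ + w w̄ = 1}`, an embedded submanifold of `ℂ² = ℝ⁴`.
Smooth objects on it are, locally, restrictions of smooth objects on open subsets of `ℂ²`. -/
def S3 : Set (ℂ × ℂ) := {p | Complex.normSq p.1 + Complex.normSq p.2 = 1}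

/-- The Euclidean inner product of `ℂ² = ℝ⁴`. -/
def euclInner (v w : ℂ × ℂ) : ℝ :=
  (v.1 * (starRingEnd ℂ) w.1 + v.2 * (starRingEnd ℂ) w.2).re

/-- `v` is tangent to the three-sphere at `p`. -/
def IsTangent (p v : ℂ × ℂ) : Prop := euclInner v p = 0

/-- The Hopf vector field `X(z, w) = (iz, iw)`, which generates the Hopf circle action. -/
def hopf (p : ℂ × ℂ) : ℂ × ℂ := (Complex.I * p.1, Complex.I * p.2)

/-- The component of a tangent vector `v` at `p` that is orthogonal, for the round metric, to the
Hopf field. -/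
def horizontalPart (p v : ℂ × ℂ) : ℂ × ℂ := v - euclInner v (hopf p) • hopf p

/-- The Berger metric `g_ε` at `p`, evaluated on tangent vectors: the Hopf direction and its
orthogonal complement are `g_ε`-orthogonal, and the round metric is multiplied by `ε ^ 2` on the
former and by `ε` on the latter. -/
def metric (ε : ℝ) (p v w : ℂ × ℂ) : ℝ :=
  ε * euclInner (horizontalPart p v) (horizontalPart p w)
    + ε ^ 2 * (euclInner v (hopf p) * euclInner w (hopf p))

/-- The `g_ε`-length of a curve in the three-sphere parametrized by `[0, 1]`. -/
def length (ε : ℝ) (γ : ℝ → ℂ × ℂ) : ℝ :=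
  ∫ t in (0 : ℝ)..1, Real.sqrt (metric ε (γ t) (deriv γ t) (deriv γ t))

/-- The Riemannian distance of the metric `g_ε` on the three-sphere: the infimum of the lengths of
the `C¹` curves in the sphere that join the two points. -/
def dist (ε : ℝ) (x y : ℂ × ℂ) : ℝ :=
  sInf {l | ∃ γ : ℝ → ℂ × ℂ, ContDiff ℝ 1 γ ∧ (∀ t ∈ Set.Icc (0 : ℝ) 1, γ t ∈ S3) ∧
    γ 0 = x ∧ γ 1 = y ∧ l = length ε γ}

/-- The Riemannian distance from a point to a set. -/
def distTo (ε : ℝ) (x : ℂ × ℂ) (A : Set (ℂ × ℂ)) : ℝ := sInf (dist ε x '' A)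

/-- A smooth one-dimensional foliation of the three-sphere, given by its tangent line field: a
line in each tangent space of the sphere, spanned near each point by a smooth vector field.
(In dimension one every smooth line field is integrable; the leaves are its maximal integral
curves. Only the values of `line` at points of the sphere matter.) -/
structure OneDimFoliation where
  line : ℂ × ℂ → Submodule ℝ (ℂ × ℂ)
  smooth : ∀ p ∈ S3, ∃ O : Set (ℂ × ℂ), IsOpen O ∧ p ∈ O ∧ ∃ V : ℂ × ℂ → ℂ × ℂ,
    ContDiffOn ℝ ∞ V O ∧
      ∀ q ∈ O ∩ S3, V q ≠ 0 ∧ IsTangent q (V q) ∧ line q = Submodule.span ℝ {V q}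

/-- The plaque through `x` of the foliation restricted to `U`: the points that can be joined to `x`
inside `U` by a `C¹` curve running in a leaf. For `U` the whole sphere this is the leaf
through `x`; in general it is the connected component of `x` in (leaf through `x`) `∩ U`, for the
topology of the leaf. -/
def OneDimFoliation.plaque (F : OneDimFoliation) (U : Set (ℂ × ℂ)) (x : ℂ × ℂ) : Set (ℂ × ℂ) :=
  {y | ∃ γ : ℝ → ℂ × ℂ, ContDiff ℝ 1 γ ∧ γ 0 = x ∧ γ 1 = y ∧
    ∀ t ∈ Set.Icc (0 : ℝ) 1, γ t ∈ U ∩ S3 ∧ deriv γ t ∈ F.line (γ t)}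

/-- The foliation is metric for `g_ε`: its leaves are locally equidistant. Every point has
arbitrarily small neighbourhoods `U`, each with a smaller neighbourhood `U'`, such that the
distance to the plaque in `U` of a point of `U'` is constant along every plaque in `U'`.
(The smaller neighbourhood is there because plaques of `U` end at the boundary of `U`, so that
near the boundary the nearest point of the leaf may lie outside `U`.) -/
def OneDimFoliation.IsMetric (ε : ℝ) (F : OneDimFoliation) : Prop :=
  ∀ p ∈ S3, ∀ N ∈ 𝓝 p, ∃ U U' : Set (ℂ × ℂ),
    IsOpen U ∧ IsOpen U' ∧ p ∈ U' ∧ U' ⊆ U ∧ U ⊆ N ∧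
      ∀ x ∈ U' ∩ S3, ∀ y ∈ U' ∩ S3, ∀ x' ∈ F.plaque U' x,
        distTo ε x' (F.plaque U y) = distTo ε x (F.plaque U y)

/-- The foliation is homogeneous for `g_ε`: locally, its leaves are the orbits of an isometric
group action. Near every point there is a smooth local action `Φ` of the group `ℝ` on the sphere
by `g_ε`-isometries, whose orbits are regular curves running in the leaves. (If the leaves are
locally orbits of some Lie group of isometries, then a one-parameter subgroup suffices.) -/
def OneDimFoliation.IsHomogeneous (ε : ℝ) (F : OneDimFoliation) : Prop :=
  ∀ p ∈ S3, ∃ O : Set (ℂ × ℂ), IsOpen O ∧ p ∈ O ∧ ∃ δ > 0, ∃ Φ : ℝ → ℂ × ℂ → ℂ × ℂ,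
    ContDiffOn ℝ ∞ (fun a : ℝ × (ℂ × ℂ) => Φ a.1 a.2) (Set.Ioo (-δ) δ ×ˢ O) ∧
    (∀ q ∈ O ∩ S3, Φ 0 q = q) ∧
    (∀ t ∈ Set.Ioo (-δ) δ, ∀ q ∈ O ∩ S3, Φ t q ∈ S3) ∧
    (∀ s ∈ Set.Ioo (-δ) δ, ∀ t ∈ Set.Ioo (-δ) δ, s + t ∈ Set.Ioo (-δ) δ →
      ∀ q ∈ O ∩ S3, Φ t q ∈ O → Φ s (Φ t q) = Φ (s + t) q) ∧
    (∀ t ∈ Set.Ioo (-δ) δ, ∀ q ∈ O ∩ S3, ∀ v w, IsTangent q v → IsTangent q w →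
      metric ε (Φ t q) (fderiv ℝ (Φ t) q v) (fderiv ℝ (Φ t) q w) = metric ε q v w) ∧
    (∀ t ∈ Set.Ioo (-δ) δ, ∀ q ∈ O ∩ S3, deriv (fun τ => Φ τ q) t ≠ 0 ∧
      F.line (Φ t q) = Submodule.span ℝ {deriv (fun τ => Φ τ q) t})

end Berger

end

/-! A metric foliation `F` of the Berger sphere is locally spanned by a field `V`, of unit length
for the metric `g_ε`. Comparing the distances between nearby plaques before and after moving along
the flow of `V`, to first order in the distance and in the time, shows that `⟨∇_A V, A⟩ = 0` for
all `A` orthogonal to `V` (`OneDimFoliation.IsMetric.fderiv_eq_zero`): the flow of `V` preserves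
the metric of the orthogonal planes, and `V` is a Riemannian flow
(`OneDimFoliation.IsMetric.exists_isRiemannianFlow`).

It remains to see that a Riemannian flow is locally a multiple of an infinitesimal isometry. Where
`V` is not parallel to the Hopf field `e₁`, let `U` be the part of `e₁` orthogonal to `V`, and let
`X = V × e₁`. The condition on `V` leaves three unknown functions: the components `P` and `Q` of
the mean curvature `∇_V V` along `U` and `X`, and the vorticity `s`. The brackets of `V`, `U`, `X`
express nearly all their derivatives through these functions and `c = ⟨V, e₁⟩`, and `ε ≠ 1` makes
the system overdetermined: its last integrability condition is that `P` times a sum of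
eigenfunctions of `U`, with eigenvalues `0`, `2 P N`, `3 P N`, `4 P N`, `5 P N`, `6 P N`, `7 P N`,
vanishes (`FlowFrame.weight_identity`), where `N = |U|²`. Where `P ≠ 0`, each eigenfunction has to
vanish. The one with eigenvalue `0` gives `c = 0`, which contradicts `V c = P N`. So `P = 0`
(`FlowFrame.not_isUnit_P`), and then the Hopf field preserves the line field of `V`
(`FlowFrame.bracket_coeff_eq_zero`). Open sets where `V` is parallel to `e₁` are harmless, and the
remaining points are reached by continuity.

The infinitesimal isometries of a Berger sphere that matter here are the fields `q ↦ a i q + q y`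
with `a` real and `y` an imaginary quaternion. A field `V` which is a multiple of such a field
determines that field at each point up to a factor, by the tuple `killTuple` of first derivatives
of `V`. The equations above say that this tuple, for a Riemannian flow, has derivatives
proportional to itself (`IsRiemannianFlow.tupleDeriv_eq_smul`). Hence the corresponding isometry
is locally constant up to a factor (`IsRiemannianFlow.exists_killingField`), and its exponential
is the action sought (`exists_localAction`).

Functions on the sphere are extended to open subsets of `ℂ²` as constants on rays. The
computations with the structure equations take place in an arbitrary commutative `ℝ`-algebra with
derivations, which is later the algebra of smooth functions on an open set. -/

set_option linter.unusedSimpArgs false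

open scoped ContDiff Topology NNReal

noncomputable section

namespace Berger

/-! ### Differential algebra of a unit Riemannian flow on a Berger sphere -/

/-- The structure equations of a unit field `V` whose flow preserves the transverse metric, on an
open subset of the Berger sphere where `V` is not parallel to the unit Hopf field `e₁`. Functions
form the ring `A`, vector fields act as derivations. `U = e₁ - c V` is the part of `e₁` orthogonal
to `V`, `X = V × e₁`, `c = ⟨V, e₁⟩`, `N = |U|² = |X|²`, `t` is the square root of the parameter
of the metric, `∇_V V = P U + Q X`, and `s` is half the `V`-component of the curl of `V`.
The functions `w₂, w₃` are the other two components of `V` in the right-invariant orthonormal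
frame. -/
structure FlowFrame (A : Type*) [CommRing A] [Algebra ℝ A] where
  V : Derivation ℝ A A
  U : Derivation ℝ A A
  X : Derivation ℝ A A
  (c w₂ w₃ P Q s t ti N : A)
  ht : t * ti = 1
  V_t : V t = 0
  U_t : U t = 0
  X_t : X t = 0
  isUnit_N : IsUnit N
  hN : N = w₂ ^ 2 + w₃ ^ 2
  hc : c ^ 2 + w₂ ^ 2 + w₃ ^ 2 = 1
  V_c : V c = P * N
  U_c : U c = 0
  X_c : X c = (t - s) * N
  V_w₂ : V w₂ = -(P * c * w₂) + (Q + (2 * t - 2 * ti) * c) * w₃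
  V_w₃ : V w₃ = -(P * c * w₃) - (Q + (2 * t - 2 * ti) * c) * w₂
  U_w₂ : U w₂ = (s - t + (2 * t - 2 * ti) * N) * w₃
  U_w₃ : U w₃ = -((s - t + (2 * t - 2 * ti) * N) * w₂)
  X_w₂ : X w₂ = -((t - s) * c * w₂)
  X_w₃ : X w₃ = -((t - s) * c * w₃)
  bracket_U_V : ∀ f, U (V f) - V (U f) = (s + t + c * Q) * X f + c * P * U f + P * N * V f
  bracket_X_V : ∀ f, X (V f) - V (X f) = -((s + t + c * Q) * U f) + c * P * X f + Q * N * V f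
  bracket_U_X : ∀ f, U (X f) - X (U f) = -(2 * s * N * V f)

namespace FlowFrame

variable {A : Type*} [CommRing A] [Algebra ℝ A] (F : FlowFrame A)

lemma N_eq : F.N = 1 - F.c ^ 2 := by linear_combination F.hN + F.hc

lemma derivation_ofNat (δ : Derivation ℝ A A) (n : ℕ) [n.AtLeastTwo] :
    δ (ofNat(n) : A) = 0 := by
  have h := δ.map_natCast (OfNat.ofNat n)
  rwa [Nat.cast_ofNat] at h

lemma derivation_N (δ : Derivation ℝ A A) : δ F.N = -(2 * F.c * δ F.c) := by
  rw [F.N_eq, map_sub, Derivation.map_one_eq_zero, pow_two, Derivation.leibniz]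
  simp only [smul_eq_mul]; ring

lemma V_N : F.V F.N = -(2 * F.c * F.P * F.N) := by rw [derivation_N, V_c]; ring
lemma U_N : F.U F.N = 0 := by rw [derivation_N, U_c]; ring
lemma X_N : F.X F.N = -(2 * F.c * (F.t - F.s) * F.N) := by rw [derivation_N, X_c]; ring

lemma derivation_ti (δ : Derivation ℝ A A) (h : δ F.t = 0) : δ F.ti = 0 := by
  have h1 := congrArg δ F.ht
  rw [Derivation.leibniz, Derivation.map_one_eq_zero, h] at h1
  simp only [smul_eq_mul] at h1
  linear_combination F.ti * h1 - δ F.ti * F.ht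

lemma V_ti : F.V F.ti = 0 := F.derivation_ti _ F.V_t
lemma U_ti : F.U F.ti = 0 := F.derivation_ti _ F.U_t
lemma X_ti : F.X F.ti = 0 := F.derivation_ti _ F.X_t

lemma cancel_N {a b : A} (h : F.N * a = F.N * b) : a = b := F.isUnit_N.mul_left_cancel h

lemma U_P : F.U F.P = (F.s + F.t + F.c * F.Q) * (F.t - F.s) + F.P ^ 2 * F.N := by
  apply F.cancel_N
  have h := F.bracket_U_V F.c
  simp only [V_c, U_c, X_c, map_zero, Derivation.leibniz, smul_eq_mul, U_N] at h
  linear_combination h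

lemma X_P : F.X F.P = -F.V F.s + F.c * F.P * (F.t - F.s) + F.P * F.Q * F.N := by
  apply F.cancel_N
  have h := F.bracket_X_V F.c
  simp only [V_c, U_c, X_c, map_sub, Derivation.leibniz, smul_eq_mul, V_N, X_N, V_t] at h
  linear_combination h

lemma U_s : F.U F.s = 2 * F.s * F.P * F.N := by
  apply F.cancel_N
  have h := F.bracket_U_X F.c
  simp only [V_c, U_c, X_c, map_sub, map_zero, Derivation.leibniz, smul_eq_mul, U_N, U_t] at h
  linear_combination -h

/-- Combining the brackets applied to `w₂` and `w₃` as `w₃ · - w₂ ·` isolates the derivatives of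
the polar angle of the pair `(w₂, w₃)`; the same device gives `X_Q` and `X_s`. -/
lemma U_Q : F.U F.Q = F.V F.s + F.c * F.P * (F.s - F.t) + F.P * F.N * F.Q := by
  apply F.cancel_N
  have h2 := F.bracket_U_V F.w₂
  have h3 := F.bracket_U_V F.w₃
  simp only [V_w₂, V_w₃, U_w₂, U_w₃, X_w₂, X_w₃, map_add, map_sub, map_neg, Derivation.leibniz,
    smul_eq_mul, U_c, V_c, U_N, V_N, U_t, V_t, U_ti, V_ti, derivation_ofNat] at h2 h3
  linear_combination F.w₃ * h2 - F.w₂ * h3 +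
    (F.U F.Q - (F.V F.s + F.c * F.P * (F.s - F.t) + F.P * F.N * F.Q)) * F.hN

lemma X_Q : F.X F.Q = (F.s + F.t + F.c * F.Q) * (F.t - F.s) + (4 - 4 * F.t ^ 2) * F.N
    + F.Q ^ 2 * F.N := by
  apply F.cancel_N
  have h2 := F.bracket_X_V F.w₂
  have h3 := F.bracket_X_V F.w₃
  simp only [V_w₂, V_w₃, U_w₂, U_w₃, X_w₂, X_w₃, map_add, map_sub, map_neg, Derivation.leibniz,
    smul_eq_mul, X_c, V_c, X_N, V_N, X_t, V_t, X_ti, V_ti, derivation_ofNat] at h2 h3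
  linear_combination F.w₃ * h2 - F.w₂ * h3 +
    (F.X F.Q - ((F.s + F.t + F.c * F.Q) * (F.t - F.s) + (4 - 4 * F.t ^ 2) * F.N
    + F.Q ^ 2 * F.N)) * F.hN + 4 * F.N * (F.w₂ ^ 2 + F.w₃ ^ 2) * F.ht

lemma X_s : F.X F.s = F.N * (2 * F.s * F.Q - (4 - 4 * F.t ^ 2) * F.c) := by
  apply F.cancel_N
  have h2 := F.bracket_U_X F.w₂
  have h3 := F.bracket_U_X F.w₃
  simp only [V_w₂, V_w₃, U_w₂, U_w₃, X_w₂, X_w₃, map_add, map_sub, map_neg, Derivation.leibniz,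
    smul_eq_mul, X_c, U_c, X_N, U_N, X_t, U_t, X_ti, U_ti,
    derivation_ofNat] at h2 h3
  linear_combination -F.w₃ * h2 + F.w₂ * h3 +
    (F.X F.s - (F.N * (2 * F.s * F.Q - (4 - 4 * F.t ^ 2) * F.c))) * F.hN
    - 4 * F.N * F.c * (F.w₂ ^ 2 + F.w₃ ^ 2) * F.ht

lemma three_mul_s_mul_V_s :
    3 * F.s * F.V F.s = -((4 - 4 * F.t ^ 2) * F.c * F.P * F.N) := by
  have h2 : IsUnit (2 : A) := by
    have := (isUnit_iff_ne_zero.mpr (two_ne_zero (α := ℝ))).map (algebraMap ℝ A)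
    rwa [map_ofNat] at this
  apply h2.mul_left_cancel
  apply F.cancel_N
  have h := F.bracket_U_X F.s
  simp only [X_s, U_s, X_P, U_Q, map_add, map_sub, map_neg, Derivation.leibniz,
    Derivation.leibniz_pow, nsmul_eq_mul, smul_eq_mul, X_c, U_c, X_N, U_N, X_t, U_t, X_ti, U_ti,
    derivation_ofNat] at h
  linear_combination h

lemma s_pow_mul_V_Q :
    18 * F.s ^ 3 * F.V F.Q = F.P * (18 * F.s ^ 3 * (2 * F.c * F.Q + F.t + F.s)
      + 12 * (4 - 4 * F.t ^ 2) * F.c * F.N * F.Q * F.s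
      + 3 * (4 - 4 * F.t ^ 2) * F.s * (4 * F.s - F.t) * (F.N - F.c ^ 2)
      - 4 * (4 - 4 * F.t ^ 2) ^ 2 * F.c ^ 2 * F.N) := by
  apply F.cancel_N
  have h := F.bracket_X_V F.s
  have hr := F.three_mul_s_mul_V_s
  have hX := congrArg F.X hr
  simp only [X_s, U_s, X_P, U_Q, map_add, map_sub, map_neg, Derivation.leibniz,
    Derivation.leibniz_pow, nsmul_eq_mul, smul_eq_mul, X_c, V_c, X_N, V_N, X_t, V_t,
    derivation_ofNat] at h hX
  linear_combination 3 * F.s * hX - 9 * F.s ^ 2 * h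
    - (15 * F.s * F.N * F.Q - 4 * (4 - 4 * F.t ^ 2) * F.c * F.N) * hr

/-- The combination of the invariants that is homogeneous of weight `3` under `U`. -/
def weightThree : A :=
  9 * F.s * F.Q * F.N - 9 * F.s * F.c * (F.t + F.s) - (4 - 4 * F.t ^ 2) * F.c * F.N

lemma U_weightThree : F.U F.weightThree = 3 * (F.P * F.N) * F.weightThree := by
  have hr := F.three_mul_s_mul_V_s
  simp only [weightThree, U_s, U_Q, map_add, map_sub, map_neg, Derivation.leibniz,
    Derivation.leibniz_pow, nsmul_eq_mul, smul_eq_mul, U_c, U_N, U_t, derivation_ofNat]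
  linear_combination 3 * F.N * hr

/-- The integrability condition of the second derivatives of `Q`, sorted by the weight with which
`U` acts on each term: the weights are `0`, `2`, `4`, `6`, `3`, `5`, `7`. -/
lemma weight_identity : F.P * (4 - 4 * F.t ^ 2) * 2 *
    (-900 * F.c ^ 3 * (4 - 4 * F.t ^ 2) ^ 2 * F.N ^ 2
      + -5670 * F.c * F.t * (F.t ^ 2 - 1) * (6 * F.c ^ 2 - 1) * F.N * F.s
      + 81 * F.c * (-40 * F.c ^ 2 * F.t ^ 2 - 176 * F.c ^ 2 - 95 * F.t ^ 2 + 176) * F.s ^ 2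
      + (-10935 * F.c * F.t * F.s ^ 3 - 90 * F.c * F.weightThree ^ 2)
      + -2520 * F.c ^ 2 * F.N * (F.t ^ 2 - 1) * F.weightThree
      + 9 * (45 * F.t - 270 * F.c ^ 2 * F.t) * (F.s * F.weightThree)
      + -810 * (F.s ^ 2 * F.weightThree)) = 0 := by
  have h := F.bracket_X_V F.Q
  have hr := F.three_mul_s_mul_V_s
  have hZ := F.s_pow_mul_V_Q
  have hX := congrArg F.X hZ
  simp only [X_Q, X_s, U_s, X_P, U_Q, map_add, map_sub, map_neg, Derivation.leibniz,
    Derivation.leibniz_pow, nsmul_eq_mul, smul_eq_mul, X_c, V_c, X_N, V_N, X_t, V_t,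
    derivation_ofNat] at h hX
  rw [weightThree]
  have hN := F.N_eq
  rw [hN] at h hr hZ hX ⊢
  linear_combination 243 * 18 * F.s ^ 4 * h - 243 * F.s * hX
    + 243 * (F.s * (F.c * (F.t - F.s) + 3 * F.Q * (1 - F.c ^ 2))
      + 3 * (1 - F.c ^ 2) * (2 * F.s * F.Q - (4 - 4 * F.t ^ 2) * F.c)) * hZ
    - 81 * (18 * F.s ^ 3 * (2 * (F.s + F.t + F.c * F.Q) - F.t + F.s)
      - (18 * F.s ^ 3 * (2 * F.c * F.Q + F.t + F.s)
      + 12 * (4 - 4 * F.t ^ 2) * F.c * (1 - F.c ^ 2) * F.Q * F.s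
      + 3 * (4 - 4 * F.t ^ 2) * F.s * (4 * F.s - F.t) * ((1 - F.c ^ 2) - F.c ^ 2)
      - 4 * (4 - 4 * F.t ^ 2) ^ 2 * F.c ^ 2 * (1 - F.c ^ 2))) * hr

end FlowFrame

/-! ### The mean curvature is orthogonal to the Hopf field -/

/-- Eigenvectors of a derivation for eigenvalues `k p`, with distinct natural numbers `k` and an
invertible `p`, that add up to zero all vanish. -/
lemma eq_zero_of_sum_weights {A : Type*} [CommRing A] [Algebra ℝ A] (δ : Derivation ℝ A A)
    {p : A} (hp : IsUnit p) (S : Finset ℕ) (a : ℕ → A)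
    (ha : ∀ k ∈ S, δ (a k) = k * p * a k) (hsum : ∑ k ∈ S, a k = 0) : ∀ k ∈ S, a k = 0 := by
  induction S using Finset.induction_on generalizing a with
  | empty => simp
  | insert j S hj ih =>
    have hunit : ∀ k ∈ S, IsUnit ((k : A) - j) := by
      intro k hk
      have hkj : (k : ℝ) - j ≠ 0 := by
        rw [sub_ne_zero]; intro h
        exact hj ((Nat.cast_injective h : k = j) ▸ hk)
      have := (isUnit_iff_ne_zero.mpr hkj).map (algebraMap ℝ A)
      simpa using this
    have h0 : ∀ k ∈ S, a k = 0 := by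
      have h1 : ∑ k ∈ S, ((k : A) - j) * a k = 0 := by
        apply hp.mul_left_cancel
        have h2 := congrArg δ hsum
        rw [map_sum, map_zero, Finset.sum_congr rfl ha, Finset.sum_insert hj] at h2
        rw [Finset.sum_insert hj] at hsum
        rw [Finset.mul_sum, mul_zero]
        calc ∑ k ∈ S, p * (((k : A) - j) * a k)
            = ∑ k ∈ S, (k * p * a k) - j * p * ∑ k ∈ S, a k := by
              rw [Finset.mul_sum, ← Finset.sum_sub_distrib]
              exact Finset.sum_congr rfl fun k _ => by ring
          _ = 0 := by linear_combination h2 - j * p * hsum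
      have h3 := ih (fun k => ((k : A) - j) * a k) (fun k hk => by
        simp only [Derivation.leibniz, map_sub, Derivation.map_natCast, smul_eq_mul,
          ha k (Finset.mem_insert_of_mem hk)]
        ring) h1
      exact fun k hk => (hunit k hk).mul_left_cancel (by rw [h3 k hk, mul_zero])
    intro k hk
    rcases Finset.mem_insert.mp hk with rfl | hk
    · rwa [Finset.sum_insert hj, Finset.sum_eq_zero h0, add_zero] at hsum
    · exact h0 k hk

namespace FlowFrame

variable {A : Type*} [CommRing A] [Algebra ℝ A] (F : FlowFrame A)

/-- The Hopf component of the mean curvature `∇_V V` cannot be invertible: the weight-zero part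
of `weight_identity` would force `c = 0`, hence `P N = V c = 0`. -/
lemma not_isUnit_P [Nontrivial A] (hD : IsUnit (4 - 4 * F.t ^ 2)) : ¬ IsUnit F.P := by
  intro hP
  have h2 : IsUnit (2 : A) := by
    have := (isUnit_iff_ne_zero.mpr (two_ne_zero (α := ℝ))).map (algebraMap ℝ A)
    rwa [map_ofNat] at this
  have h900 : IsUnit (-900 : A) := by
    have := (isUnit_iff_ne_zero.mpr (by norm_num : (-900 : ℝ) ≠ 0)).map (algebraMap ℝ A)
    rwa [map_neg, map_ofNat] at this
  have hsum := F.weight_identity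
  have hsum := ((hP.mul hD).mul h2).mul_left_cancel (hsum.trans (mul_zero _).symm)
  let a : ℕ → A := fun k => match k with
    | 0 => -900 * F.c ^ 3 * (4 - 4 * F.t ^ 2) ^ 2 * F.N ^ 2
    | 2 => -5670 * F.c * F.t * (F.t ^ 2 - 1) * (6 * F.c ^ 2 - 1) * F.N * F.s
    | 4 => 81 * F.c * (-40 * F.c ^ 2 * F.t ^ 2 - 176 * F.c ^ 2 - 95 * F.t ^ 2 + 176) * F.s ^ 2
    | 6 => -10935 * F.c * F.t * F.s ^ 3 - 90 * F.c * F.weightThree ^ 2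
    | 3 => -2520 * F.c ^ 2 * F.N * (F.t ^ 2 - 1) * F.weightThree
    | 5 => 9 * (45 * F.t - 270 * F.c ^ 2 * F.t) * (F.s * F.weightThree)
    | 7 => -810 * (F.s ^ 2 * F.weightThree)
    | _ => 0
  have ha : ∀ k ∈ Finset.range 8, F.U (a k) = k * (F.P * F.N) * a k := by
    intro k hk
    have hk := Finset.mem_range.mp hk
    interval_cases k <;> simp only [a, map_zero] <;>
    (try simp only [U_weightThree, U_s, map_add, map_sub, map_neg, Derivation.leibniz,
      Derivation.map_one_eq_zero, Derivation.leibniz_pow, nsmul_eq_mul, smul_eq_mul, U_c, U_N,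
      U_t, derivation_ofNat]) <;> push_cast <;> ring
  have h0 := eq_zero_of_sum_weights F.U (hP.mul F.isUnit_N) (Finset.range 8) a ha
    (by simp only [Finset.sum_range_succ, Finset.sum_range_zero, a]; linear_combination hsum)
    0 (by simp)
  have hc : F.c ^ 3 = 0 := by
    apply ((h900.mul (hD.pow 2)).mul (F.isUnit_N.pow 2)).mul_left_cancel
    simp only [a] at h0
    linear_combination h0
  -- differentiating along `V` lowers the power of `c`, because `V c = P N` is invertible
  have h1 := congrArg F.V hc
  simp only [Derivation.leibniz_pow, V_c, map_zero, nsmul_eq_mul, smul_eq_mul] at h1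
  have h3 : IsUnit (3 : A) := by
    have := (isUnit_iff_ne_zero.mpr (by norm_num : (3 : ℝ) ≠ 0)).map (algebraMap ℝ A)
    rwa [map_ofNat] at this
  have hc2 : F.c ^ 2 = 0 := by
    apply (h3.mul (hP.mul F.isUnit_N)).mul_left_cancel
    push_cast at h1
    linear_combination h1
  have h1 := congrArg F.V hc2
  simp only [Derivation.leibniz_pow, V_c, map_zero, nsmul_eq_mul, smul_eq_mul] at h1
  have hc1 : F.c = 0 := by
    apply (h2.mul (hP.mul F.isUnit_N)).mul_left_cancel
    push_cast at h1
    linear_combination h1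
  have h1 := F.V_c
  rw [hc1, map_zero] at h1
  exact (hP.mul F.isUnit_N).ne_zero h1.symm

/-- If the Hopf component of the mean curvature vanishes, then the Hopf field preserves the line
field of `V`. -/
lemma bracket_coeff_eq_zero [IsReduced A] (hD : IsUnit (4 - 4 * F.t ^ 2))
    (hpos : IsUnit (F.t ^ 2 * F.N + F.c ^ 2)) (hP : F.P = 0) : F.s + F.t + F.c * F.Q = 0 := by
  have hr : F.V F.s = 0 := by have := F.X_P; rw [hP, map_zero] at this; linear_combination this
  have h1 : (F.s + F.t + F.c * F.Q) * (F.t - F.s) = 0 := by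
    have := F.U_P; rw [hP, map_zero] at this; linear_combination -this
  have h2 : (F.s + F.t + F.c * F.Q) * (2 * F.t * F.Q - (4 - 4 * F.t ^ 2) * F.c) = 0 := by
    apply F.cancel_N
    have := F.bracket_U_V F.s
    rw [U_s, hr, hP, X_s] at this
    simp only [mul_zero, zero_mul, map_zero] at this
    linear_combination 2 * F.Q * F.N * h1 - this
  have h3 := congrArg F.X h2
  have h4 : IsUnit (4 : A) := by
    have := (isUnit_iff_ne_zero.mpr (by norm_num : (4 : ℝ) ≠ 0)).map (algebraMap ℝ A)
    rwa [map_ofNat] at this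
  have ht : IsUnit F.t := IsUnit.of_mul_eq_one _ F.ht
  simp only [X_Q, X_c, X_t, map_sub, map_zero, Derivation.leibniz, smul_eq_mul, derivation_ofNat,
    Derivation.leibniz_pow, nsmul_eq_mul] at h3
  have h5 : (F.s + F.t + F.c * F.Q) ^ 2 * ((4 - 4 * F.t ^ 2) + F.Q ^ 2) = 0 := by
    have h2t : IsUnit (2 * F.t * F.N) := by
      refine (IsUnit.mul ?_ ht).mul F.isUnit_N
      have := (isUnit_iff_ne_zero.mpr (by norm_num : (2 : ℝ) ≠ 0)).map (algebraMap ℝ A)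
      rwa [map_ofNat] at this
    apply h2t.mul_left_cancel
    linear_combination (F.s + F.t + F.c * F.Q) * h3
      - F.X (F.s + F.t + F.c * F.Q) * h2
      - (2 * F.t * (F.s + F.t + F.c * F.Q) - (4 - 4 * F.t ^ 2) * F.N) * (F.s + F.t + F.c * F.Q) * h1
  have h6 : ((F.s + F.t + F.c * F.Q) * (F.t ^ 2 * F.N + F.c ^ 2)) ^ 2 = 0 := by
    apply (hD.mul h4).mul_left_cancel
    linear_combination (F.t ^ 2 * F.N + F.c ^ 2) * (4 * F.t ^ 2 * h5
        - (F.s + F.t + F.c * F.Q) * (2 * F.t * F.Q + (4 - 4 * F.t ^ 2) * F.c) * h2)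
      + 4 * (4 - 4 * F.t ^ 2) * (F.s + F.t + F.c * F.Q) ^ 2 * (F.t ^ 2 * F.N + F.c ^ 2)
        * F.t ^ 2 * F.N_eq
  exact hpos.mul_right_cancel ((pow_eq_zero_iff two_ne_zero).mp h6 |>.trans (zero_mul _).symm)

lemma V_s_eq_zero (hP : F.P = 0) : F.V F.s = 0 := by
  have := F.X_P; rw [hP, map_zero] at this; linear_combination this

lemma U_Q_eq_zero (hP : F.P = 0) : F.U F.Q = 0 := by
  have := F.U_Q; rw [hP, F.V_s_eq_zero hP] at this; linear_combination this

lemma V_Q_eq_zero (hP : F.P = 0) (hT : F.s + F.t + F.c * F.Q = 0) : F.V F.Q = 0 := by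
  have hVs := F.V_s_eq_zero hP
  have hUs : F.U F.s = 0 := by have := F.U_s; rw [hP] at this; linear_combination this
  have hVc : F.V F.c = 0 := by have := F.V_c; rw [hP] at this; linear_combination this
  have hVN : F.V F.N = 0 := by have := F.V_N; rw [hP] at this; linear_combination this
  have h1 : F.c * F.V F.Q = 0 := by
    have := congrArg F.V hT
    simp only [map_add, Derivation.leibniz, F.V_t, hVs, hVc, map_zero, smul_eq_mul] at this
    linear_combination this
  have h2 : IsUnit (2 : A) := by
    have := (isUnit_iff_ne_zero.mpr (two_ne_zero (α := ℝ))).map (algebraMap ℝ A)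
    rwa [map_ofNat] at this
  have h3 : F.s * F.V F.Q = 0 := by
    apply (h2.mul F.isUnit_N).mul_left_cancel
    have := F.bracket_X_V F.s
    simp only [hVs, hUs, hP, F.X_s, map_zero, map_sub, Derivation.leibniz, smul_eq_mul, hVN,
      F.V_t, hVc, derivation_ofNat, Derivation.leibniz_pow, nsmul_eq_mul] at this
    linear_combination -this
  have ht : IsUnit F.t := IsUnit.of_mul_eq_one _ F.ht
  apply ht.mul_left_cancel
  linear_combination F.V F.Q * hT - h3 - F.Q * h1

end FlowFrame

/-! ### Unit Riemannian flows in the right-invariant frame -/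

/-- A unit field `V = w₁ e₁ + w₂ e₂ + w₃ e₃` on an open subset of the Berger sphere whose flow
preserves the transverse metric. Functions form the ring `A`; `e₁, e₂, e₃` is the right-invariant
orthonormal frame (with `e₁` the unit Hopf field), `t` is the square root of the parameter of the
metric. The field `riemannian` says that `⟨∇_a V, a⟩ = 0` for all `a` orthogonal to `V`. -/
structure RiemannianFlow (A : Type*) [CommRing A] [Algebra ℝ A] where
  (e₁ e₂ e₃ : Derivation ℝ A A)
  (t ti w₁ w₂ w₃ : A)
  ht : t * ti = 1
  e₁_t : e₁ t = 0
  e₂_t : e₂ t = 0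
  e₃_t : e₃ t = 0
  bracket₂₃ : ∀ f, e₂ (e₃ f) - e₃ (e₂ f) = -(2 * t * e₁ f)
  bracket₃₁ : ∀ f, e₃ (e₁ f) - e₁ (e₃ f) = -(2 * ti * e₂ f)
  bracket₁₂ : ∀ f, e₁ (e₂ f) - e₂ (e₁ f) = -(2 * ti * e₃ f)
  unit : w₁ ^ 2 + w₂ ^ 2 + w₃ ^ 2 = 1
  riemannian : ∀ a₁ a₂ a₃ : A, a₁ * w₁ + a₂ * w₂ + a₃ * w₃ = 0 →
    a₁ * (a₁ * e₁ w₁ + a₂ * e₂ w₁ + a₃ * e₃ w₁) + a₂ * (a₁ * e₁ w₂ + a₂ * e₂ w₂ + a₃ * e₃ w₂)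
      + a₃ * (a₁ * e₁ w₃ + a₂ * e₂ w₃ + a₃ * e₃ w₃)
      + (2 * t - 2 * ti) * a₁ * (w₂ * a₃ - w₃ * a₂) = 0

namespace RiemannianFlow

variable {A : Type*} [CommRing A] [Algebra ℝ A] (B : RiemannianFlow A)

/-- The derivation `a₁ e₁ + a₂ e₂ + a₃ e₃`. -/
def combo (a₁ a₂ a₃ : A) : Derivation ℝ A A := a₁ • B.e₁ + a₂ • B.e₂ + a₃ • B.e₃

lemma combo_apply (a₁ a₂ a₃ f : A) :
    B.combo a₁ a₂ a₃ f = a₁ * B.e₁ f + a₂ * B.e₂ f + a₃ * B.e₃ f := by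
  simp [combo]

/-- The commutator of two combinations of the frame fields. -/
lemma combo_bracket (a₁ a₂ a₃ b₁ b₂ b₃ f : A) :
    B.combo a₁ a₂ a₃ (B.combo b₁ b₂ b₃ f) - B.combo b₁ b₂ b₃ (B.combo a₁ a₂ a₃ f)
      = (B.combo a₁ a₂ a₃ b₁ - B.combo b₁ b₂ b₃ a₁ - 2 * B.t * (a₂ * b₃ - a₃ * b₂)) * B.e₁ f
      + (B.combo a₁ a₂ a₃ b₂ - B.combo b₁ b₂ b₃ a₂ - 2 * B.ti * (a₃ * b₁ - a₁ * b₃)) * B.e₂ f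
      + (B.combo a₁ a₂ a₃ b₃ - B.combo b₁ b₂ b₃ a₃ - 2 * B.ti * (a₁ * b₂ - a₂ * b₁)) * B.e₃ f := by
  simp only [combo_apply, map_add, Derivation.leibniz, smul_eq_mul]
  linear_combination (a₂ * b₃ - a₃ * b₂) * B.bracket₂₃ f + (a₃ * b₁ - a₁ * b₃) * B.bracket₃₁ f
    + (a₁ * b₂ - a₂ * b₁) * B.bracket₁₂ f

/-- The square `1 - w₁²` of the length of the part of the Hopf field orthogonal to the flow. -/
def normSqU : A := B.w₂ ^ 2 + B.w₃ ^ 2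

/-- The flow field. -/
def V : Derivation ℝ A A := B.combo B.w₁ B.w₂ B.w₃

/-- The part of `e₁` orthogonal to the flow. -/
def U : Derivation ℝ A A := B.combo B.normSqU (-(B.w₁ * B.w₂)) (-(B.w₁ * B.w₃))

/-- The cross product of the flow field with `e₁`. -/
def X : Derivation ℝ A A := B.combo 0 B.w₃ (-B.w₂)

/-- The component along `X` of the mean curvature of the flow. -/
def meanCurv : A :=
  B.w₃ * B.V B.w₂ - B.w₂ * B.V B.w₃ - (2 * B.t - 2 * B.ti) * B.w₁ * B.normSqU

lemma derivation_unit (δ : Derivation ℝ A A) :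
    B.w₁ * δ B.w₁ + B.w₂ * δ B.w₂ + B.w₃ * δ B.w₃ = 0 := by
  have h2 : IsUnit (2 : A) := by
    have := (isUnit_iff_ne_zero.mpr (two_ne_zero (α := ℝ))).map (algebraMap ℝ A)
    rwa [map_ofNat] at this
  have h := congrArg δ B.unit
  simp only [map_add, Derivation.leibniz_pow, Derivation.map_one_eq_zero, nsmul_eq_mul,
    smul_eq_mul] at h
  apply h2.mul_left_cancel
  push_cast at h
  linear_combination h

lemma inner_X_X : B.w₃ * B.X B.w₂ - B.w₂ * B.X B.w₃ = 0 := by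
  have h := B.riemannian 0 B.w₃ (-B.w₂) (by ring)
  simp only [X, combo_apply]
  linear_combination h

lemma inner_U_U : B.U B.w₁ = 0 := by
  have h := B.riemannian B.normSqU (-(B.w₁ * B.w₂)) (-(B.w₁ * B.w₃))
    (by simp only [normSqU]; ring)
  have h1 := B.derivation_unit B.U
  have h2 := B.unit
  have e1 := B.combo_apply B.normSqU (-(B.w₁ * B.w₂)) (-(B.w₁ * B.w₃)) B.w₁
  have e2 := B.combo_apply B.normSqU (-(B.w₁ * B.w₂)) (-(B.w₁ * B.w₃)) B.w₂
  have e3 := B.combo_apply B.normSqU (-(B.w₁ * B.w₂)) (-(B.w₁ * B.w₃)) B.w₃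
  change B.U _ = _ at e1 e2 e3
  rw [← e1, ← e2, ← e3] at h
  have hn : B.normSqU = B.w₂ ^ 2 + B.w₃ ^ 2 := rfl
  rw [hn] at h
  linear_combination h + B.w₁ * h1 - B.U B.w₁ * h2

lemma inner_U_X : B.w₃ * B.U B.w₂ - B.w₂ * B.U B.w₃ + B.X B.w₁
    - (2 * B.t - 2 * B.ti) * B.normSqU ^ 2 = 0 := by
  have h := B.riemannian B.normSqU (-(B.w₁ * B.w₂) + B.w₃) (-(B.w₁ * B.w₃) - B.w₂)
    (by simp only [normSqU]; ring)
  have hU := B.riemannian B.normSqU (-(B.w₁ * B.w₂)) (-(B.w₁ * B.w₃))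
    (by simp only [normSqU]; ring)
  have hX := B.riemannian 0 B.w₃ (-B.w₂) (by ring)
  have h1 := B.derivation_unit B.X
  have h2 := B.unit
  simp only [X, U, combo_apply, normSqU] at h hU hX h1 ⊢
  linear_combination h - hU - hX + B.w₁ * h1 -
    (0 * B.e₁ B.w₁ + B.w₃ * B.e₂ B.w₁ + -B.w₂ * B.e₃ B.w₁) * h2

section Frame

variable {iN : A} (h : B.normSqU * iN = 1)

include h

lemma V_w₂ : B.V B.w₂ = -(iN * B.V B.w₁ * B.w₁ * B.w₂)
    + (iN * B.meanCurv + (2 * B.t - 2 * B.ti) * B.w₁) * B.w₃ := by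
  have hd := B.derivation_unit B.V
  rw [meanCurv]
  have hn : B.normSqU = B.w₂ ^ 2 + B.w₃ ^ 2 := rfl
  rw [hn] at h ⊢
  linear_combination -B.V B.w₂ * h + iN * B.w₂ * hd
    + (2 * B.t - 2 * B.ti) * B.w₁ * B.w₃ * h

lemma V_w₃ : B.V B.w₃ = -(iN * B.V B.w₁ * B.w₁ * B.w₃)
    - (iN * B.meanCurv + (2 * B.t - 2 * B.ti) * B.w₁) * B.w₂ := by
  have hd := B.derivation_unit B.V
  rw [meanCurv]
  have hn : B.normSqU = B.w₂ ^ 2 + B.w₃ ^ 2 := rfl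
  rw [hn] at h ⊢
  linear_combination -B.V B.w₃ * h + iN * B.w₃ * hd
    - (2 * B.t - 2 * B.ti) * B.w₁ * B.w₂ * h

lemma U_w₂ : B.U B.w₂ =
    (B.t - iN * B.X B.w₁ - B.t + (2 * B.t - 2 * B.ti) * B.normSqU) * B.w₃ := by
  have hd := B.derivation_unit B.U
  have hu := B.inner_U_U
  have hx := B.inner_U_X
  rw [hu] at hd
  have hn : B.normSqU = B.w₂ ^ 2 + B.w₃ ^ 2 := rfl
  rw [hn] at h hx ⊢
  linear_combination -B.U B.w₂ * h + iN * B.w₂ * hd + iN * B.w₃ * hx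
    + (2 * B.t - 2 * B.ti) * (B.w₂ ^ 2 + B.w₃ ^ 2) * B.w₃ * h

lemma U_w₃ : B.U B.w₃ =
    -((B.t - iN * B.X B.w₁ - B.t + (2 * B.t - 2 * B.ti) * B.normSqU) * B.w₂) := by
  have hd := B.derivation_unit B.U
  have hu := B.inner_U_U
  have hx := B.inner_U_X
  rw [hu] at hd
  have hn : B.normSqU = B.w₂ ^ 2 + B.w₃ ^ 2 := rfl
  rw [hn] at h hx ⊢
  linear_combination -B.U B.w₃ * h + iN * B.w₃ * hd - iN * B.w₂ * hx
    - (2 * B.t - 2 * B.ti) * (B.w₂ ^ 2 + B.w₃ ^ 2) * B.w₂ * h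

lemma X_w₂ : B.X B.w₂ = -((B.t - (B.t - iN * B.X B.w₁)) * B.w₁ * B.w₂) := by
  have hd := B.derivation_unit B.X
  have hx := B.inner_X_X
  have hn : B.normSqU = B.w₂ ^ 2 + B.w₃ ^ 2 := rfl
  rw [hn] at h
  linear_combination -B.X B.w₂ * h + iN * B.w₂ * hd + iN * B.w₃ * hx

lemma X_w₃ : B.X B.w₃ = -((B.t - (B.t - iN * B.X B.w₁)) * B.w₁ * B.w₃) := by
  have hd := B.derivation_unit B.X
  have hx := B.inner_X_X
  have hn : B.normSqU = B.w₂ ^ 2 + B.w₃ ^ 2 := rfl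
  rw [hn] at h
  linear_combination -B.X B.w₃ * h + iN * B.w₃ * hd - iN * B.w₂ * hx

end Frame

lemma derivation_normSqU (δ : Derivation ℝ A A) :
    δ B.normSqU = -(2 * B.w₁ * δ B.w₁) := by
  have hN : B.normSqU = 1 - B.w₁ ^ 2 := by have := B.unit; rw [normSqU]; linear_combination this
  rw [hN, map_sub, Derivation.map_one_eq_zero, pow_two, Derivation.leibniz]
  simp only [smul_eq_mul]; ring

/-- The flow frame of a Riemannian flow that is nowhere parallel to the Hopf field. -/
def flowFrame (iN : A) (h : B.normSqU * iN = 1) : FlowFrame A where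
  V := B.V
  U := B.U
  X := B.X
  c := B.w₁
  P := iN * B.V B.w₁
  Q := iN * B.meanCurv
  s := B.t - iN * B.X B.w₁
  t := B.t
  ti := B.ti
  w₂ := B.w₂
  w₃ := B.w₃
  N := B.normSqU
  ht := B.ht
  V_t := by simp [V, combo_apply, B.e₁_t, B.e₂_t, B.e₃_t]
  U_t := by simp [U, combo_apply, B.e₁_t, B.e₂_t, B.e₃_t]
  X_t := by simp [X, combo_apply, B.e₁_t, B.e₂_t, B.e₃_t]
  isUnit_N := IsUnit.of_mul_eq_one _ h
  hN := rfl
  hc := B.unit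
  V_c := by linear_combination -B.V B.w₁ * h
  U_c := B.inner_U_U
  X_c := by linear_combination -B.X B.w₁ * h
  V_w₂ := B.V_w₂ h
  V_w₃ := B.V_w₃ h
  U_w₂ := B.U_w₂ h
  U_w₃ := B.U_w₃ h
  X_w₂ := B.X_w₂ h
  X_w₃ := B.X_w₃ h
  bracket_U_V f := by
    have hb : B.U (B.V f) - B.V (B.U f) = _ := B.combo_bracket _ _ _ _ _ _ f
    change _ = (B.U _ - B.V _ - _) * _ + (B.U _ - B.V _ - _) * _ + (B.U _ - B.V _ - _) * _ at hb
    have hn : B.normSqU = B.w₂ ^ 2 + B.w₃ ^ 2 := rfl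
    have hu := B.unit
    simp only [map_neg, Derivation.leibniz, smul_eq_mul, B.derivation_normSqU, B.V_w₂ h,
      B.V_w₃ h, B.U_w₂ h, B.U_w₃ h, B.inner_U_U] at hb
    rw [hb]
    have e1 : B.X f = _ := B.combo_apply _ _ _ f
    have e2 : B.U f = _ := B.combo_apply _ _ _ f
    have e3 : B.V f = _ := B.combo_apply _ _ _ f
    rw [e1, e2, e3, hn]
    rw [hn] at h
    linear_combination 2 * B.t * (B.w₃ * B.e₂ f - B.w₂ * B.e₃ f) * hu
      - (2 * B.w₁ * B.V B.w₁ * B.e₁ f + B.V B.w₁ * B.w₂ * B.e₂ f + B.V B.w₁ * B.w₃ * B.e₃ f) * h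
  bracket_X_V f := by
    have hb : B.X (B.V f) - B.V (B.X f) = _ := B.combo_bracket _ _ _ _ _ _ f
    change _ = (B.X _ - B.V _ - _) * _ + (B.X _ - B.V _ - _) * _ + (B.X _ - B.V _ - _) * _ at hb
    have hn : B.normSqU = B.w₂ ^ 2 + B.w₃ ^ 2 := rfl
    have hu := B.unit
    simp only [map_neg, map_zero, Derivation.leibniz, smul_eq_mul, B.derivation_normSqU, B.V_w₂ h,
      B.V_w₃ h, B.X_w₂ h, B.X_w₃ h] at hb
    rw [hb]
    have e1 : B.X f = _ := B.combo_apply _ _ _ f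
    have e2 : B.U f = _ := B.combo_apply _ _ _ f
    have e3 : B.V f = _ := B.combo_apply _ _ _ f
    rw [e1, e2, e3, hn]
    rw [hn] at h
    linear_combination -B.X B.w₁ * B.e₁ f * h
      - iN * B.meanCurv * (B.w₂ * B.e₂ f + B.w₃ * B.e₃ f) * hu
  bracket_U_X f := by
    have hb : B.U (B.X f) - B.X (B.U f) = _ := B.combo_bracket _ _ _ _ _ _ f
    change _ = (B.U _ - B.X _ - _) * _ + (B.U _ - B.X _ - _) * _ + (B.U _ - B.X _ - _) * _ at hb
    have hn : B.normSqU = B.w₂ ^ 2 + B.w₃ ^ 2 := rfl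
    have hu := B.unit
    simp only [map_neg, map_zero, Derivation.leibniz, smul_eq_mul, B.derivation_normSqU, B.U_w₂ h,
      B.U_w₃ h, B.X_w₂ h, B.X_w₃ h] at hb
    rw [hb]
    have e3 : B.V f = _ := B.combo_apply _ _ _ f
    rw [e3, hn]
    rw [hn] at h
    linear_combination -iN * B.X B.w₁ * (B.w₂ * B.e₂ f + B.w₃ * B.e₃ f) * hu
      - B.X B.w₁ * (2 * B.w₁ * B.e₁ f + B.w₂ * B.e₂ f + B.w₃ * B.e₃ f) * h

lemma e₁_eq (f : A) : B.e₁ f = B.w₁ * B.V f + B.U f := by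
  simp only [V, U, combo_apply, normSqU]
  linear_combination -B.e₁ f * B.unit

lemma e₂_eq {iN : A} (h : B.normSqU * iN = 1) (f : A) :
    B.e₂ f = B.w₂ * B.V f - iN * B.w₁ * B.w₂ * B.U f + iN * B.w₃ * B.X f := by
  simp only [V, U, X, combo_apply]
  rw [normSqU] at *
  linear_combination -(B.e₂ f - B.w₁ * B.w₂ * B.e₁ f) * h
    - iN * B.w₂ * (B.w₂ * B.e₂ f + B.w₃ * B.e₃ f) * B.unit
    + B.w₂ * (B.w₂ * B.e₂ f + B.w₃ * B.e₃ f) * h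

lemma e₃_eq {iN : A} (h : B.normSqU * iN = 1) (f : A) :
    B.e₃ f = B.w₃ * B.V f - iN * B.w₁ * B.w₃ * B.U f - iN * B.w₂ * B.X f := by
  simp only [V, U, X, combo_apply]
  rw [normSqU] at *
  linear_combination -(B.e₃ f - B.w₁ * B.w₃ * B.e₁ f) * h
    - iN * B.w₃ * (B.w₂ * B.e₂ f + B.w₃ * B.e₃ f) * B.unit
    + B.w₃ * (B.w₂ * B.e₂ f + B.w₃ * B.e₃ f) * h

/-- If the flow is locally a multiple of an infinitesimal isometry, then for each point `q` a
multiple `x ↦ a i x + x q⁻¹ (u₁ i + u₂ j + u₃ k) q` of that isometry takes the value `4 V` at `q`.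
This is the coefficient `u₁`, expressed through `V`. -/
def killingPart : A := B.meanCurv - (B.e₂ B.w₃ - B.e₃ B.w₂)

/-- The tuple `(a, u) = (4 ti w₁ - k, (k, 4 w₂, 4 w₃))` with `k` the `killingPart` is parallel up
to a factor: the derivative of `a` and the covariant derivatives `e_j u + 2 u × e_j` are `κ_j a`
and `κ_j u` with common factors `κ_j`. -/
structure IsProjParallel (κ₁ κ₂ κ₃ : A) : Prop where
  a₁ : B.e₁ (4 * B.ti * B.w₁ - B.killingPart) = κ₁ * (4 * B.ti * B.w₁ - B.killingPart)
  a₂ : B.e₂ (4 * B.ti * B.w₁ - B.killingPart) = κ₂ * (4 * B.ti * B.w₁ - B.killingPart)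
  a₃ : B.e₃ (4 * B.ti * B.w₁ - B.killingPart) = κ₃ * (4 * B.ti * B.w₁ - B.killingPart)
  u₁₁ : B.e₁ B.killingPart = κ₁ * B.killingPart
  u₁₂ : B.e₁ B.w₂ + 2 * B.ti * B.w₃ = κ₁ * B.w₂
  u₁₃ : B.e₁ B.w₃ - 2 * B.ti * B.w₂ = κ₁ * B.w₃
  u₂₁ : B.e₂ B.killingPart - 8 * B.w₃ = κ₂ * B.killingPart
  u₂₂ : B.e₂ B.w₂ = κ₂ * B.w₂
  u₂₃ : 4 * B.e₂ B.w₃ + 2 * B.killingPart = 4 * κ₂ * B.w₃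
  u₃₁ : B.e₃ B.killingPart + 8 * B.w₂ = κ₃ * B.killingPart
  u₃₂ : 4 * B.e₃ B.w₂ - 2 * B.killingPart = 4 * κ₃ * B.w₂
  u₃₃ : B.e₃ B.w₃ = κ₃ * B.w₃

/-- Where the flow is nowhere parallel to the Hopf field, `κ` is the mean curvature. -/
lemma isProjParallel_of_isUnit {iN : A} (h : B.normSqU * iN = 1)
    (hP : (B.flowFrame iN h).P = 0)
    (hT : (B.flowFrame iN h).s + B.t + B.w₁ * (B.flowFrame iN h).Q = 0) :
    B.IsProjParallel 0 (B.w₃ * (iN * B.meanCurv)) (-(B.w₂ * (iN * B.meanCurv))) := by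
  obtain ⟨Q, hQ⟩ : ∃ Q, Q = iN * B.meanCurv := ⟨_, rfl⟩
  obtain ⟨s, hs⟩ : ∃ s, s = B.t - iN * B.X B.w₁ := ⟨_, rfl⟩
  have hm : B.meanCurv = B.normSqU * Q := by rw [hQ]; linear_combination -B.meanCurv * h
  have hT' : s + B.t + B.w₁ * Q = 0 := by rw [hs, hQ]; exact hT
  have hP' : iN * B.V B.w₁ = 0 := hP
  have hu := B.unit
  have hN : B.normSqU = B.w₂ ^ 2 + B.w₃ ^ 2 := rfl
  have hVc : B.V B.w₁ = 0 := by linear_combination B.normSqU * hP' - B.V B.w₁ * h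
  have hUc : B.U B.w₁ = 0 := B.inner_U_U
  have hXc : B.X B.w₁ = (B.t - s) * B.normSqU := by
    rw [hs]; linear_combination -B.X B.w₁ * h
  have hs' : s = -B.t - B.w₁ * Q := by linear_combination hT'
  have hV2 := B.V_w₂ h
  have hV3 := B.V_w₃ h
  have hU2 := B.U_w₂ h
  have hU3 := B.U_w₃ h
  have hX2 := B.X_w₂ h
  have hX3 := B.X_w₃ h
  rw [← hs, hs', hN] at hU2 hU3
  rw [← hs, hs'] at hX2 hX3
  rw [hP', ← hQ] at hV2 hV3
  rw [hs', hN] at hXc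
  have hVQ : B.V Q = 0 := by rw [hQ]; exact FlowFrame.V_Q_eq_zero _ hP hT
  have hUQ : B.U Q = 0 := by rw [hQ]; exact FlowFrame.U_Q_eq_zero _ hP
  have hXQ : B.X Q = (4 - 4 * B.t ^ 2 + Q ^ 2) * (B.w₂ ^ 2 + B.w₃ ^ 2) := by
    have h1 : B.X Q = (s + B.t + B.w₁ * Q) * (B.t - s) + (4 - 4 * B.t ^ 2) * B.normSqU
        + Q ^ 2 * B.normSqU := by rw [hQ, hs]; exact (B.flowFrame iN h).X_Q
    rw [h1, hT', hN]; ring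
  have h2 : ∀ f, B.e₂ f = _ := B.e₂_eq h
  have h3 : ∀ f, B.e₃ f = _ := B.e₃_eq h
  have hVt : B.V B.t = 0 := (B.flowFrame iN h).V_t
  have hUt : B.U B.t = 0 := (B.flowFrame iN h).U_t
  have hXt : B.X B.t = 0 := (B.flowFrame iN h).X_t
  have hVti : B.V B.ti = 0 := (B.flowFrame iN h).V_ti
  have hUti : B.U B.ti = 0 := (B.flowFrame iN h).U_ti
  have hXti : B.X B.ti = 0 := (B.flowFrame iN h).X_ti
  rw [hN] at h hm
  have hk : B.killingPart = 2 * Q + 4 * B.t * B.w₁ := by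
    rw [killingPart, h2, h3, hV2, hV3, hU2, hU3, hX2, hX3, hm]
    linear_combination 2 * Q * hu - ((2 * B.t - 2 * B.ti) * B.w₁ * (B.w₂ ^ 2 + B.w₃ ^ 2)
      + 2 * B.w₁ * (-2 * B.t - B.w₁ * Q)) * h
  have hE : ∀ δ : Derivation ℝ A A, δ (4 * B.ti * B.w₁ - B.killingPart)
      = 4 * (B.ti * δ B.w₁ + B.w₁ * δ B.ti) - 2 * δ Q - 4 * (B.t * δ B.w₁ + B.w₁ * δ B.t) := by
    intro δ
    rw [hk]
    simp only [map_add, map_sub, Derivation.leibniz, smul_eq_mul, FlowFrame.derivation_ofNat]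
    ring
  have hE' : ∀ δ : Derivation ℝ A A, δ B.killingPart
      = 2 * δ Q + 4 * (B.t * δ B.w₁ + B.w₁ * δ B.t) := by
    intro δ
    rw [hk]
    simp only [map_add, Derivation.leibniz, smul_eq_mul, FlowFrame.derivation_ofNat]
    ring
  rw [← hQ]
  constructor
  · simp only [B.e₁_eq, hE, hVt, hUt, hVti, hUti, hVc, hUc, hVQ, hUQ]; ring
  · rw [h2, hE, hE, hE, hk]
    simp only [hVt, hUt, hXt, hVti, hUti, hXti, hVc, hUc, hXc, hVQ, hUQ, hXQ]
    linear_combination B.w₃ * ((4 * B.ti - 4 * B.t) * (2 * B.t + B.w₁ * Q)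
      - 2 * (4 - 4 * B.t ^ 2) - 2 * Q ^ 2) * h + 8 * B.w₃ * B.ht
  · rw [h3, hE, hE, hE, hk]
    simp only [hVt, hUt, hXt, hVti, hUti, hXti, hVc, hUc, hXc, hVQ, hUQ, hXQ]
    linear_combination -B.w₂ * ((4 * B.ti - 4 * B.t) * (2 * B.t + B.w₁ * Q)
      - 2 * (4 - 4 * B.t ^ 2) - 2 * Q ^ 2) * h - 8 * B.w₂ * B.ht
  · simp only [B.e₁_eq, hE', hVt, hUt, hVc, hUc, hVQ, hUQ]; ring
  · rw [B.e₁_eq, hV2, hU2]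
    linear_combination (2 * B.t - 2 * B.ti) * B.w₃ * hu
  · rw [B.e₁_eq, hV3, hU3]
    linear_combination -(2 * B.t - 2 * B.ti) * B.w₂ * hu
  · rw [h2, hE', hE', hE', hk]
    simp only [hVt, hUt, hXt, hVc, hUc, hXc, hVQ, hUQ, hXQ]
    linear_combination B.w₃ * (2 * (4 - 4 * B.t ^ 2) + 2 * Q ^ 2
      + 4 * B.t * (2 * B.t + B.w₁ * Q)) * h
  · rw [h2, hV2, hU2, hX2]
    linear_combination -(2 * B.t - 2 * B.ti) * B.w₁ * B.w₂ * B.w₃ * h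
  · rw [h2, hV3, hU3, hX3, hk]
    linear_combination (4 * (2 * B.t - 2 * B.ti) * B.w₁ * B.w₂ ^ 2
      + 4 * B.w₁ * (-2 * B.t - B.w₁ * Q)) * h - 4 * Q * hu
  · rw [h3, hE', hE', hE', hk]
    simp only [hVt, hUt, hXt, hVc, hUc, hXc, hVQ, hUQ, hXQ]
    linear_combination -B.w₂ * (2 * (4 - 4 * B.t ^ 2) + 2 * Q ^ 2
      + 4 * B.t * (2 * B.t + B.w₁ * Q)) * h
  · rw [h3, hV2, hU2, hX2, hk]
    linear_combination (-4 * (2 * B.t - 2 * B.ti) * B.w₁ * B.w₃ ^ 2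
      - 4 * B.w₁ * (-2 * B.t - B.w₁ * Q)) * h + 4 * Q * hu
  · rw [h3, hV3, hU3, hX3]
    linear_combination (2 * B.t - 2 * B.ti) * B.w₁ * B.w₂ * B.w₃ * h

/-- Where the flow is the Hopf flow, the tuple is `(± 4 ti, 0)`. -/
lemma isProjParallel_of_eq_zero (h₂ : B.w₂ = 0) (h₃ : B.w₃ = 0) : B.IsProjParallel 0 0 0 := by
  have hu := B.unit
  rw [h₂, h₃] at hu
  have hw : IsUnit B.w₁ := IsUnit.of_mul_eq_one B.w₁ (by linear_combination hu)
  have hd : ∀ δ : Derivation ℝ A A, δ B.w₁ = 0 := fun δ => by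
    have := B.derivation_unit δ
    rw [h₂, h₃] at this
    apply hw.mul_left_cancel
    linear_combination this
  have hm : B.meanCurv = 0 := by simp [meanCurv, h₂, h₃, normSqU]
  have hk : B.killingPart = 0 := by simp [killingPart, hm, h₂, h₃]
  have hti : ∀ δ : Derivation ℝ A A, δ B.t = 0 → δ B.ti = 0 := fun δ h => by
    have h1 := congrArg δ B.ht
    rw [Derivation.leibniz, Derivation.map_one_eq_zero, h] at h1
    simp only [smul_eq_mul] at h1
    linear_combination B.ti * h1 - δ B.ti * B.ht
  constructor <;>
    simp [hk, h₂, h₃, hd, Derivation.leibniz, hti _ B.e₁_t, hti _ B.e₂_t, hti _ B.e₃_t,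
      FlowFrame.derivation_ofNat]

end RiemannianFlow

/-! ### The differential algebra of smooth functions on an open set -/

section SmoothFun

variable {E : Type*} [NormedAddCommGroup E] [NormedSpace ℝ E]

/-- The derivative of `f` along the linear vector field `L`. -/
def lieDeriv (L : E →L[ℝ] E) (f : E → ℝ) (q : E) : ℝ := fderiv ℝ f q (L q)

lemma contDiffOn_lieDeriv {Ω : Set E} (hΩ : IsOpen Ω) (L : E →L[ℝ] E) {f : E → ℝ}
    (hf : ContDiffOn ℝ ∞ f Ω) : ContDiffOn ℝ ∞ (lieDeriv L f) Ω :=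
  (hf.fderiv_of_isOpen hΩ (by simp)).clm_apply L.contDiff.contDiffOn

/-- The algebra of smooth real functions on an open set. -/
def smoothFun (Ω : TopologicalSpace.Opens E) : Subalgebra ℝ (Ω → ℝ) where
  carrier := {f | ∃ g : E → ℝ, ContDiffOn ℝ ∞ g Ω ∧ ∀ x : Ω, f x = g x}
  mul_mem' := by
    rintro f₁ f₂ ⟨g₁, h₁, e₁⟩ ⟨g₂, h₂, e₂⟩
    exact ⟨fun x => g₁ x * g₂ x, h₁.mul h₂, fun x => by simp [e₁, e₂]⟩
  add_mem' := by
    rintro f₁ f₂ ⟨g₁, h₁, e₁⟩ ⟨g₂, h₂, e₂⟩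
    exact ⟨fun x => g₁ x + g₂ x, h₁.add h₂, fun x => by simp [e₁, e₂]⟩
  algebraMap_mem' r := ⟨fun _ => r, contDiffOn_const, fun x => by simp⟩

variable {Ω : TopologicalSpace.Opens E}

/-- The restriction to `Ω` of a function that is smooth on `Ω`. -/
def restr {g : E → ℝ} (hg : ContDiffOn ℝ ∞ g Ω) : smoothFun Ω := ⟨fun x => g x, g, hg, fun _ => rfl⟩

/-- A smooth representative of an element of `smoothFun Ω`. -/
def rep (f : smoothFun Ω) : E → ℝ := f.2.choose

lemma contDiffOn_rep (f : smoothFun Ω) : ContDiffOn ℝ ∞ (rep f) Ω := f.2.choose_spec.1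

lemma rep_apply (f : smoothFun Ω) (x : Ω) : rep f x = f.1 x := (f.2.choose_spec.2 x).symm

lemma rep_eq (f : smoothFun Ω) {y : E} (hy : y ∈ Ω) : rep f y = f.1 ⟨y, hy⟩ := rep_apply f ⟨y, hy⟩

lemma smoothFun_ext {f g : smoothFun Ω} (h : ∀ x, f.1 x = g.1 x) : f = g :=
  Subtype.ext (funext h)

lemma lieDeriv_congr (L : E →L[ℝ] E) {f g : E → ℝ} (h : Set.EqOn f g Ω) (x : Ω) :
    lieDeriv L f x = lieDeriv L g x := by
  have : f =ᶠ[𝓝 (x : E)] g := Filter.eventually_of_mem (Ω.isOpen.mem_nhds x.2) h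
  rw [lieDeriv, lieDeriv, this.fderiv_eq]

lemma differentiableAt_of_mem {f : E → ℝ} (hf : ContDiffOn ℝ ∞ f Ω) (x : Ω) :
    DifferentiableAt ℝ f x :=
  (hf.contDiffAt (Ω.isOpen.mem_nhds x.2)).differentiableAt (by simp)

/-- The linear vector field `L` as a derivation of the smooth functions on `Ω`. -/
def fieldDerivation (Ω : TopologicalSpace.Opens E) (L : E →L[ℝ] E) :
    Derivation ℝ (smoothFun Ω) (smoothFun Ω) :=
  Derivation.mk'
    { toFun := fun f => restr (contDiffOn_lieDeriv Ω.isOpen L (contDiffOn_rep f))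
      map_add' := fun f g => smoothFun_ext fun x => by
        change lieDeriv L (rep (f + g)) x = lieDeriv L (rep f) x + lieDeriv L (rep g) x
        rw [lieDeriv_congr L (g := fun y => rep f y + rep g y) (fun y hy => by
          simp only [rep_eq _ hy]; rfl) x]
        simp only [lieDeriv]
        rw [fderiv_fun_add (differentiableAt_of_mem (contDiffOn_rep f) x)
          (differentiableAt_of_mem (contDiffOn_rep g) x)]
        rfl
      map_smul' := fun r f => smoothFun_ext fun x => by
        change lieDeriv L (rep (r • f)) x = r * lieDeriv L (rep f) x
        rw [lieDeriv_congr L (g := fun y => r * rep f y) (fun y hy => by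
          simp only [rep_eq _ hy]; rfl) x]
        simp only [lieDeriv]
        rw [fderiv_const_mul (differentiableAt_of_mem (contDiffOn_rep f) x)]
        rfl }
    (fun f g => smoothFun_ext fun x => by
      change lieDeriv L (rep (f * g)) x =
        f.1 x * lieDeriv L (rep g) x + g.1 x * lieDeriv L (rep f) x
      rw [lieDeriv_congr L (g := fun y => rep f y * rep g y) (fun y hy => by
        simp only [rep_eq _ hy]; rfl) x]
      simp only [lieDeriv]
      rw [fderiv_fun_mul (differentiableAt_of_mem (contDiffOn_rep f) x)
          (differentiableAt_of_mem (contDiffOn_rep g) x), rep_apply, rep_apply]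
      rfl)

lemma fieldDerivation_apply (L : E →L[ℝ] E) (f : smoothFun Ω) (x : Ω) :
    (fieldDerivation Ω L f).1 x = lieDeriv L (rep f) x := rfl

@[simp] lemma fieldDerivation_restr (L : E →L[ℝ] E) {g : E → ℝ} (hg : ContDiffOn ℝ ∞ g Ω) :
    fieldDerivation Ω L (restr hg) = restr (contDiffOn_lieDeriv Ω.isOpen L hg) :=
  smoothFun_ext fun x => lieDeriv_congr L (fun y hy => rep_apply _ ⟨y, hy⟩) x

lemma lieDeriv_lieDeriv_sub (L₁ L₂ : E →L[ℝ] E) {f : E → ℝ} {x : E}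
    (hf : ContDiffAt ℝ ∞ f x) :
    lieDeriv L₁ (lieDeriv L₂ f) x - lieDeriv L₂ (lieDeriv L₁ f) x
      = fderiv ℝ f x (L₂ (L₁ x) - L₁ (L₂ x)) := by
  have hd : DifferentiableAt ℝ (fderiv ℝ f) x :=
    (hf.fderiv_right (m := 1) (by norm_cast)).differentiableAt (by simp)
  have hsymm : IsSymmSndFDerivAt ℝ f x := hf.isSymmSndFDerivAt (by simp; norm_cast)
  have key : ∀ A B : E →L[ℝ] E, lieDeriv A (lieDeriv B f) x
      = fderiv ℝ (fderiv ℝ f) x (A x) (B x) + fderiv ℝ f x (B (A x)) := by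
    intro A B
    have : HasFDerivAt (lieDeriv B f) _ x := hd.hasFDerivAt.clm_apply B.hasFDerivAt
    rw [lieDeriv, this.fderiv]
    simp [add_comm]
  rw [key, key, hsymm.eq (L₁ x) (L₂ x), map_sub]
  ring

/-- The commutator of two linear vector fields is the linear vector field of the commutator. -/
lemma fieldDerivation_bracket (L₁ L₂ : E →L[ℝ] E) (f : smoothFun Ω) :
    fieldDerivation Ω L₁ (fieldDerivation Ω L₂ f) - fieldDerivation Ω L₂ (fieldDerivation Ω L₁ f)
      = fieldDerivation Ω (L₂.comp L₁ - L₁.comp L₂) f := by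
  obtain ⟨_, g, hg, h⟩ := f
  obtain rfl : _ = fun x : Ω => g x := funext h
  change fieldDerivation Ω L₁ (fieldDerivation Ω L₂ (restr hg)) -
    fieldDerivation Ω L₂ (fieldDerivation Ω L₁ (restr hg)) = fieldDerivation Ω _ (restr hg)
  rw [fieldDerivation_restr, fieldDerivation_restr, fieldDerivation_restr, fieldDerivation_restr,
    fieldDerivation_restr]
  exact smoothFun_ext fun x =>
    lieDeriv_lieDeriv_sub L₁ L₂ (hg.contDiffAt (Ω.isOpen.mem_nhds x.2))

/-- A function without zeros is invertible. -/
lemma exists_inverse (f : smoothFun Ω) (hf : ∀ x, f.1 x ≠ 0) : ∃ g, f * g = 1 := by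
  have h : ∀ x ∈ Ω, rep f x ≠ 0 := fun x hx => by rw [rep_apply f ⟨x, hx⟩]; exact hf _
  refine ⟨restr ((contDiffOn_rep f).inv h), smoothFun_ext fun x => ?_⟩
  change f.1 x * (rep f x)⁻¹ = 1
  rw [rep_apply]
  exact mul_inv_cancel₀ (hf x)

lemma isUnit_of_ne_zero (f : smoothFun Ω) (hf : ∀ x, f.1 x ≠ 0) : IsUnit f :=
  let ⟨_, h⟩ := exists_inverse f hf
  IsUnit.of_mul_eq_one _ h

instance : IsReduced (smoothFun Ω) :=
  ⟨fun _ ⟨n, hn⟩ => smoothFun_ext fun x =>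
    eq_zero_of_pow_eq_zero (n := n) (congrFun (congrArg Subtype.val hn) x)⟩

end SmoothFun

/-! ### The right-invariant frame -/

/-- Left multiplication by the quaternion `i`, whose field is the Hopf field. -/
def frame₁ : ℂ × ℂ →L[ℝ] ℂ × ℂ := LinearMap.toContinuousLinearMap
  { toFun := fun q => (Complex.I * q.1, Complex.I * q.2)
    map_add' := fun p q => by ext <;> simp <;> ring
    map_smul' := fun r q => by ext <;> simp [mul_left_comm] }

/-- Left multiplication by the quaternion `j`, where `(z, w)` stands for `z + w j`. -/
def frame₂ : ℂ × ℂ →L[ℝ] ℂ × ℂ := LinearMap.toContinuousLinearMap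
  { toFun := fun q => (-(starRingEnd ℂ) q.2, (starRingEnd ℂ) q.1)
    map_add' := fun p q => by ext <;> simp <;> ring
    map_smul' := fun r q => by ext <;> simp [mul_left_comm] }

/-- Left multiplication by the quaternion `k`. -/
def frame₃ : ℂ × ℂ →L[ℝ] ℂ × ℂ := LinearMap.toContinuousLinearMap
  { toFun := fun q => (-(Complex.I * (starRingEnd ℂ) q.2), Complex.I * (starRingEnd ℂ) q.1)
    map_add' := fun p q => by ext <;> simp <;> ring
    map_smul' := fun r q => by ext <;> simp [mul_left_comm] }

lemma frame₁_apply (q : ℂ × ℂ) : frame₁ q = (Complex.I * q.1, Complex.I * q.2) := rfl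
lemma frame₂_apply (q : ℂ × ℂ) :
    frame₂ q = (-(starRingEnd ℂ) q.2, (starRingEnd ℂ) q.1) := rfl
lemma frame₃_apply (q : ℂ × ℂ) :
    frame₃ q = (-(Complex.I * (starRingEnd ℂ) q.2), Complex.I * (starRingEnd ℂ) q.1) := rfl

lemma frame_comm₂₃ : frame₃.comp frame₂ - frame₂.comp frame₃ = (-2 : ℝ) • frame₁ := by
  ext q <;> simp [frame₁_apply, frame₂_apply, frame₃_apply] <;> ring_nf

lemma frame_comm₃₁ : frame₁.comp frame₃ - frame₃.comp frame₁ = (-2 : ℝ) • frame₂ := by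
  ext q <;> simp [frame₁_apply, frame₂_apply, frame₃_apply] <;> ring_nf <;> simp

lemma frame_comm₁₂ : frame₂.comp frame₁ - frame₁.comp frame₂ = (-2 : ℝ) • frame₃ := by
  ext q <;> simp [frame₁_apply, frame₂_apply, frame₃_apply] <;> ring_nf

/-! ### Riemannian flows on open sets are projectively Killing -/

/-- The smooth field `V = v₁ E₁ + v₂ E₂ + v₃ E₃` on `Ω`, in terms of the right-invariant frame, has
unit length for the metric `τ² η₁² + η₂² + η₃²`, and `⟨∇_a V, a⟩ = 0` for all `a` orthogonal to
`V`. -/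
structure IsRiemannianFlow (τ : ℝ) (Ω : TopologicalSpace.Opens (ℂ × ℂ)) (v₁ v₂ v₃ : ℂ × ℂ → ℝ) :
    Prop where
  smooth₁ : ContDiffOn ℝ ∞ v₁ Ω
  smooth₂ : ContDiffOn ℝ ∞ v₂ Ω
  smooth₃ : ContDiffOn ℝ ∞ v₃ Ω
  unit : ∀ q ∈ Ω, τ ^ 2 * v₁ q ^ 2 + v₂ q ^ 2 + v₃ q ^ 2 = 1
  riemannian : ∀ q ∈ Ω, ∀ a₁ a₂ a₃ : ℝ, τ ^ 2 * a₁ * v₁ q + a₂ * v₂ q + a₃ * v₃ q = 0 →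
    τ ^ 2 * a₁ * (a₁ * lieDeriv frame₁ v₁ q + a₂ * lieDeriv frame₂ v₁ q + a₃ * lieDeriv frame₃ v₁ q)
      + a₂ * (a₁ * lieDeriv frame₁ v₂ q + a₂ * lieDeriv frame₂ v₂ q + a₃ * lieDeriv frame₃ v₂ q)
      + a₃ * (a₁ * lieDeriv frame₁ v₃ q + a₂ * lieDeriv frame₂ v₃ q + a₃ * lieDeriv frame₃ v₃ q)
      + (2 * τ ^ 2 - 2) * a₁ * (v₂ q * a₃ - v₃ q * a₂) = 0

/-- Pointwise form of `RiemannianFlow.killingPart`. -/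
def killFun (τ : ℝ) (v₁ v₂ v₃ : ℂ × ℂ → ℝ) (q : ℂ × ℂ) : ℝ :=
  v₃ q * (v₁ q * lieDeriv frame₁ v₂ q + v₂ q * lieDeriv frame₂ v₂ q + v₃ q * lieDeriv frame₃ v₂ q)
  - v₂ q * (v₁ q * lieDeriv frame₁ v₃ q + v₂ q * lieDeriv frame₂ v₃ q + v₃ q * lieDeriv frame₃ v₃ q)
  - (2 * τ ^ 2 - 2) * v₁ q * (v₂ q ^ 2 + v₃ q ^ 2) - (lieDeriv frame₂ v₃ q - lieDeriv frame₃ v₂ q)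

/-- The coefficients `(a, u₁, u₂, u₃)` of an infinitesimal isometry
`x ↦ a i x + x q⁻¹ (u₁ i + u₂ j + u₃ k) q` that agrees at `x = q` with four times the field `v`. -/
def killTuple (τ : ℝ) (v₁ v₂ v₃ : ℂ × ℂ → ℝ) (q : ℂ × ℂ) : Fin 4 → ℝ :=
  ![4 * v₁ q - killFun τ v₁ v₂ v₃ q, killFun τ v₁ v₂ v₃ q, 4 * v₂ q, 4 * v₃ q]

/-- The derivatives along the frame of a tuple `(a, u)`, corrected by the derivative
`2 u × e_j` of the right-invariant fields in the left-invariant frame. -/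
def tupleDeriv (M : ℂ × ℂ → Fin 4 → ℝ) (q : ℂ × ℂ) : Fin 3 → Fin 4 → ℝ :=
  ![![lieDeriv frame₁ (fun x => M x 0) q, lieDeriv frame₁ (fun x => M x 1) q,
      lieDeriv frame₁ (fun x => M x 2) q + 2 * M q 3,
      lieDeriv frame₁ (fun x => M x 3) q - 2 * M q 2],
    ![lieDeriv frame₂ (fun x => M x 0) q, lieDeriv frame₂ (fun x => M x 1) q - 2 * M q 3,
      lieDeriv frame₂ (fun x => M x 2) q,
      lieDeriv frame₂ (fun x => M x 3) q + 2 * M q 1],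
    ![lieDeriv frame₃ (fun x => M x 0) q, lieDeriv frame₃ (fun x => M x 1) q + 2 * M q 2,
      lieDeriv frame₃ (fun x => M x 2) q - 2 * M q 1,
      lieDeriv frame₃ (fun x => M x 3) q]]

namespace IsRiemannianFlow

variable {τ : ℝ} {Ω : TopologicalSpace.Opens (ℂ × ℂ)} {v₁ v₂ v₃ : ℂ × ℂ → ℝ}

lemma mono (h : IsRiemannianFlow τ Ω v₁ v₂ v₃) {Ω' : TopologicalSpace.Opens (ℂ × ℂ)} (hΩ : Ω' ≤ Ω) :
    IsRiemannianFlow τ Ω' v₁ v₂ v₃ where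
  smooth₁ := h.smooth₁.mono hΩ
  smooth₂ := h.smooth₂.mono hΩ
  smooth₃ := h.smooth₃.mono hΩ
  unit q hq := h.unit q (hΩ hq)
  riemannian q hq := h.riemannian q (hΩ hq)

lemma fieldDerivation_smul (L : ℂ × ℂ →L[ℝ] ℂ × ℂ) (r : ℝ) (f : smoothFun Ω) :
    fieldDerivation Ω (r • L) f = r • fieldDerivation Ω L f :=
  smoothFun_ext fun x => by
    change fderiv ℝ _ _ (r • L x) = r * fderiv ℝ _ _ (L x)
    rw [map_smul, smul_eq_mul]

/-- The algebraic structure carried by a Riemannian flow. -/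
def toFlow (h : IsRiemannianFlow τ Ω v₁ v₂ v₃) (hτ : τ ≠ 0) : RiemannianFlow (smoothFun Ω) where
  e₁ := τ⁻¹ • fieldDerivation Ω frame₁
  e₂ := fieldDerivation Ω frame₂
  e₃ := fieldDerivation Ω frame₃
  t := algebraMap ℝ _ τ
  ti := algebraMap ℝ _ τ⁻¹
  w₁ := τ • restr h.smooth₁
  w₂ := restr h.smooth₂
  w₃ := restr h.smooth₃
  ht := by rw [← map_mul, mul_inv_cancel₀ hτ, map_one]
  e₁_t := by simp
  e₂_t := by simp
  e₃_t := by simp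
  bracket₂₃ f := by
    rw [fieldDerivation_bracket, frame_comm₂₃, fieldDerivation_smul]
    refine smoothFun_ext fun x => ?_
    change (-2) * _ = -((2 * τ) * (τ⁻¹ * _))
    field_simp
    rfl
  bracket₃₁ f := by
    have := fieldDerivation_bracket frame₃ frame₁ f
    rw [frame_comm₃₁, fieldDerivation_smul] at this
    have h2 := congrArg (fun z => τ⁻¹ • z) this
    simp only [smul_sub] at h2
    rw [Derivation.smul_apply, Derivation.smul_apply, Derivation.map_smul, h2]
    refine smoothFun_ext fun x => ?_
    change τ⁻¹ * ((-2) * _) = -((2 * τ⁻¹) * _)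
    ring
  bracket₁₂ f := by
    have := fieldDerivation_bracket frame₁ frame₂ f
    rw [frame_comm₁₂, fieldDerivation_smul] at this
    have h2 := congrArg (fun z => τ⁻¹ • z) this
    simp only [smul_sub] at h2
    rw [Derivation.smul_apply, Derivation.smul_apply, Derivation.map_smul, h2]
    refine smoothFun_ext fun x => ?_
    change τ⁻¹ * ((-2) * _) = -((2 * τ⁻¹) * _)
    ring
  unit := smoothFun_ext fun x => by
    have := h.unit x x.2
    change (τ * v₁ x) ^ 2 + v₂ x ^ 2 + v₃ x ^ 2 = 1
    rw [← this]; ring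
  riemannian a₁ a₂ a₃ ha := smoothFun_ext fun x => by
    have hx : a₁.1 x * (τ * v₁ x) + a₂.1 x * v₂ x + a₃.1 x * v₃ x = 0 :=
      congrFun (congrArg Subtype.val ha) x
    have := h.riemannian x x.2 (τ⁻¹ * a₁.1 x) (a₂.1 x) (a₃.1 x) (by
      rw [← hx]; field_simp)
    simp only [Derivation.smul_apply, Derivation.map_smul, fieldDerivation_restr]
    change a₁.1 x * (a₁.1 x * (τ * (τ⁻¹ * lieDeriv frame₁ v₁ x))
      + a₂.1 x * (τ * lieDeriv frame₂ v₁ x) + a₃.1 x * (τ * lieDeriv frame₃ v₁ x))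
      + a₂.1 x * (a₁.1 x * (τ⁻¹ * lieDeriv frame₁ v₂ x)
      + a₂.1 x * (lieDeriv frame₂ v₂ x) + a₃.1 x * (lieDeriv frame₃ v₂ x))
      + a₃.1 x * (a₁.1 x * (τ⁻¹ * lieDeriv frame₁ v₃ x)
      + a₂.1 x * (lieDeriv frame₂ v₃ x) + a₃.1 x * (lieDeriv frame₃ v₃ x))
      + (2 * τ - 2 * τ⁻¹) * a₁.1 x * (v₂ x * a₃.1 x - v₃ x * a₂.1 x) = 0
    rw [← this]
    field_simp

lemma contDiffOn_killFun (h : IsRiemannianFlow τ Ω v₁ v₂ v₃) :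
    ContDiffOn ℝ ∞ (killFun τ v₁ v₂ v₃) Ω := by
  have d := fun (L : ℂ × ℂ →L[ℝ] ℂ × ℂ) => contDiffOn_lieDeriv Ω.isOpen L h.smooth₂
  have d' := fun (L : ℂ × ℂ →L[ℝ] ℂ × ℂ) => contDiffOn_lieDeriv Ω.isOpen L h.smooth₃
  have h₁ := h.smooth₁
  have h₂ := h.smooth₂
  have h₃ := h.smooth₃
  exact (((h₃.mul (((h₁.mul (d _)).add (h₂.mul (d _))).add (h₃.mul (d _)))).sub
    (h₂.mul (((h₁.mul (d' _)).add (h₂.mul (d' _))).add (h₃.mul (d' _))))).sub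
    ((contDiffOn_const.mul h₁).mul ((h₂.pow 2).add (h₃.pow 2)))).sub ((d' _).sub (d _))

lemma contDiffOn_killTuple (h : IsRiemannianFlow τ Ω v₁ v₂ v₃) (a : Fin 4) :
    ContDiffOn ℝ ∞ (fun x => killTuple τ v₁ v₂ v₃ x a) Ω := by
  fin_cases a
  · exact (contDiffOn_const.mul h.smooth₁).sub h.contDiffOn_killFun
  · exact h.contDiffOn_killFun
  · exact contDiffOn_const.mul h.smooth₂
  · exact contDiffOn_const.mul h.smooth₃

lemma killingPart_toFlow (h : IsRiemannianFlow τ Ω v₁ v₂ v₃) (hτ : τ ≠ 0) :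
    (h.toFlow hτ).killingPart = restr h.contDiffOn_killFun := by
  refine smoothFun_ext fun x => ?_
  simp only [RiemannianFlow.killingPart, RiemannianFlow.meanCurv, RiemannianFlow.V,
    RiemannianFlow.combo_apply, toFlow, Derivation.smul_apply, fieldDerivation_restr,
    RiemannianFlow.normSqU]
  change v₃ x * ((τ * v₁ x) * (τ⁻¹ * lieDeriv frame₁ v₂ x) + v₂ x * lieDeriv frame₂ v₂ x
      + v₃ x * lieDeriv frame₃ v₂ x)
    - v₂ x * ((τ * v₁ x) * (τ⁻¹ * lieDeriv frame₁ v₃ x) + v₂ x * lieDeriv frame₂ v₃ x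
      + v₃ x * lieDeriv frame₃ v₃ x)
    - (2 * τ - 2 * τ⁻¹) * (τ * v₁ x) * (v₂ x ^ 2 + v₃ x ^ 2)
    - (lieDeriv frame₂ v₃ x - lieDeriv frame₃ v₂ x) = killFun τ v₁ v₂ v₃ x
  rw [killFun]
  field_simp

/-- The tuple and its corrected derivatives are proportional where the flow is. -/
lemma tupleDeriv_of_isProjParallel (h : IsRiemannianFlow τ Ω v₁ v₂ v₃) (hτ : τ ≠ 0)
    {κ₁ κ₂ κ₃ : smoothFun Ω} (hκ : (h.toFlow hτ).IsProjParallel κ₁ κ₂ κ₃) (x : Ω) (i : Fin 3) :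
    ∃ κ : ℝ, tupleDeriv (killTuple τ v₁ v₂ v₃) x i = κ • killTuple τ v₁ v₂ v₃ x := by
  have hk := h.killingPart_toFlow hτ
  have hM0 : 4 * (h.toFlow hτ).ti * (h.toFlow hτ).w₁ - restr h.contDiffOn_killFun
      = restr (h.contDiffOn_killTuple 0) := by
    refine smoothFun_ext fun x => ?_
    change 4 * τ⁻¹ * (τ * v₁ x) - killFun τ v₁ v₂ v₃ x = 4 * v₁ x - killFun τ v₁ v₂ v₃ x
    field_simp
  obtain ⟨a₁, a₂, a₃, u₁₁, u₁₂, u₁₃, u₂₁, u₂₂, u₂₃, u₃₁, u₃₂, u₃₃⟩ := hκ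
  rw [hk] at u₁₁ u₂₁ u₂₃ u₃₁ u₃₂
  rw [hk, hM0] at a₁ a₂ a₃
  simp only [toFlow, Derivation.smul_apply, fieldDerivation_restr] at *
  have ev : ∀ {f g : smoothFun Ω}, f = g → f.1 x = g.1 x := fun h => by rw [h]
  have hfour : ∀ (L : ℂ × ℂ →L[ℝ] ℂ × ℂ) {f : ℂ × ℂ → ℝ} (hf : ContDiffOn ℝ ∞ f Ω),
      lieDeriv L (fun y => 4 * f y) x = 4 * lieDeriv L f x := fun L f hf => by
    rw [lieDeriv, fderiv_const_mul (differentiableAt_of_mem hf x)]; rfl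
  have f2 := fun L => hfour L h.smooth₂
  have f3 := fun L => hfour L h.smooth₃
  fin_cases i
  · refine ⟨τ * κ₁.1 x, ?_⟩
    have a₁ : τ⁻¹ * lieDeriv frame₁ (fun x => killTuple τ v₁ v₂ v₃ x 0) x
      = κ₁.1 x * killTuple τ v₁ v₂ v₃ x 0 := ev a₁
    have u₁ : τ⁻¹ * lieDeriv frame₁ (killFun τ v₁ v₂ v₃) x = κ₁.1 x * killFun τ v₁ v₂ v₃ x := ev u₁₁
    have u₂ : τ⁻¹ * lieDeriv frame₁ v₂ x + 2 * τ⁻¹ * v₃ x = κ₁.1 x * v₂ x := ev u₁₂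
    have u₃ : τ⁻¹ * lieDeriv frame₁ v₃ x - 2 * τ⁻¹ * v₂ x = κ₁.1 x * v₃ x := ev u₁₃
    funext a
    fin_cases a
    · change lieDeriv frame₁ (fun x => killTuple τ v₁ v₂ v₃ x 0) x
        = τ * κ₁.1 x * killTuple τ v₁ v₂ v₃ x 0
      rw [mul_assoc, ← a₁]; field_simp
    · change lieDeriv frame₁ (killFun τ v₁ v₂ v₃) x = τ * κ₁.1 x * killFun τ v₁ v₂ v₃ x
      rw [mul_assoc, ← u₁]; field_simp
    · change lieDeriv frame₁ (fun y => 4 * v₂ y) x + 2 * (4 * v₃ x) = τ * κ₁.1 x * (4 * v₂ x)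
      rw [f2, show τ * κ₁.1 x * (4 * v₂ x) = 4 * τ * (κ₁.1 x * v₂ x) by ring, ← u₂]; field_simp
    · change lieDeriv frame₁ (fun y => 4 * v₃ y) x - 2 * (4 * v₂ x) = τ * κ₁.1 x * (4 * v₃ x)
      rw [f3, show τ * κ₁.1 x * (4 * v₃ x) = 4 * τ * (κ₁.1 x * v₃ x) by ring, ← u₃]; field_simp
  · refine ⟨κ₂.1 x, ?_⟩
    have a₁ : lieDeriv frame₂ (fun x => killTuple τ v₁ v₂ v₃ x 0) x
      = κ₂.1 x * killTuple τ v₁ v₂ v₃ x 0 := ev a₂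
    have u₁ : lieDeriv frame₂ (killFun τ v₁ v₂ v₃) x - 8 * v₃ x = κ₂.1 x * killFun τ v₁ v₂ v₃ x :=
      ev u₂₁
    have u₂ : lieDeriv frame₂ v₂ x = κ₂.1 x * v₂ x := ev u₂₂
    have u₃ : 4 * lieDeriv frame₂ v₃ x + 2 * killFun τ v₁ v₂ v₃ x = 4 * κ₂.1 x * v₃ x := ev u₂₃
    funext a
    fin_cases a
    · exact a₁
    · change lieDeriv frame₂ (killFun τ v₁ v₂ v₃) x - 2 * (4 * v₃ x) = κ₂.1 x * killFun τ v₁ v₂ v₃ x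
      rw [← u₁]; ring
    · change lieDeriv frame₂ (fun y => 4 * v₂ y) x = κ₂.1 x * (4 * v₂ x)
      rw [f2, u₂]; ring
    · change lieDeriv frame₂ (fun y => 4 * v₃ y) x + 2 * killFun τ v₁ v₂ v₃ x
        = κ₂.1 x * (4 * v₃ x)
      rw [f3, u₃]; ring
  · refine ⟨κ₃.1 x, ?_⟩
    have a₁ : lieDeriv frame₃ (fun x => killTuple τ v₁ v₂ v₃ x 0) x
      = κ₃.1 x * killTuple τ v₁ v₂ v₃ x 0 := ev a₃
    have u₁ : lieDeriv frame₃ (killFun τ v₁ v₂ v₃) x + 8 * v₂ x = κ₃.1 x * killFun τ v₁ v₂ v₃ x :=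
      ev u₃₁
    have u₂ : 4 * lieDeriv frame₃ v₂ x - 2 * killFun τ v₁ v₂ v₃ x = 4 * κ₃.1 x * v₂ x := ev u₃₂
    have u₃ : lieDeriv frame₃ v₃ x = κ₃.1 x * v₃ x := ev u₃₃
    funext a
    fin_cases a
    · exact a₁
    · change lieDeriv frame₃ (killFun τ v₁ v₂ v₃) x + 2 * (4 * v₂ x) = κ₃.1 x * killFun τ v₁ v₂ v₃ x
      rw [← u₁]; ring
    · change lieDeriv frame₃ (fun y => 4 * v₂ y) x - 2 * killFun τ v₁ v₂ v₃ x
        = κ₃.1 x * (4 * v₂ x)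
      rw [f2, u₂]; ring
    · change lieDeriv frame₃ (fun y => 4 * v₃ y) x = κ₃.1 x * (4 * v₃ x)
      rw [f3, u₃]; ring

/-- The points of an open set where a smooth function does not vanish. -/
def nonvanishing (f : smoothFun Ω) : TopologicalSpace.Opens (ℂ × ℂ) :=
  ⟨{x | x ∈ Ω ∧ rep f x ≠ 0}, by
    exact (contDiffOn_rep f).continuousOn.isOpen_inter_preimage Ω.isOpen
      (t := {y : ℝ | y ≠ 0}) isOpen_ne⟩

lemma nonvanishing_le (f : smoothFun Ω) : nonvanishing f ≤ Ω := fun _ hx => hx.1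

lemma V_w₁_apply (h : IsRiemannianFlow τ Ω v₁ v₂ v₃) (hτ : τ ≠ 0) (x : Ω) :
    ((h.toFlow hτ).V (h.toFlow hτ).w₁).1 x = τ * (v₁ x * lieDeriv frame₁ v₁ x
      + v₂ x * lieDeriv frame₂ v₁ x + v₃ x * lieDeriv frame₃ v₁ x) := by
  simp only [RiemannianFlow.V, RiemannianFlow.combo_apply, toFlow, Derivation.smul_apply,
    fieldDerivation_restr, Derivation.map_smul]
  change τ * ((τ * v₁ x) * (τ⁻¹ * lieDeriv frame₁ v₁ x) + v₂ x * lieDeriv frame₂ v₁ x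
    + v₃ x * lieDeriv frame₃ v₁ x) = _
  field_simp

/-- Some point of every nonempty open set satisfies the conclusion of the algebraic analysis: pass
to an open subset where `V` is nowhere (or everywhere) parallel to the Hopf field, and to one where
the Hopf component of the mean curvature has no zeros, if that is possible. -/
lemma exists_tupleDeriv (h : IsRiemannianFlow τ Ω v₁ v₂ v₃) (hτ : 0 < τ) (hτ1 : τ ≠ 1)
    (hne : (Ω : Set (ℂ × ℂ)).Nonempty) : ∃ x ∈ Ω, ∀ i : Fin 3,
    ∃ κ : ℝ, tupleDeriv (killTuple τ v₁ v₂ v₃) x i = κ • killTuple τ v₁ v₂ v₃ x := by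
  have hD : (4 - 4 * τ ^ 2) ≠ 0 := by
    intro h0
    have h1 : (1 - τ) * (1 + τ) = 0 := by linarith
    rcases mul_eq_zero.mp h1 with h2 | h2
    · exact hτ1 (by linarith)
    · linarith
  by_cases hN : ∀ x : Ω, (h.toFlow hτ.ne').normSqU.1 x = 0
  · obtain ⟨x, hx⟩ := hne
    refine ⟨x, hx, fun i => h.tupleDeriv_of_isProjParallel hτ.ne'
      ((h.toFlow hτ.ne').isProjParallel_of_eq_zero ?_ ?_) ⟨x, hx⟩ i⟩
    all_goals
      refine smoothFun_ext fun y => ?_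
      have hy : v₂ y ^ 2 + v₃ y ^ 2 = 0 := hN y
    · change v₂ y = 0
      nlinarith [sq_nonneg (v₂ y), sq_nonneg (v₃ y)]
    · change v₃ y = 0
      nlinarith [sq_nonneg (v₂ y), sq_nonneg (v₃ y)]
  push Not at hN
  obtain ⟨x₀, hx₀⟩ := hN
  set Ω₂ := nonvanishing (h.toFlow hτ.ne').normSqU with hΩ₂
  have h₂ := h.mono (nonvanishing_le (h.toFlow hτ.ne').normSqU)
  rw [← hΩ₂] at h₂
  have hx₂ : (x₀ : ℂ × ℂ) ∈ Ω₂ := ⟨x₀.2, by rwa [rep_apply]⟩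
  have hN₂ : ∀ x : Ω₂, v₂ x ^ 2 + v₃ x ^ 2 ≠ 0 := fun x => by
    have := x.2.2
    rw [rep_eq _ x.2.1] at this
    exact this
  obtain ⟨iN, hiN⟩ := exists_inverse (h₂.toFlow hτ.ne').normSqU hN₂
  set F := (h₂.toFlow hτ.ne').flowFrame iN hiN with hF
  have hP : F.P = 0 := by
    by_contra hP
    obtain ⟨x₁, hx₁⟩ : ∃ x, F.P.1 x ≠ 0 := by
      by_contra hcon
      push Not at hcon
      exact hP (smoothFun_ext hcon)
    set Ω₃ := nonvanishing F.P with hΩ₃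
    have h₃ := h₂.mono (nonvanishing_le F.P)
    rw [← hΩ₃] at h₃
    have hx₃ : (x₁ : ℂ × ℂ) ∈ Ω₃ := ⟨x₁.2, by rwa [rep_apply]⟩
    obtain ⟨iN', hiN'⟩ := exists_inverse (h₃.toFlow hτ.ne').normSqU fun x => hN₂ ⟨x, x.2.1⟩
    have : Nontrivial (smoothFun Ω₃) := by
      refine ⟨0, 1, fun h01 => ?_⟩
      have : (0 : ℝ) = 1 := congrFun (congrArg Subtype.val h01) ⟨x₁, hx₃⟩
      norm_num at this
    refine ((h₃.toFlow hτ.ne').flowFrame iN' hiN').not_isUnit_P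
      (isUnit_of_ne_zero _ fun x => hD) (isUnit_of_ne_zero _ fun x h0 => ?_)
    -- `P N = V w₁` on both open sets, so the two functions `P` vanish simultaneously
    have e₃ := congrFun (congrArg Subtype.val ((h₃.toFlow hτ.ne').flowFrame iN' hiN').V_c) x
    have e₂ := congrFun (congrArg Subtype.val F.V_c) ⟨x, x.2.1⟩
    have e₃' := (h₃.V_w₁_apply hτ.ne' x).symm.trans e₃
    have e₂' := (h₂.V_w₁_apply hτ.ne' ⟨x, x.2.1⟩).symm.trans e₂
    have hPx : F.P.1 ⟨x, x.2.1⟩ ≠ 0 := by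
      have := x.2.2
      rwa [rep_eq _ x.2.1] at this
    have e₄ : F.P.1 ⟨x, x.2.1⟩ * (v₂ x ^ 2 + v₃ x ^ 2) = 0 := by
      refine Eq.trans ?_ (e₂'.symm.trans (e₃'.trans ?_))
      · rfl
      · change ((h₃.toFlow hτ.ne').flowFrame iN' hiN').P.1 x * _ = 0
        rw [h0, zero_mul]
    exact mul_ne_zero hPx (hN₂ ⟨x, x.2.1⟩) e₄
  have hT := F.bracket_coeff_eq_zero (isUnit_of_ne_zero _ fun x => hD)
    (isUnit_of_ne_zero _ fun x => by
      change τ ^ 2 * (v₂ x ^ 2 + v₃ x ^ 2) + (τ * v₁ x) ^ 2 ≠ 0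
      have h1 : 0 < v₂ x ^ 2 + v₃ x ^ 2 :=
        lt_of_le_of_ne (by positivity) (hN₂ x).symm
      positivity) hP
  exact ⟨x₀, x₀.2, fun i => h₂.tupleDeriv_of_isProjParallel hτ.ne'
    ((h₂.toFlow hτ.ne').isProjParallel_of_isUnit hiN hP hT) ⟨x₀, hx₂⟩ i⟩

lemma killTuple_ne_zero (h : IsRiemannianFlow τ Ω v₁ v₂ v₃) {q : ℂ × ℂ} (hq : q ∈ Ω) :
    killTuple τ v₁ v₂ v₃ q ≠ 0 := by
  intro h0
  have e0 : 4 * v₁ q - killFun τ v₁ v₂ v₃ q = 0 := congrFun h0 0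
  have e1 : killFun τ v₁ v₂ v₃ q = 0 := congrFun h0 1
  have e2 : 4 * v₂ q = 0 := congrFun h0 2
  have e3 : 4 * v₃ q = 0 := congrFun h0 3
  have := h.unit q hq
  rw [show v₁ q = 0 by linarith, show v₂ q = 0 by linarith, show v₃ q = 0 by linarith] at this
  norm_num at this

/-- The tuple of a Riemannian flow of a Berger sphere that is not round is parallel up to a
factor. -/
theorem tupleDeriv_eq_smul (h : IsRiemannianFlow τ Ω v₁ v₂ v₃) (hτ : 0 < τ) (hτ1 : τ ≠ 1)
    {q : ℂ × ℂ} (hq : q ∈ Ω) (i : Fin 3) :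
    ∃ κ : ℝ, tupleDeriv (killTuple τ v₁ v₂ v₃) q i = κ • killTuple τ v₁ v₂ v₃ q := by
  set M := killTuple τ v₁ v₂ v₃ with hM
  have hMc : ∀ a, ContinuousOn (fun x => M x a) Ω := fun a =>
    (h.contDiffOn_killTuple a).continuousOn
  have hLc : ∀ (L : ℂ × ℂ →L[ℝ] ℂ × ℂ) a, ContinuousOn (fun x => lieDeriv L (fun y => M y a) x) Ω :=
    fun L a => (contDiffOn_lieDeriv Ω.isOpen L (h.contDiffOn_killTuple a)).continuousOn
  have hDc : ∀ b, ContinuousOn (fun x => tupleDeriv M x i b) Ω := by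
    intro b
    have c2 : ∀ a, ContinuousOn (fun x => 2 * M x a) Ω := fun a => continuousOn_const.mul (hMc a)
    fin_cases i <;> fin_cases b
    · exact hLc _ _
    · exact hLc _ _
    · exact (hLc _ _).add (c2 _)
    · exact (hLc _ _).sub (c2 _)
    · exact hLc _ _
    · exact (hLc _ _).sub (c2 _)
    · exact hLc _ _
    · exact (hLc _ _).add (c2 _)
    · exact hLc _ _
    · exact (hLc _ _).add (c2 _)
    · exact (hLc _ _).sub (c2 _)
    · exact hLc _ _
  have hcross : ∀ a b, M q a * tupleDeriv M q i b = M q b * tupleDeriv M q i a := by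
    intro a b
    by_contra hne
    have hopen : IsOpen ((Ω : Set (ℂ × ℂ)) ∩ {x | M x a * tupleDeriv M x i b
        - M x b * tupleDeriv M x i a ∈ ({0}ᶜ : Set ℝ)}) :=
      (((hMc a).mul (hDc b)).sub ((hMc b).mul (hDc a))).isOpen_inter_preimage Ω.isOpen
        isOpen_compl_singleton
    obtain ⟨x, hx, hκ⟩ := (h.mono (Ω' := ⟨_, hopen⟩) (fun y hy => hy.1)).exists_tupleDeriv hτ hτ1
      ⟨q, hq, sub_ne_zero.mpr hne⟩
    obtain ⟨κ, hκ⟩ := hκ i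
    apply hx.2
    rw [← hM] at hκ
    change M x a * tupleDeriv M x i b - M x b * tupleDeriv M x i a = 0
    rw [hκ]
    simp only [Pi.smul_apply, smul_eq_mul]
    ring
  obtain ⟨a, ha⟩ := Function.ne_iff.mp (h.killTuple_ne_zero hq)
  rw [← hM] at ha
  refine ⟨tupleDeriv M q i a / M q a, funext fun b => ?_⟩
  have := hcross a b
  simp only [Pi.smul_apply, smul_eq_mul]
  have ha' : M q a ≠ 0 := ha
  field_simp
  linarith

end IsRiemannianFlow

/-! ### From a projectively parallel tuple to an infinitesimal isometry -/

section

lemma euclInner_eq (v w : ℂ × ℂ) : euclInner v w =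
    v.1.re * w.1.re + v.1.im * w.1.im + v.2.re * w.2.re + v.2.im * w.2.im := by
  simp [euclInner]; ring

lemma euclInner_add_left (u v w : ℂ × ℂ) :
    euclInner (u + v) w = euclInner u w + euclInner v w := by
  simp only [euclInner_eq, Prod.fst_add, Prod.snd_add, Complex.add_re, Complex.add_im]; ring

lemma euclInner_add_right (u v w : ℂ × ℂ) :
    euclInner u (v + w) = euclInner u v + euclInner u w := by
  simp only [euclInner_eq, Prod.fst_add, Prod.snd_add, Complex.add_re, Complex.add_im]; ring

lemma euclInner_smul_left (r : ℝ) (v w : ℂ × ℂ) :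
    euclInner (r • v) w = r * euclInner v w := by
  simp only [euclInner_eq, Prod.smul_fst, Prod.smul_snd, Complex.smul_re, Complex.smul_im,
    smul_eq_mul]; ring

lemma euclInner_smul_right (r : ℝ) (v w : ℂ × ℂ) :
    euclInner v (r • w) = r * euclInner v w := by
  simp only [euclInner_eq, Prod.smul_fst, Prod.smul_snd, Complex.smul_re, Complex.smul_im,
    smul_eq_mul]; ring

lemma euclInner_comm (v w : ℂ × ℂ) : euclInner v w = euclInner w v := by
  simp only [euclInner_eq]; ring

lemma contDiff_euclInner {n : WithTop ℕ∞} :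
    ContDiff ℝ n (fun x : (ℂ × ℂ) × (ℂ × ℂ) => euclInner x.1 x.2) := by
  have hre : ContDiff ℝ n Complex.re := Complex.reCLM.contDiff
  have him : ContDiff ℝ n Complex.im := Complex.imCLM.contDiff
  simp only [euclInner_eq]
  fun_prop

lemma euclInner_self_pos {v : ℂ × ℂ} (hv : v ≠ 0) : 0 < euclInner v v := by
  rw [euclInner_eq]
  by_contra h
  apply hv
  have h1 := mul_self_nonneg v.1.re
  have h2 := mul_self_nonneg v.1.im
  have h3 := mul_self_nonneg v.2.re
  have h4 := mul_self_nonneg v.2.im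
  apply Prod.ext <;> apply Complex.ext <;>
    refine mul_self_eq_zero.mp (le_antisymm ?_ (mul_self_nonneg _)) <;>
    linarith!

/-- Right multiplication by the quaternion `i`. -/
def rframe₁ : ℂ × ℂ →L[ℝ] ℂ × ℂ := LinearMap.toContinuousLinearMap
  { toFun := fun q => (Complex.I * q.1, -(Complex.I * q.2))
    map_add' := fun p q => by ext <;> simp <;> ring
    map_smul' := fun r q => by ext <;> simp [mul_left_comm] }

/-- Right multiplication by the quaternion `j`. -/
def rframe₂ : ℂ × ℂ →L[ℝ] ℂ × ℂ := LinearMap.toContinuousLinearMap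
  { toFun := fun q => (-q.2, q.1)
    map_add' := fun p q => by ext <;> simp <;> ring
    map_smul' := fun r q => by ext <;> simp }

/-- Right multiplication by the quaternion `k`. -/
def rframe₃ : ℂ × ℂ →L[ℝ] ℂ × ℂ := LinearMap.toContinuousLinearMap
  { toFun := fun q => (Complex.I * q.2, Complex.I * q.1)
    map_add' := fun p q => by ext <;> simp <;> ring
    map_smul' := fun r q => by ext <;> simp [mul_left_comm] }

lemma rframe₁_apply (q : ℂ × ℂ) : rframe₁ q = (Complex.I * q.1, -(Complex.I * q.2)) := rfl
lemma rframe₂_apply (q : ℂ × ℂ) : rframe₂ q = (-q.2, q.1) := rfl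
lemma rframe₃_apply (q : ℂ × ℂ) : rframe₃ q = (Complex.I * q.2, Complex.I * q.1) := rfl

/-- The quadratic function `q ↦ ⟨L q, K q⟩`. -/
def quadFun (L K : ℂ × ℂ →L[ℝ] ℂ × ℂ) (q : ℂ × ℂ) : ℝ := euclInner (L q) (K q)

lemma contDiff_quadFun (L K : ℂ × ℂ →L[ℝ] ℂ × ℂ) : ContDiff ℝ ∞ (quadFun L K) :=
  contDiff_euclInner.comp (L.contDiff.prodMk K.contDiff)

lemma lieDeriv_quadFun (A L K : ℂ × ℂ →L[ℝ] ℂ × ℂ) (q : ℂ × ℂ) :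
    lieDeriv A (quadFun L K) q
      = euclInner (L (A q)) (K q) + euclInner (L q) (K (A q)) := by
  have h1 : HasDerivAt (fun s : ℝ => quadFun L K (q + s • A q)) (lieDeriv A (quadFun L K) q) 0 := by
    have hd : HasFDerivAt (quadFun L K) (fderiv ℝ (quadFun L K) q) (q + (0 : ℝ) • A q) := by
      rw [zero_smul, add_zero]
      exact ((contDiff_quadFun L K).differentiable (by simp) q).hasFDerivAt
    have hl : HasDerivAt (fun s : ℝ => q + s • A q) (A q) 0 := by
      simpa using ((hasDerivAt_id (0 : ℝ)).smul_const (A q)).const_add q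
    exact hd.comp_hasDerivAt (0 : ℝ) hl
  have h2 : HasDerivAt (fun s : ℝ => quadFun L K q
      + s * (euclInner (L (A q)) (K q) + euclInner (L q) (K (A q)))
      + s ^ 2 * euclInner (L (A q)) (K (A q)))
      (euclInner (L (A q)) (K q) + euclInner (L q) (K (A q))) 0 := by
    have := ((((hasDerivAt_id' (0 : ℝ)).mul_const
      (euclInner (L (A q)) (K q) + euclInner (L q) (K (A q)))).const_add (quadFun L K q)).fun_add
      (((hasDerivAt_id' (0 : ℝ)).fun_pow 2).mul_const (euclInner (L (A q)) (K (A q)))))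
    simpa using this
  refine h1.unique (h2.congr_of_eventuallyEq (Filter.Eventually.of_forall fun s => ?_))
  simp only [quadFun, map_add, map_smul, euclInner_add_left, euclInner_add_right,
    euclInner_smul_left, euclInner_smul_right]
  ring

/-- The tuple `(|q|² a, |q|² q⁻¹ u q)`: the coefficients of `|q|² (a i q + u q)` in the fields
`q ↦ i q` and `q ↦ q i, q j, q k`. -/
def leftTuple (m : Fin 4 → ℝ) (q : ℂ × ℂ) : Fin 4 → ℝ :=
  ![m 0 * quadFun (.id ℝ _) (.id ℝ _) q,
    m 1 * quadFun frame₁ rframe₁ q + m 2 * quadFun frame₂ rframe₁ q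
      + m 3 * quadFun frame₃ rframe₁ q,
    m 1 * quadFun frame₁ rframe₂ q + m 2 * quadFun frame₂ rframe₂ q
      + m 3 * quadFun frame₃ rframe₂ q,
    m 1 * quadFun frame₁ rframe₃ q + m 2 * quadFun frame₂ rframe₃ q
      + m 3 * quadFun frame₃ rframe₃ q]

lemma leftTuple_smul (r : ℝ) (m : Fin 4 → ℝ) (q : ℂ × ℂ) :
    leftTuple (r • m) q = r • leftTuple m q := by
  funext a
  fin_cases a <;> simp [leftTuple] <;> ring

/-- The infinitesimal isometry `q ↦ y₀ i q + q (y₁ i + y₂ j + y₃ k)`. -/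
def killingField (y : Fin 4 → ℝ) : ℂ × ℂ →L[ℝ] ℂ × ℂ :=
  y 0 • frame₁ + y 1 • rframe₁ + y 2 • rframe₂ + y 3 • rframe₃

lemma killingField_leftTuple (m : Fin 4 → ℝ) (q : ℂ × ℂ) :
    killingField (leftTuple m q) q = euclInner q q •
      ((m 0 + m 1) • frame₁ q + m 2 • frame₂ q + m 3 • frame₃ q) := by
  simp only [killingField, leftTuple, quadFun, euclInner_eq]
  apply Prod.ext <;> apply Complex.ext <;>
    simp [frame₁_apply, frame₂_apply, frame₃_apply, rframe₁_apply, rframe₂_apply, rframe₃_apply] <;>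
    ring

/-- The frame and the position vector span `ℂ²`. -/
lemma frame_expansion (q h : ℂ × ℂ) : euclInner q q • h = euclInner h q • q
    + euclInner h (frame₁ q) • frame₁ q + euclInner h (frame₂ q) • frame₂ q
    + euclInner h (frame₃ q) • frame₃ q := by
  simp only [euclInner_eq]
  apply Prod.ext <;> apply Complex.ext <;>
    simp [frame₁_apply, frame₂_apply, frame₃_apply] <;> ring

variable {Ω : TopologicalSpace.Opens (ℂ × ℂ)}

lemma contDiffOn_leftTuple {M : ℂ × ℂ → Fin 4 → ℝ}
    (hM : ∀ a, ContDiffOn ℝ ∞ (fun x => M x a) Ω) (a : Fin 4) :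
    ContDiffOn ℝ ∞ (fun x => leftTuple (M x) x a) Ω := by
  have c : ∀ L K, ContDiffOn ℝ ∞ (quadFun L K) Ω := fun L K => (contDiff_quadFun L K).contDiffOn
  fin_cases a
  · exact (hM 0).mul (c _ _)
  all_goals
    exact (((hM 1).mul (c _ _)).add ((hM 2).mul (c _ _))).add ((hM 3).mul (c _ _))

lemma lieDeriv_mul_quadFun (A L K : ℂ × ℂ →L[ℝ] ℂ × ℂ) {f : ℂ × ℂ → ℝ} {q : ℂ × ℂ}
    (hf : DifferentiableAt ℝ f q) :
    lieDeriv A (fun x => f x * quadFun L K x) q = lieDeriv A f q * quadFun L K q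
      + f q * (euclInner (L (A q)) (K q) + euclInner (L q) (K (A q))) := by
  rw [← lieDeriv_quadFun, lieDeriv,
    fderiv_fun_mul hf ((contDiff_quadFun L K).differentiable (by simp) q)]
  simp [lieDeriv]
  ring

lemma lieDeriv_sum_quadFun (A L₁ L₂ L₃ K : ℂ × ℂ →L[ℝ] ℂ × ℂ) {f₁ f₂ f₃ : ℂ × ℂ → ℝ} {q : ℂ × ℂ}
    (h₁ : DifferentiableAt ℝ f₁ q) (h₂ : DifferentiableAt ℝ f₂ q) (h₃ : DifferentiableAt ℝ f₃ q) :
    lieDeriv A (fun x => f₁ x * quadFun L₁ K x + f₂ x * quadFun L₂ K x + f₃ x * quadFun L₃ K x) q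
      = (lieDeriv A f₁ q * quadFun L₁ K q
          + f₁ q * (euclInner (L₁ (A q)) (K q) + euclInner (L₁ q) (K (A q))))
        + (lieDeriv A f₂ q * quadFun L₂ K q
          + f₂ q * (euclInner (L₂ (A q)) (K q) + euclInner (L₂ q) (K (A q))))
        + (lieDeriv A f₃ q * quadFun L₃ K q
          + f₃ q * (euclInner (L₃ (A q)) (K q) + euclInner (L₃ q) (K (A q)))) := by
  have hQ : ∀ L K, DifferentiableAt ℝ (quadFun L K) q := fun L K =>
    (contDiff_quadFun L K).differentiable (by simp) q
  have d1 := h₁.fun_mul (hQ L₁ K)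
  have d2 := h₂.fun_mul (hQ L₂ K)
  have d3 := h₃.fun_mul (hQ L₃ K)
  rw [← lieDeriv_mul_quadFun A L₁ K h₁, ← lieDeriv_mul_quadFun A L₂ K h₂,
    ← lieDeriv_mul_quadFun A L₃ K h₃, lieDeriv, fderiv_fun_add (d1.fun_add d2) d3,
    fderiv_fun_add d1 d2]
  rfl

/-- Passing to the left-invariant frame turns the corrected derivatives into derivatives. -/
lemma lieDeriv_leftTuple {M : ℂ × ℂ → Fin 4 → ℝ}
    (hM : ∀ a, ContDiffOn ℝ ∞ (fun x => M x a) Ω) {q : ℂ × ℂ} (hq : q ∈ Ω) (a : Fin 4) (i : Fin 3) :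
    lieDeriv (![frame₁, frame₂, frame₃] i) (fun x => leftTuple (M x) x a) q
      = leftTuple (tupleDeriv M q i) q a := by
  have hd : ∀ a, DifferentiableAt ℝ (fun x => M x a) q := fun a =>
    differentiableAt_of_mem (hM a) ⟨q, hq⟩
  have h0 : ∀ A : ℂ × ℂ →L[ℝ] ℂ × ℂ, lieDeriv A (fun x => leftTuple (M x) x 0) q = _ :=
    fun A => lieDeriv_mul_quadFun A _ _ (hd 0)
  have h1 : ∀ A : ℂ × ℂ →L[ℝ] ℂ × ℂ, lieDeriv A (fun x => leftTuple (M x) x 1) q = _ :=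
    fun A => lieDeriv_sum_quadFun A _ _ _ _ (hd 1) (hd 2) (hd 3)
  have h2 : ∀ A : ℂ × ℂ →L[ℝ] ℂ × ℂ, lieDeriv A (fun x => leftTuple (M x) x 2) q = _ :=
    fun A => lieDeriv_sum_quadFun A _ _ _ _ (hd 1) (hd 2) (hd 3)
  have h3 : ∀ A : ℂ × ℂ →L[ℝ] ℂ × ℂ, lieDeriv A (fun x => leftTuple (M x) x 3) q = _ :=
    fun A => lieDeriv_sum_quadFun A _ _ _ _ (hd 1) (hd 2) (hd 3)
  fin_cases a
  · refine (h0 _).trans ?_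
    fin_cases i <;>
    simp only [leftTuple, tupleDeriv, quadFun, euclInner_eq, Fin.zero_eta, Fin.mk_one,
      Fin.reduceFinMk, Matrix.cons_val_zero, Matrix.cons_val_one, Matrix.cons_val] <;>
    simp [frame₁_apply, frame₂_apply, frame₃_apply, rframe₁_apply, rframe₂_apply, rframe₃_apply]
    all_goals exact Or.inr (by ring)
  · refine (h1 _).trans ?_
    fin_cases i <;>
    simp only [leftTuple, tupleDeriv, quadFun, euclInner_eq, Fin.zero_eta, Fin.mk_one,
      Fin.reduceFinMk, Matrix.cons_val_zero, Matrix.cons_val_one, Matrix.cons_val] <;>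
    simp [frame₁_apply, frame₂_apply, frame₃_apply, rframe₁_apply, rframe₂_apply, rframe₃_apply] <;>
    ring
  · refine (h2 _).trans ?_
    fin_cases i <;>
    simp only [leftTuple, tupleDeriv, quadFun, euclInner_eq, Fin.zero_eta, Fin.mk_one,
      Fin.reduceFinMk, Matrix.cons_val_zero, Matrix.cons_val_one, Matrix.cons_val] <;>
    simp [frame₁_apply, frame₂_apply, frame₃_apply, rframe₁_apply, rframe₂_apply, rframe₃_apply] <;>
    ring
  · refine (h3 _).trans ?_
    fin_cases i <;>
    simp only [leftTuple, tupleDeriv, quadFun, euclInner_eq, Fin.zero_eta, Fin.mk_one,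
      Fin.reduceFinMk, Matrix.cons_val_zero, Matrix.cons_val_one, Matrix.cons_val] <;>
    simp [frame₁_apply, frame₂_apply, frame₃_apply, rframe₁_apply, rframe₂_apply, rframe₃_apply] <;>
    ring

/-- The tuple in the left-invariant frame of a radially constant tuple has degree two. -/
lemma euler_leftTuple {M : ℂ × ℂ → Fin 4 → ℝ}
    (hM : ∀ a, ContDiffOn ℝ ∞ (fun x => M x a) Ω) {q : ℂ × ℂ} (hq : q ∈ Ω)
    (hE : ∀ a, lieDeriv (.id ℝ _) (fun x => M x a) q = 0) (a : Fin 4) :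
    lieDeriv (.id ℝ _) (fun x => leftTuple (M x) x a) q = 2 * leftTuple (M q) q a := by
  have hd : ∀ a, DifferentiableAt ℝ (fun x => M x a) q := fun a =>
    differentiableAt_of_mem (hM a) ⟨q, hq⟩
  fin_cases a
  · refine (lieDeriv_mul_quadFun _ _ _ (hd 0)).trans ?_
    rw [hE]
    simp only [leftTuple, quadFun, ContinuousLinearMap.id_apply, Fin.zero_eta, Matrix.cons_val_zero]
    ring
  all_goals
    refine (lieDeriv_sum_quadFun _ _ _ _ _ (hd 1) (hd 2) (hd 3)).trans ?_
    rw [hE, hE, hE]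
    simp only [leftTuple, quadFun, ContinuousLinearMap.id_apply, Fin.mk_one, Fin.reduceFinMk,
      Matrix.cons_val_one, Matrix.cons_val]
    ring

end

section

variable {Ω : TopologicalSpace.Opens (ℂ × ℂ)}

namespace IsRiemannianFlow

variable {τ : ℝ} {v₁ v₂ v₃ : ℂ × ℂ → ℝ}

/-- The tuple of a radially constant flow is radially constant. -/
lemma euler_killTuple (h : IsRiemannianFlow τ Ω v₁ v₂ v₃)
    (h₁ : ∀ q ∈ Ω, lieDeriv (.id ℝ _) v₁ q = 0) (h₂ : ∀ q ∈ Ω, lieDeriv (.id ℝ _) v₂ q = 0)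
    (h₃ : ∀ q ∈ Ω, lieDeriv (.id ℝ _) v₃ q = 0) {q : ℂ × ℂ} (hq : q ∈ Ω) (a : Fin 4) :
    lieDeriv (.id ℝ _) (fun x => killTuple τ v₁ v₂ v₃ x a) q = 0 := by
  let D := fieldDerivation Ω (.id ℝ (ℂ × ℂ))
  let d₁ := fieldDerivation Ω frame₁
  let d₂ := fieldDerivation Ω frame₂
  let d₃ := fieldDerivation Ω frame₃
  let f₁ := restr h.smooth₁
  let f₂ := restr h.smooth₂
  let f₃ := restr h.smooth₃
  have e₁ : D f₁ = 0 := by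
    simp only [D, f₁, fieldDerivation_restr]; exact smoothFun_ext fun x => h₁ x x.2
  have e₂ : D f₂ = 0 := by
    simp only [D, f₂, fieldDerivation_restr]; exact smoothFun_ext fun x => h₂ x x.2
  have e₃ : D f₃ = 0 := by
    simp only [D, f₃, fieldDerivation_restr]; exact smoothFun_ext fun x => h₃ x x.2
  have comm : ∀ (L : ℂ × ℂ →L[ℝ] ℂ × ℂ) f, D f = 0 → D (fieldDerivation Ω L f) = 0 := by
    intro L f hf
    have := fieldDerivation_bracket (.id ℝ (ℂ × ℂ)) L f
    rw [show L.comp (.id ℝ (ℂ × ℂ)) - ContinuousLinearMap.comp (.id ℝ (ℂ × ℂ)) L = 0 by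
      ext <;> simp] at this
    change D (fieldDerivation Ω L f) - fieldDerivation Ω L (D f) = _ at this
    rw [hf, map_zero, sub_zero] at this
    rw [this]
    exact smoothFun_ext fun x => by
      rw [fieldDerivation_apply, lieDeriv]; simp
  have ek : D (restr h.contDiffOn_killFun) = 0 := by
    have : restr h.contDiffOn_killFun = f₃ * (f₁ * d₁ f₂ + f₂ * d₂ f₂ + f₃ * d₃ f₂)
        - f₂ * (f₁ * d₁ f₃ + f₂ * d₂ f₃ + f₃ * d₃ f₃)
        - (algebraMap ℝ _ (2 * τ ^ 2 - 2)) * f₁ * (f₂ * f₂ + f₃ * f₃) - (d₂ f₃ - d₃ f₂) := by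
      simp only [d₁, d₂, d₃, f₁, f₂, f₃, fieldDerivation_restr]
      refine smoothFun_ext fun x => ?_
      change killFun _ _ _ _ _ = v₃ x * (v₁ x * _ + v₂ x * _ + v₃ x * _)
        - v₂ x * (v₁ x * _ + v₂ x * _ + v₃ x * _) -
        (2 * τ ^ 2 - 2) * v₁ x * (v₂ x * v₂ x + v₃ x * v₃ x) - (_ - _)
      rw [← sq, ← sq]
      rfl
    rw [this]
    simp only [map_sub, map_add, Derivation.leibniz, e₁, e₂, e₃, comm _ _ e₂, comm _ _ e₃, d₁, d₂,
      d₃, Derivation.map_algebraMap, smul_zero, add_zero, sub_zero]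
  have key : ∀ {g : ℂ × ℂ → ℝ} (hg : ContDiffOn ℝ ∞ g Ω), D (restr hg) = 0 →
      lieDeriv (.id ℝ _) g q = 0 := by
    intro g hg h0
    simp only [D, fieldDerivation_restr] at h0
    exact congrFun (congrArg Subtype.val h0) ⟨q, hq⟩
  have hfour : ∀ {f : ℂ × ℂ → ℝ} (hf : ContDiffOn ℝ ∞ f Ω),
      lieDeriv (.id ℝ _) (fun y => 4 * f y) q = 4 * lieDeriv (.id ℝ _) f q := fun hf => by
    rw [lieDeriv, fderiv_const_mul (differentiableAt_of_mem hf ⟨q, hq⟩)]; rfl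
  fin_cases a
  · have : lieDeriv (.id ℝ _) (fun x => 4 * v₁ x - killFun τ v₁ v₂ v₃ x) q = 0 := by
      rw [lieDeriv, fderiv_fun_sub]
      · have h4 := hfour h.smooth₁
        rw [h₁ q hq] at h4
        have h5 := key h.contDiffOn_killFun ek
        rw [lieDeriv] at h4 h5
        rw [_root_.sub_apply, h4, h5]
        simp
      · exact differentiableAt_of_mem (contDiffOn_const.mul h.smooth₁) ⟨q, hq⟩
      · exact differentiableAt_of_mem h.contDiffOn_killFun ⟨q, hq⟩
    exact this
  · exact key _ ek
  · exact (hfour h.smooth₂).trans (by rw [h₂ q hq, mul_zero])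
  · exact (hfour h.smooth₃).trans (by rw [h₃ q hq, mul_zero])

/-- A radially constant Riemannian flow is locally a rescaled infinitesimal isometry. -/
theorem exists_killingField (h : IsRiemannianFlow τ Ω v₁ v₂ v₃) (hτ : 0 < τ) (hτ1 : τ ≠ 1)
    (h₁ : ∀ q ∈ Ω, lieDeriv (.id ℝ _) v₁ q = 0) (h₂ : ∀ q ∈ Ω, lieDeriv (.id ℝ _) v₂ q = 0)
    (h₃ : ∀ q ∈ Ω, lieDeriv (.id ℝ _) v₃ q = 0) {p : ℂ × ℂ} (hp : p ∈ Ω) (hp0 : p ≠ 0) :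
    ∃ y : Fin 4 → ℝ, ∀ᶠ q in 𝓝 p, ∃ r : ℝ, r ≠ 0 ∧
      v₁ q • frame₁ q + v₂ q • frame₂ q + v₃ q • frame₃ q = r • killingField y q := by
  set M := killTuple τ v₁ v₂ v₃ with hM
  have hMs : ∀ a, ContDiffOn ℝ ∞ (fun x => M x a) Ω := h.contDiffOn_killTuple
  let Y : ℂ × ℂ → Fin 4 → ℝ := fun q => leftTuple (M q) q
  have hYs : ∀ a, ContDiffOn ℝ ∞ (fun x => Y x a) Ω := contDiffOn_leftTuple hMs
  have hfield : ∀ q, killingField (Y q) q = (4 * euclInner q q) •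
      (v₁ q • frame₁ q + v₂ q • frame₂ q + v₃ q • frame₃ q) := by
    intro q
    rw [killingField_leftTuple]
    have e0 : M q 0 + M q 1 = 4 * v₁ q := by
      change 4 * v₁ q - killFun τ v₁ v₂ v₃ q + killFun τ v₁ v₂ v₃ q = _; ring
    have e2 : M q 2 = 4 * v₂ q := rfl
    have e3 : M q 3 = 4 * v₃ q := rfl
    rw [e0, e2, e3]
    module
  -- the tuple in the left-invariant frame is proportional to its derivatives
  have hder : ∀ q ∈ Ω, q ≠ 0 → ∀ w, ∃ κ : ℝ, ∀ a, fderiv ℝ (fun x => Y x a) q w = κ * Y q a := by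
    intro q hq hq0 w
    have hqq := euclInner_self_pos hq0
    choose κ hκ using h.tupleDeriv_eq_smul hτ hτ1 hq
    have hfr : ∀ i a, fderiv ℝ (fun x => Y x a) q (![frame₁, frame₂, frame₃] i q) =
        κ i * Y q a := by
      intro i a
      have := lieDeriv_leftTuple hMs hq a i
      rw [hM, hκ i, leftTuple_smul] at this
      exact this
    have hid : ∀ a, fderiv ℝ (fun x => Y x a) q q = 2 * Y q a :=
      fun a => euler_leftTuple hMs hq (h.euler_killTuple h₁ h₂ h₃ hq) a
    refine ⟨(euclInner q q)⁻¹ * (euclInner w q * 2 + euclInner w (frame₁ q) * κ 0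
      + euclInner w (frame₂ q) * κ 1 + euclInner w (frame₃ q) * κ 2), fun a => ?_⟩
    have h0 : _ = κ 0 * Y q a := hfr 0 a
    have h1 : _ = κ 1 * Y q a := hfr 1 a
    have h2 : _ = κ 2 * Y q a := hfr 2 a
    have := congrArg (fderiv ℝ (fun x => Y x a) q) (frame_expansion q w)
    simp only [map_add, map_smul, hid, smul_eq_mul] at this
    simp only [Matrix.cons_val_zero, Matrix.cons_val_one, Matrix.cons_val] at h0 h1 h2
    rw [h0, h1, h2] at this
    field_simp
    linarith
  have hYp : Y p ≠ 0 := by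
    intro h0
    have h4 := hfield p
    rw [h0] at h4
    have hpp := euclInner_self_pos hp0
    have h5 : v₁ p • frame₁ p + v₂ p • frame₂ p + v₃ p • frame₃ p = 0 := by
      replace h4 := h4.symm.trans (show killingField 0 p = 0 by simp [killingField])
      exact (smul_eq_zero.mp h4).resolve_left (by positivity)
    have h6 : euclInner (v₁ p • frame₁ p + v₂ p • frame₂ p + v₃ p • frame₃ p)
        (v₁ p • frame₁ p + v₂ p • frame₂ p + v₃ p • frame₃ p)
        = euclInner p p * (v₁ p ^ 2 + v₂ p ^ 2 + v₃ p ^ 2) := by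
      simp only [euclInner_eq, frame₁_apply, frame₂_apply, frame₃_apply]
      simp
      ring
    rw [h5] at h6
    have h7 : v₁ p ^ 2 + v₂ p ^ 2 + v₃ p ^ 2 = 0 := by
      have : euclInner (0 : ℂ × ℂ) 0 = 0 := by simp [euclInner]
      rw [this, eq_comm] at h6
      exact (mul_eq_zero.mp h6).resolve_left hpp.ne'
    have := h.unit p hp
    have s1 := sq_nonneg (v₁ p)
    have s2 := sq_nonneg (v₂ p)
    have s3 := sq_nonneg (v₃ p)
    have z1 : v₁ p ^ 2 = 0 := by linarith
    rw [z1] at this h7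
    linarith
  obtain ⟨b, hb⟩ := Function.ne_iff.mp hYp
  have hbc : ContinuousAt (fun x => Y x b) p :=
    ((hYs b).contDiffAt (Ω.isOpen.mem_nhds hp)).continuousAt
  have hev : ∀ᶠ q in 𝓝 p, q ∈ Ω ∧ Y q b ≠ 0 ∧ q ≠ 0 :=
    (Filter.eventually_mem_set.mpr (Ω.isOpen.mem_nhds hp)).and
      ((hbc.eventually_ne hb).and (eventually_ne_nhds hp0))
  obtain ⟨ρ, hρ, hball⟩ := Metric.eventually_nhds_iff_ball.mp hev
  refine ⟨fun a => Y p a / Y p b, ?_⟩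
  have hconst : ∀ q ∈ Metric.ball p ρ, ∀ a, Y q a / Y q b = Y p a / Y p b := by
    intro q hq a
    have hdiff : ∀ x ∈ Metric.ball p ρ,
        HasFDerivAt (fun x => Y x a / Y x b) (0 : ℂ × ℂ →L[ℝ] ℝ) x := by
      intro x hx
      obtain ⟨hxΩ, hxb, hx0⟩ := hball x hx
      have da := (differentiableAt_of_mem (hYs a) ⟨x, hxΩ⟩).hasFDerivAt
      have db := (differentiableAt_of_mem (hYs b) ⟨x, hxΩ⟩).hasFDerivAt
      refine ((da.mul
        ((hasDerivAt_inv hxb).comp_hasFDerivAt x db)).congr_fderiv ?_).congr_of_eventuallyEq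
        (Filter.Eventually.of_forall fun z => div_eq_mul_inv _ _)
      refine ContinuousLinearMap.ext fun w => ?_
      obtain ⟨κ, hκ⟩ := hder x hxΩ hx0 w
      simp only [_root_.add_apply, _root_.smul_apply, hκ, smul_eq_mul, _root_.zero_apply,
        Function.comp_apply]
      field_simp
      ring
    exact Metric.isOpen_ball.is_const_of_fderiv_eq_zero (convex_ball p ρ).isPreconnected
      (fun x hx => (hdiff x hx).differentiableAt.differentiableWithinAt)
      (fun x hx => (hdiff x hx).fderiv) hq (Metric.mem_ball_self hρ)
  refine Filter.eventually_of_mem (Metric.ball_mem_nhds p hρ) fun q hq => ?_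
  obtain ⟨hqΩ, hqb, hq0⟩ := hball q hq
  have hqq := euclInner_self_pos hq0
  refine ⟨Y q b / (4 * euclInner q q), div_ne_zero hqb (by positivity), ?_⟩
  have hy : (fun a => Y p a / Y p b) = (Y q b)⁻¹ • Y q := by
    funext a
    rw [← hconst q hq a, Pi.smul_apply, smul_eq_mul, div_eq_inv_mul]
  have hks : ∀ (r : ℝ) y, killingField (r • y) q = r • killingField y q := by
    intro r y
    simp only [killingField, Pi.smul_apply, smul_eq_mul, _root_.add_apply, _root_.smul_apply]
    module
  rw [hy, hks, hfield, smul_smul, smul_smul]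
  rw [show Y q b / (4 * euclInner q q) * (Y q b)⁻¹ * (4 * euclInner q q) = 1 by field_simp,
    one_smul]

end IsRiemannianFlow

end

/-! ### Infinitesimal isometries generate isometric actions -/

lemma hopf_eq (q : ℂ × ℂ) : hopf q = frame₁ q := rfl

lemma killingField_skew (y : Fin 4 → ℝ) (v w : ℂ × ℂ) :
    euclInner (killingField y v) w + euclInner v (killingField y w) = 0 := by
  simp only [killingField, _root_.add_apply, _root_.smul_apply, euclInner_eq, frame₁_apply,
    rframe₁_apply, rframe₂_apply, rframe₃_apply]
  simp
  ring

lemma commute_frame₁_killingField (y : Fin 4 → ℝ) : Commute frame₁ (killingField y) := by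
  refine ContinuousLinearMap.ext fun v => ?_
  simp only [killingField, mul_apply_eq_comp, _root_.add_apply, _root_.smul_apply,
    frame₁_apply, rframe₁_apply, rframe₂_apply, rframe₃_apply]
  apply Prod.ext <;> apply Complex.ext <;> simp <;> ring

section LinearFlow

variable {E : Type*} [NormedAddCommGroup E] [NormedSpace ℝ E]

/-- The flow of the linear vector field `M`. -/
def linearFlow (M : E →L[ℝ] E) (t : ℝ) : E →L[ℝ] E := NormedSpace.exp (t • M)

variable (M : E →L[ℝ] E)

lemma linearFlow_zero : linearFlow M 0 = 1 := by
  rw [linearFlow, zero_smul, NormedSpace.exp_zero]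

lemma frame_linearFlow {L : E →L[ℝ] E} (hM : Commute L M) (t : ℝ) (v : E) :
    L (linearFlow M t v) = linearFlow M t (L v) := by
  have : Commute L (linearFlow M t) := (hM.smul_right t).exp_right
  exact DFunLike.congr_fun this v

variable [CompleteSpace E]

lemma linearFlow_add (s t : ℝ) (q : E) :
    linearFlow M s (linearFlow M t q) = linearFlow M (s + t) q := by
  let _ : NormedAlgebra ℚ (E →L[ℝ] E) := NormedAlgebra.restrictScalars ℚ ℝ _
  have h : Commute (s • M) (t • M) := ((Commute.refl M).smul_left s).smul_right t
  rw [linearFlow, linearFlow, linearFlow, add_smul, NormedSpace.exp_add_of_commute h]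
  rfl

lemma hasDerivAt_linearFlow (t : ℝ) (q : E) :
    HasDerivAt (fun t => linearFlow M t q) (M (linearFlow M t q)) t :=
  (hasDerivAt_exp_smul_const' M t).clm_apply (hasDerivAt_const t q) |>.congr_deriv (by
    simp [linearFlow])

lemma contDiff_linearFlow :
    ContDiff ℝ ∞ (fun a : ℝ × E => linearFlow M a.1 a.2) := by
  have h : ContDiff ℝ ∞ (NormedSpace.exp : (E →L[ℝ] E) → _) :=
    contDiff_iff_contDiffAt.mpr fun x => (NormedSpace.exp_analytic x).contDiffAt
  exact (h.comp (contDiff_fst.smul contDiff_const)).clm_apply contDiff_snd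

end LinearFlow

lemma hasDerivAt_euclInner {f g : ℝ → ℂ × ℂ} {f' g' : ℂ × ℂ} {t : ℝ} (hf : HasDerivAt f f' t)
    (hg : HasDerivAt g g' t) :
    HasDerivAt (fun s => euclInner (f s) (g s)) (euclInner f' (g t) + euclInner (f t) g') t := by
  have c : ∀ {h : ℝ → ℂ × ℂ} {h' : ℂ × ℂ}, HasDerivAt h h' t → ∀ L : ℂ × ℂ →L[ℝ] ℝ,
      HasDerivAt (fun s => L (h s)) (L h') t := fun hh L => L.hasFDerivAt.comp_hasDerivAt t hh
  let r₁ := Complex.reCLM.comp (ContinuousLinearMap.fst ℝ ℂ ℂ)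
  let i₁ := Complex.imCLM.comp (ContinuousLinearMap.fst ℝ ℂ ℂ)
  let r₂ := Complex.reCLM.comp (ContinuousLinearMap.snd ℝ ℂ ℂ)
  let i₂ := Complex.imCLM.comp (ContinuousLinearMap.snd ℝ ℂ ℂ)
  have := ((((c hf r₁).mul (c hg r₁)).add ((c hf i₁).mul (c hg i₁))).add
    ((c hf r₂).mul (c hg r₂))).add ((c hf i₂).mul (c hg i₂))
  refine (this.congr_deriv ?_).congr_of_eventuallyEq
    (Filter.Eventually.of_forall fun s => euclInner_eq _ _)
  simp only [euclInner_eq]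
  change f'.1.re * (g t).1.re + (f t).1.re * g'.1.re
    + (f'.1.im * (g t).1.im + (f t).1.im * g'.1.im)
    + (f'.2.re * (g t).2.re + (f t).2.re * g'.2.re)
    + (f'.2.im * (g t).2.im + (f t).2.im * g'.2.im) = _
  ring

lemma euclInner_linearFlow {M : ℂ × ℂ →L[ℝ] ℂ × ℂ}
    (hM : ∀ v w, euclInner (M v) w + euclInner v (M w) = 0) (t : ℝ)
    (v w : ℂ × ℂ) : euclInner (linearFlow M t v) (linearFlow M t w) = euclInner v w := by
  have hd : ∀ t, HasDerivAt (fun t => euclInner (linearFlow M t v) (linearFlow M t w)) 0 t :=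
    fun t => (hasDerivAt_euclInner (hasDerivAt_linearFlow M t v)
      (hasDerivAt_linearFlow M t w)).congr_deriv (hM _ _)
  have := is_const_of_deriv_eq_zero (fun t => (hd t).differentiableAt) (fun t => (hd t).deriv) t 0
  simpa [linearFlow_zero] using this

lemma mem_S3_iff {q : ℂ × ℂ} : q ∈ S3 ↔ euclInner q q = 1 := by
  rw [euclInner_eq, S3, Set.mem_ofPred_eq, Complex.normSq_apply, Complex.normSq_apply]
  constructor <;> intro h <;> linarith

/-- A line field that is locally spanned by an infinitesimal isometry is homogeneous. -/
theorem exists_localAction {ε : ℝ} {F : OneDimFoliation} {p : ℂ × ℂ} {y : Fin 4 → ℝ}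
    (h : ∀ᶠ q in 𝓝 p, q ∈ S3 →
      killingField y q ≠ 0 ∧ F.line q = Submodule.span ℝ {killingField y q}) :
    ∃ O : Set (ℂ × ℂ), IsOpen O ∧ p ∈ O ∧ ∃ δ > 0, ∃ Φ : ℝ → ℂ × ℂ → ℂ × ℂ,
    ContDiffOn ℝ ∞ (fun a : ℝ × (ℂ × ℂ) => Φ a.1 a.2) (Set.Ioo (-δ) δ ×ˢ O) ∧
    (∀ q ∈ O ∩ S3, Φ 0 q = q) ∧
    (∀ t ∈ Set.Ioo (-δ) δ, ∀ q ∈ O ∩ S3, Φ t q ∈ S3) ∧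
    (∀ s ∈ Set.Ioo (-δ) δ, ∀ t ∈ Set.Ioo (-δ) δ, s + t ∈ Set.Ioo (-δ) δ →
      ∀ q ∈ O ∩ S3, Φ t q ∈ O → Φ s (Φ t q) = Φ (s + t) q) ∧
    (∀ t ∈ Set.Ioo (-δ) δ, ∀ q ∈ O ∩ S3, ∀ v w, IsTangent q v → IsTangent q w →
      metric ε (Φ t q) (fderiv ℝ (Φ t) q v) (fderiv ℝ (Φ t) q w) = metric ε q v w) ∧
    (∀ t ∈ Set.Ioo (-δ) δ, ∀ q ∈ O ∩ S3, deriv (fun τ => Φ τ q) t ≠ 0 ∧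
      F.line (Φ t q) = Submodule.span ℝ {deriv (fun τ => Φ τ q) t}) := by
  set M := killingField y with hMdef
  have hskew := euclInner_linearFlow (M := M) (killingField_skew y)
  have hcomm := frame_linearFlow M (commute_frame₁_killingField y)
  have hcont : ContinuousAt (fun a : ℝ × (ℂ × ℂ) => linearFlow M a.1 a.2) (0, p) :=
    (contDiff_linearFlow M).continuous.continuousAt
  have hev : ∀ᶠ a : ℝ × (ℂ × ℂ) in 𝓝 ((0 : ℝ), p), linearFlow M a.1 a.2 ∈ S3 →
      M (linearFlow M a.1 a.2) ≠ 0 ∧ F.line (linearFlow M a.1 a.2)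
        = Submodule.span ℝ {M (linearFlow M a.1 a.2)} := by
    rw [ContinuousAt, linearFlow_zero] at hcont
    exact hcont.eventually h
  rw [nhds_prod_eq, Filter.eventually_prod_iff] at hev
  obtain ⟨P, hP, Q, hQ, hPQ⟩ := hev
  obtain ⟨δ, hδ, hδP⟩ := Metric.eventually_nhds_iff_ball.mp hP
  obtain ⟨ρ, hρ, hρQ⟩ := Metric.eventually_nhds_iff_ball.mp hQ
  have hS : ∀ t q, q ∈ S3 → linearFlow M t q ∈ S3 := fun t q hq => by
    rw [mem_S3_iff] at hq ⊢
    rw [hskew, hq]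
  refine ⟨Metric.ball p ρ, Metric.isOpen_ball, Metric.mem_ball_self hρ, δ, hδ,
    fun t q => linearFlow M t q, (contDiff_linearFlow M).contDiffOn, ?_, ?_, ?_, ?_, ?_⟩
  · intro q _
    simp [linearFlow_zero]
  · intro t _ q hq
    exact hS t q hq.2
  · intro s _ t _ _ q _ _
    exact linearFlow_add M s t q
  · intro t _ q _ v w _ _
    have : fderiv ℝ (fun q => linearFlow M t q) q = linearFlow M t := (linearFlow M t).fderiv
    rw [this]
    simp only [metric, horizontalPart, hopf_eq, hcomm, hskew, ← map_smul, ← map_sub]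
  · intro t ht q hq
    rw [(hasDerivAt_linearFlow M t q).deriv]
    exact hPQ (hδP t (by rwa [Real.ball_eq_Ioo, zero_sub, zero_add])) (hρQ q hq.1) (hS t q hq.2)

/-! ### The norm of the Berger metric -/

section

/-- The length of the vector `v` at `q` for the metric `g_ε`. -/
def bergerNorm (ε : ℝ) (q v : ℂ × ℂ) : ℝ := Real.sqrt (metric ε q v v)

lemma euclInner_hopf_self {q : ℂ × ℂ} (hq : q ∈ S3) : euclInner (hopf q) (hopf q) = 1 := by
  rw [← mem_S3_iff.mp hq, hopf_eq]
  simp only [euclInner_eq, frame₁_apply]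
  simp
  ring

lemma metric_eq (ε : ℝ) {q : ℂ × ℂ} (hq : q ∈ S3) (v w : ℂ × ℂ) : metric ε q v w
    = ε * (euclInner v w + (ε - 1) * (euclInner v (hopf q) * euclInner w (hopf q))) := by
  have h := euclInner_hopf_self hq
  have h2 : ∀ r s : ℝ, euclInner (v - r • hopf q) (w - s • hopf q) = euclInner v w
      - s * euclInner v (hopf q) - r * euclInner w (hopf q)
      + r * s * euclInner (hopf q) (hopf q) := by
    intro r s
    simp only [euclInner_eq, Prod.fst_sub, Prod.snd_sub, Complex.sub_re, Complex.sub_im,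
      Prod.smul_fst, Prod.smul_snd, Complex.smul_re, Complex.smul_im, smul_eq_mul]
    ring
  rw [metric, horizontalPart, horizontalPart, h2, h]
  ring

/-- A linear map onto Euclidean space that is isometric for the metric `g_ε` at `q`. -/
def isometrization (ε : ℝ) (q v : ℂ × ℂ) : WithLp 2 (ℂ × ℂ) :=
  WithLp.toLp 2 (Real.sqrt ε • (v + ((Real.sqrt ε - 1) * euclInner v (hopf q)) • hopf q))

lemma inner_toLp (v w : ℂ × ℂ) : inner ℝ (WithLp.toLp 2 v) (WithLp.toLp 2 w) = euclInner v w := by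
  rw [WithLp.prod_inner_apply, euclInner_eq]
  simp [Complex.inner]
  ring

lemma norm_toLp_sq (v : ℂ × ℂ) : ‖WithLp.toLp 2 v‖ ^ 2 = euclInner v v := by
  rw [← inner_toLp, real_inner_self_eq_norm_sq]

lemma abs_euclInner_le (v w : ℂ × ℂ) : |euclInner v w| ≤ 2 * ‖v‖ * ‖w‖ := by
  have h : |euclInner v w| ≤ ‖v.1 * (starRingEnd ℂ) w.1 + v.2 * (starRingEnd ℂ) w.2‖ :=
    Complex.abs_re_le_norm _
  refine h.trans ((norm_add_le _ _).trans ?_)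
  rw [norm_mul, norm_mul, RCLike.norm_conj, RCLike.norm_conj]
  have h1 := mul_le_mul (norm_fst_le v) (norm_fst_le w) (norm_nonneg _) (norm_nonneg _)
  have h2 := mul_le_mul (norm_snd_le v) (norm_snd_le w) (norm_nonneg _) (norm_nonneg _)
  linarith

lemma norm_sq_le_euclInner (v : ℂ × ℂ) : ‖v‖ ^ 2 ≤ euclInner v v := by
  have h : euclInner v v = ‖v.1‖ ^ 2 + ‖v.2‖ ^ 2 := by
    rw [euclInner_eq, ← Complex.normSq_eq_norm_sq, ← Complex.normSq_eq_norm_sq,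
      Complex.normSq_apply, Complex.normSq_apply]
    ring
  rw [h, Prod.norm_def]
  rcases max_choice ‖v.1‖ ‖v.2‖ with h | h <;> rw [h]
  · exact le_add_of_nonneg_right (sq_nonneg _)
  · exact le_add_of_nonneg_left (sq_nonneg _)

lemma norm_hopf (q : ℂ × ℂ) : ‖hopf q‖ = ‖q‖ := by
  simp [hopf, Prod.norm_def]

lemma norm_le_one_of_mem_S3 {q : ℂ × ℂ} (hq : q ∈ S3) : ‖q‖ ≤ 1 := by
  have := norm_sq_le_euclInner q
  rw [mem_S3_iff.mp hq] at this
  nlinarith [norm_nonneg q]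

variable {ε : ℝ}

lemma inner_isometrization (hε : 0 ≤ ε) {q : ℂ × ℂ} (hq : q ∈ S3) (v w : ℂ × ℂ) :
    inner ℝ (isometrization ε q v) (isometrization ε q w) = metric ε q v w := by
  have h := euclInner_hopf_self hq
  rw [isometrization, isometrization, inner_toLp, metric_eq ε hq]
  simp only [euclInner_smul_left, euclInner_smul_right, euclInner_add_left, euclInner_add_right, h,
    euclInner_comm (hopf q) w]
  have := Real.mul_self_sqrt hε
  set r := Real.sqrt ε
  rw [← this]
  ring

lemma bergerNorm_eq_norm (hε : 0 ≤ ε) {q : ℂ × ℂ} (hq : q ∈ S3) (v : ℂ × ℂ) :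
    bergerNorm ε q v = ‖isometrization ε q v‖ := by
  rw [bergerNorm, ← inner_isometrization hε hq, real_inner_self_eq_norm_sq,
    Real.sqrt_sq (norm_nonneg _)]

lemma isometrization_add (q v w : ℂ × ℂ) :
    isometrization ε q (v + w) = isometrization ε q v + isometrization ε q w := by
  rw [isometrization, isometrization, isometrization, ← WithLp.toLp_add, euclInner_add_left]
  congr 1
  module

lemma isometrization_smul (r : ℝ) (q v : ℂ × ℂ) :
    isometrization ε q (r • v) = r • isometrization ε q v := by
  rw [isometrization, isometrization, ← WithLp.toLp_smul, euclInner_smul_left]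
  congr 1
  module

lemma bergerNorm_nonneg (q v : ℂ × ℂ) : 0 ≤ bergerNorm ε q v := Real.sqrt_nonneg _

lemma bergerNorm_add_le (hε : 0 ≤ ε) {q : ℂ × ℂ} (hq : q ∈ S3) (v w : ℂ × ℂ) :
    bergerNorm ε q (v + w) ≤ bergerNorm ε q v + bergerNorm ε q w := by
  simp only [bergerNorm_eq_norm hε hq, isometrization_add]
  exact norm_add_le _ _

lemma bergerNorm_smul (hε : 0 ≤ ε) {q : ℂ × ℂ} (hq : q ∈ S3) (r : ℝ) (v : ℂ × ℂ) :
    bergerNorm ε q (r • v) = |r| * bergerNorm ε q v := by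
  simp only [bergerNorm_eq_norm hε hq, isometrization_smul, norm_smul, Real.norm_eq_abs]

lemma metric_le (hε : 0 ≤ ε) {q : ℂ × ℂ} (hq : q ∈ S3) (v w : ℂ × ℂ) :
    metric ε q v w ≤ bergerNorm ε q v * bergerNorm ε q w := by
  rw [bergerNorm_eq_norm hε hq, bergerNorm_eq_norm hε hq, ← inner_isometrization hε hq]
  exact real_inner_le_norm _ _

lemma metric_self_nonneg (hε : 0 ≤ ε) {q : ℂ × ℂ} (hq : q ∈ S3) (v : ℂ × ℂ) :
    0 ≤ metric ε q v v := by
  rw [← inner_isometrization hε hq]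
  exact real_inner_self_nonneg

lemma norm_toLp_le (v : ℂ × ℂ) : ‖WithLp.toLp 2 v‖ ≤ 2 * ‖v‖ := by
  refine abs_le_of_sq_le_sq' ?_ (by positivity) |>.2
  rw [norm_toLp_sq]
  have := (le_abs_self _).trans (abs_euclInner_le v v)
  nlinarith [sq_nonneg ‖v‖]

/-- The norms of the metric are comparable to the standard one, and depend on the point in a
Lipschitz way. -/
lemma exists_bergerNorm_bounds (hε : 0 < ε) : ∃ C ≥ 1, ∀ q ∈ S3, ∀ v,
    ‖v‖ ≤ C * bergerNorm ε q v ∧ bergerNorm ε q v ≤ C * ‖v‖ ∧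
      ∀ q' ∈ S3, bergerNorm ε q v ≤ bergerNorm ε q' v + C * ‖q - q'‖ * ‖v‖ := by
  set a := Real.sqrt ε with ha
  have ha0 : 0 < a := Real.sqrt_pos.mpr hε
  have haa : a * a = ε := Real.mul_self_sqrt hε.le
  have hlip : ∀ q ∈ S3, ∀ q' ∈ S3, ∀ v,
      bergerNorm ε q v ≤ bergerNorm ε q' v + (8 * a * |a - 1|) * ‖q - q'‖ * ‖v‖ := by
    intro q hq q' hq' v
    rw [bergerNorm_eq_norm hε.le hq, bergerNorm_eq_norm hε.le hq']
    have h1 : isometrization ε q v - isometrization ε q' v = WithLp.toLp 2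
        ((a * (a - 1)) • (euclInner v (hopf (q - q')) • hopf q
          + euclInner v (hopf q') • hopf (q - q'))) := by
      rw [isometrization, isometrization, ← WithLp.toLp_sub]
      congr 1
      rw [show hopf (q - q') = hopf q - hopf q' from map_sub frame₁ q q',
        show euclInner v (hopf q - hopf q') = euclInner v (hopf q) - euclInner v (hopf q') by
          rw [sub_eq_add_neg, ← neg_one_smul ℝ (hopf q'), euclInner_add_right, euclInner_smul_right]
          ring]
      module
    have h2 : ‖isometrization ε q v - isometrization ε q' v‖
        ≤ (8 * a * |a - 1|) * ‖q - q'‖ * ‖v‖ := by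
      rw [h1]
      refine (norm_toLp_le _).trans ?_
      rw [norm_smul, norm_mul, Real.norm_eq_abs, Real.norm_eq_abs, abs_of_pos ha0]
      have h3 : ‖euclInner v (hopf (q - q')) • hopf q + euclInner v (hopf q') • hopf (q - q')‖
          ≤ 2 * ‖v‖ * ‖q - q'‖ * 1 + 2 * ‖v‖ * 1 * ‖q - q'‖ := by
        refine (norm_add_le _ _).trans ?_
        rw [norm_smul, norm_smul, Real.norm_eq_abs, Real.norm_eq_abs, norm_hopf, norm_hopf]
        have e1 := abs_euclInner_le v (hopf (q - q'))
        have e2 := abs_euclInner_le v (hopf q')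
        rw [norm_hopf] at e1 e2
        have e3 := norm_le_one_of_mem_S3 hq
        have e4 := norm_le_one_of_mem_S3 hq'
        gcongr
        exact e2.trans (by gcongr)
      have h4 : 0 ≤ a * |a - 1| := by positivity
      nlinarith [mul_le_mul_of_nonneg_left h3 h4]
    have := norm_le_insert' (isometrization ε q v) (isometrization ε q' v)
    linarith
  have hup : ∀ q ∈ S3, ∀ v, bergerNorm ε q v ≤ (2 * a * (1 + 2 * |a - 1|)) * ‖v‖ := by
    intro q hq v
    rw [bergerNorm_eq_norm hε.le hq, isometrization]
    refine (norm_toLp_le _).trans ?_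
    rw [norm_smul, Real.norm_eq_abs, abs_of_pos ha0]
    have : ‖v + ((a - 1) * euclInner v (hopf q)) • hopf q‖ ≤
        ‖v‖ + (|a - 1| * (2 * ‖v‖ * 1)) * 1 := by
      refine (norm_add_le _ _).trans ?_
      rw [norm_smul, Real.norm_eq_abs, abs_mul, norm_hopf]
      have e1 := abs_euclInner_le v (hopf q)
      rw [norm_hopf] at e1
      have e3 := norm_le_one_of_mem_S3 hq
      gcongr
      exact e1.trans (by gcongr)
    nlinarith [mul_le_mul_of_nonneg_left this ha0.le]
  have hlow : ∀ q ∈ S3, ∀ v, ‖v‖ ≤ (a⁻¹ + ε⁻¹) * bergerNorm ε q v := by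
    intro q hq v
    have hv := norm_sq_le_euclInner v
    have hqq := euclInner_hopf_self hq
    have hcs : euclInner v (hopf q) ^ 2 ≤ euclInner v v := by
      have := abs_real_inner_le_norm (WithLp.toLp 2 v) (WithLp.toLp 2 (hopf q))
      rw [inner_toLp] at this
      have h1 := norm_toLp_sq (hopf q)
      rw [hqq] at h1
      have h2 := norm_toLp_sq v
      rw [← sq_abs, ← h2, ← mul_one (‖_‖ ^ 2), ← h1, ← mul_pow]
      gcongr
    have hm := metric_eq ε hq v v
    set b := euclInner v (hopf q)
    set n := bergerNorm ε q v
    have hn0 : 0 ≤ n := bergerNorm_nonneg _ _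
    have hn : n ^ 2 = metric ε q v v := Real.sq_sqrt (metric_self_nonneg hε.le hq v)
    rcases le_total 1 ε with h1 | h1
    · have : (a * ‖v‖) ^ 2 ≤ n ^ 2 := by
        rw [hn, hm, mul_pow, sq a, haa]
        have : 0 ≤ (ε - 1) * (b * b) := mul_nonneg (by linarith) (mul_self_nonneg _)
        nlinarith
      have := abs_le_of_sq_le_sq' this hn0 |>.2
      calc ‖v‖ = a⁻¹ * (a * ‖v‖) := by field_simp
        _ ≤ a⁻¹ * n := by gcongr
        _ ≤ _ := by gcongr; exact le_add_of_nonneg_right (by positivity)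
    · have : (ε * ‖v‖) ^ 2 ≤ n ^ 2 := by
        rw [hn, hm, mul_pow, sq ε, mul_assoc]
        have : (1 - ε) * (b * b) ≤ (1 - ε) * euclInner v v :=
          mul_le_mul_of_nonneg_left (by rw [← sq]; exact hcs) (by linarith)
        have : ε * ‖v‖ ^ 2 ≤ ε * euclInner v v := by gcongr
        gcongr
        linarith
      have := abs_le_of_sq_le_sq' this hn0 |>.2
      calc ‖v‖ = ε⁻¹ * (ε * ‖v‖) := by field_simp
        _ ≤ ε⁻¹ * n := by gcongr
        _ ≤ _ := by gcongr; exact le_add_of_nonneg_left (by positivity)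
  refine ⟨1 + 8 * a * |a - 1| + 2 * a * (1 + 2 * |a - 1|) + (a⁻¹ + ε⁻¹), ?_, fun q hq v =>
    ⟨(hlow q hq v).trans ?_, (hup q hq v).trans ?_, fun q' hq' => (hlip q hq q' hq' v).trans ?_⟩⟩
  · have : 0 ≤ 8 * a * |a - 1| + 2 * a * (1 + 2 * |a - 1|) + (a⁻¹ + ε⁻¹) := by positivity
    linarith
  · have : 0 ≤ 1 + 8 * a * |a - 1| + 2 * a * (1 + 2 * |a - 1|) := by positivity
    exact mul_le_mul_of_nonneg_right (by linarith) (bergerNorm_nonneg _ _)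
  · gcongr
    have : 0 ≤ 1 + 8 * a * |a - 1| + (a⁻¹ + ε⁻¹) := by positivity
    linarith
  · gcongr
    have : 0 ≤ 1 + 2 * a * (1 + 2 * |a - 1|) + (a⁻¹ + ε⁻¹) := by positivity
    linarith

end

/-! ### The Riemannian distance to first order -/

section

variable {ε : ℝ}

/-- The properties of the norms of the metric that matter for the distance: comparability with the
standard norm and Lipschitz dependence on the point. -/
def NormBounds (ε C : ℝ) : Prop := ∀ q ∈ S3, ∀ v,
    ‖v‖ ≤ C * bergerNorm ε q v ∧ bergerNorm ε q v ≤ C * ‖v‖ ∧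
      ∀ q' ∈ S3, bergerNorm ε q v ≤ bergerNorm ε q' v + C * ‖q - q'‖ * ‖v‖

/-- The lengths of the `C¹` curves in the sphere that join two points. -/
def lengths (ε : ℝ) (x y : ℂ × ℂ) : Set ℝ :=
  {l | ∃ γ : ℝ → ℂ × ℂ, ContDiff ℝ 1 γ ∧ (∀ t ∈ Set.Icc (0 : ℝ) 1, γ t ∈ S3) ∧
    γ 0 = x ∧ γ 1 = y ∧ l = length ε γ}

lemma length_nonneg (γ : ℝ → ℂ × ℂ) : 0 ≤ length ε γ :=
  intervalIntegral.integral_nonneg zero_le_one fun _ _ => Real.sqrt_nonneg _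

lemma bddBelow_lengths (x y : ℂ × ℂ) : BddBelow (lengths ε x y) :=
  ⟨0, by rintro l ⟨γ, -, -, -, -, rfl⟩; exact length_nonneg γ⟩

lemma dist_nonneg (x y : ℂ × ℂ) : 0 ≤ dist ε x y :=
  Real.sInf_nonneg (by rintro l ⟨γ, -, -, -, -, rfl⟩; exact length_nonneg γ)

lemma continuous_bergerNorm {X : Type*} [TopologicalSpace X] {f g : X → ℂ × ℂ} (hf : Continuous f)
    (hg : Continuous g) : Continuous fun t => bergerNorm ε (f t) (g t) := by
  have h : ∀ {f g : X → ℂ × ℂ}, Continuous f → Continuous g →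
      Continuous fun t => euclInner (f t) (g t) := fun hf hg =>
    (contDiff_euclInner (n := 0)).continuous.comp (hf.prodMk hg)
  have hh : Continuous fun t => hopf (f t) := frame₁.continuous.comp hf
  have hp : Continuous fun t => horizontalPart (f t) (g t) := hg.sub ((h hg hh).smul hh)
  exact (((h hp hp).const_mul ε).add (((h hg hh).mul (h hg hh)).const_mul (ε ^ 2))).sqrt

section Curve

variable {C : ℝ} {γ : ℝ → ℂ × ℂ}

lemma continuous_speed (hγ : ContDiff ℝ 1 γ) :
    Continuous fun t => bergerNorm ε (γ t) (deriv γ t) :=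
  continuous_bergerNorm hγ.continuous (hγ.continuous_deriv le_rfl)

lemma integral_deriv_curve (hγ : ContDiff ℝ 1 γ) (t : ℝ) :
    ∫ s in (0 : ℝ)..t, deriv γ s = γ t - γ 0 :=
  intervalIntegral.integral_deriv_eq_sub (fun s _ => hγ.differentiable (by simp) s)
    ((hγ.continuous_deriv le_rfl).intervalIntegrable _ _)

lemma norm_sub_le_length (hC : NormBounds ε C) (hC0 : 0 ≤ C) (hγ : ContDiff ℝ 1 γ)
    (hS : ∀ t ∈ Set.Icc (0 : ℝ) 1, γ t ∈ S3) {t : ℝ} (ht : t ∈ Set.Icc (0 : ℝ) 1) :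
    ‖γ t - γ 0‖ ≤ C * length ε γ := by
  have hc := continuous_speed (ε := ε) hγ
  rw [← integral_deriv_curve hγ]
  calc ‖∫ s in (0 : ℝ)..t, deriv γ s‖ ≤ ∫ s in (0 : ℝ)..t, C * bergerNorm ε (γ s) (deriv γ s) :=
        intervalIntegral.norm_integral_le_of_norm_le ht.1
          (Filter.Eventually.of_forall fun s hs => (hC _ (hS s ⟨hs.1.le, hs.2.trans ht.2⟩) _).1)
          ((hc.const_mul C).intervalIntegrable _ _)
    _ ≤ ∫ s in (0 : ℝ)..1, C * bergerNorm ε (γ s) (deriv γ s) :=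
        intervalIntegral.integral_mono_interval le_rfl ht.1 ht.2
          (Filter.Eventually.of_forall fun s => mul_nonneg hC0 (bergerNorm_nonneg _ _))
          ((hc.const_mul C).intervalIntegrable _ _)
    _ = C * length ε γ := by rw [intervalIntegral.integral_const_mul]; rfl

/-- A covector of length at most one at the initial point of a curve calibrates the curve up to
second order in its length. -/
lemma calibration_le_length (hC : NormBounds ε C) (hC0 : 0 ≤ C) (hγ : ContDiff ℝ 1 γ)
    (hS : ∀ t ∈ Set.Icc (0 : ℝ) 1, γ t ∈ S3) (l : ℂ × ℂ →L[ℝ] ℝ)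
    (hl : ∀ v, l v ≤ bergerNorm ε (γ 0) v) :
    l (γ 1 - γ 0) ≤ (1 + C ^ 3 * length ε γ) * length ε γ := by
  have hc := continuous_speed (ε := ε) hγ
  have hcd := hγ.continuous_deriv le_rfl
  rw [← integral_deriv_curve hγ, ← l.intervalIntegral_comp_comm (hcd.intervalIntegrable _ _)]
  calc ∫ s in (0 : ℝ)..1, l (deriv γ s)
      ≤ ∫ s in (0 : ℝ)..1, (1 + C ^ 3 * length ε γ) * bergerNorm ε (γ s) (deriv γ s) := by
        refine intervalIntegral.integral_mono_on zero_le_one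
          ((l.continuous.comp hcd).intervalIntegrable _ _)
          ((hc.const_mul _).intervalIntegrable _ _) fun s hs => (hl _).trans ?_
        have h0 : γ 0 ∈ S3 := hS 0 ⟨le_rfl, zero_le_one⟩
        refine ((hC _ h0 _).2.2 _ (hS s hs)).trans ?_
        have h1 := norm_sub_le_length hC hC0 hγ hS hs
        rw [norm_sub_rev] at h1
        have h2 := (hC _ (hS s hs) (deriv γ s)).1
        have h3 : C * ‖γ 0 - γ s‖ * ‖deriv γ s‖
          ≤ C * (C * length ε γ) * (C * bergerNorm ε (γ s) (deriv γ s)) := by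
          have := length_nonneg (ε := ε) γ
          gcongr
        linarith
    _ = _ := by rw [intervalIntegral.integral_const_mul]; rfl

end Curve

lemma norm_sub_le_dist {C : ℝ} (hC : NormBounds ε C) (hC0 : 0 ≤ C) {x y : ℂ × ℂ}
    (hne : (lengths ε x y).Nonempty) : ‖y - x‖ ≤ C * dist ε x y := by
  refine le_of_forall_pos_le_add fun δ hδ => ?_
  obtain ⟨l, ⟨γ, hγ, hS, rfl, rfl, rfl⟩, hl⟩ := Real.lt_sInf_add_pos hne
    (show 0 < δ / (C + 1) by positivity)
  refine (norm_sub_le_length hC hC0 hγ hS ⟨zero_le_one, le_rfl⟩).trans ?_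
  change length ε γ < dist ε _ _ + _ at hl
  have : C * (δ / (C + 1)) ≤ δ := by
    rw [mul_div_assoc', div_le_iff₀ (by positivity)]; nlinarith
  nlinarith

lemma calibration_le_dist {C : ℝ} (hC : NormBounds ε C) (hC0 : 0 ≤ C) {x y : ℂ × ℂ}
    (hne : (lengths ε x y).Nonempty) (l : ℂ × ℂ →L[ℝ] ℝ) (hl : ∀ v, l v ≤ bergerNorm ε x v) :
    l (y - x) ≤ (1 + C ^ 3 * dist ε x y) * dist ε x y := by
  have hcont : Continuous fun r : ℝ => (1 + C ^ 3 * r) * r := by fun_prop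
  have hlim : Filter.Tendsto (fun r : ℝ => (1 + C ^ 3 * r) * r) (𝓝[>] (dist ε x y))
      (𝓝 ((1 + C ^ 3 * dist ε x y) * dist ε x y)) :=
    hcont.continuousAt.tendsto.mono_left nhdsWithin_le_nhds
  refine ge_of_tendsto hlim (Filter.eventually_of_mem self_mem_nhdsWithin fun r hr => ?_)
  obtain ⟨_, ⟨γ, hγ, hS, rfl, rfl, rfl⟩, hlt⟩ := (csInf_lt_iff (bddBelow_lengths x y) hne).mp hr
  refine (calibration_le_length hC hC0 hγ hS l hl).trans ?_
  have := length_nonneg (ε := ε) γ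
  have hr0 : 0 ≤ r := this.trans hlt.le
  gcongr

lemma euclInner_le (v : ℂ × ℂ) : euclInner v v ≤ 2 * ‖v‖ ^ 2 := by
  have := (le_abs_self _).trans (abs_euclInner_le v v)
  linarith

/-- The projection of a short segment to the sphere has, to first order, the norm of the segment as
its length. -/
lemma exists_short_curve (hε : 0 < ε) {C : ℝ} (hC : NormBounds ε C) (hC1 : 1 ≤ C) {x y : ℂ × ℂ}
    (hx : x ∈ S3) (hy : y ∈ S3) (hxy : ‖y - x‖ ≤ 1 / 2) :
    ∃ l ∈ lengths ε x y, l ≤ bergerNorm ε x (y - x) + 8 * C * ‖y - x‖ ^ 2 := by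
  set d := y - x with hd
  set k := euclInner d d with hk
  have hk0 : 0 ≤ k := (sq_nonneg _).trans (norm_sq_le_euclInner d)
  have hk2 : k ≤ 2 * ‖d‖ ^ 2 := euclInner_le d
  have hk1 : k ≤ 1 / 2 := by nlinarith [norm_nonneg d]
  have hxx := mem_S3_iff.mp hx
  have hyy := mem_S3_iff.mp hy
  have hxd : euclInner x d = - k / 2 := by
    have : euclInner (x + d) (x + d) = 1 := by rw [hd, add_sub_cancel, hyy]
    simp only [euclInner_add_left, euclInner_add_right, hxx, ← hk, euclInner_comm d x] at this
    linarith
  let c : ℝ → ℂ × ℂ := fun t => x + t • d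
  let r : ℝ → ℝ := fun t => 1 - t * (1 - t) * k
  have hr : ∀ t, euclInner (c t) (c t) = r t := by
    intro t
    simp only [c, r, euclInner_add_left, euclInner_add_right, euclInner_smul_left,
      euclInner_smul_right, hxx, ← hk, euclInner_comm d x, hxd]
    ring
  have hrpos : ∀ t, 3 / 4 ≤ r t := by
    intro t
    have : t * (1 - t) ≤ 1 / 4 := by nlinarith [sq_nonneg (t - 1 / 2)]
    have : t * (1 - t) * k ≤ 1 / 4 * k := by gcongr
    simp only [r]
    linarith
  have hr0 : ∀ t, r t ≠ 0 := fun t => by linarith [hrpos t] |> ne_of_gt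
  let ρ : ℝ → ℝ := fun t => (Real.sqrt (r t))⁻¹
  have hρr : ∀ t, ρ t ^ 2 * r t = 1 := fun t => by
    simp only [ρ]
    rw [inv_pow, Real.sq_sqrt (by linarith [hrpos t])]
    exact inv_mul_cancel₀ (hr0 t)
  have hρd : ∀ t, HasDerivAt ρ ((1 - 2 * t) * k / 2 * ρ t ^ 3) t := by
    intro t
    have h1 : HasDerivAt r (-((1 - 2 * t) * k)) t := by
      have := ((((hasDerivAt_id' t).mul ((hasDerivAt_id' t).const_sub 1)).mul_const k).const_sub 1)
      exact this.congr_deriv (by ring)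
    have h2 := (h1.sqrt (hr0 t)).fun_inv (Real.sqrt_ne_zero'.mpr (by linarith [hrpos t]))
    refine h2.congr_deriv ?_
    have h3 : Real.sqrt (r t) ≠ 0 := Real.sqrt_ne_zero'.mpr (by linarith [hrpos t])
    simp only [ρ]
    field_simp
  have hγd : ∀ t, HasDerivAt (fun t => ρ t • c t)
      (((1 - 2 * t) * k / 2 * ρ t ^ 3) • c t + ρ t • d) t := by
    intro t
    have h1 : HasDerivAt c d t := by
      exact (((hasDerivAt_id' t).smul_const d).const_add x).congr_deriv (one_smul _ _)
    exact ((hρd t).fun_smul h1).congr_deriv (add_comm _ _)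
  have hγs : ContDiff ℝ 1 (fun t => ρ t • c t) := by
    have h1 : ContDiff ℝ 1 r := by simp only [r]; fun_prop
    have h2 : ContDiff ℝ 1 c := by simp only [c]; fun_prop
    exact ((h1.sqrt hr0).inv fun t => Real.sqrt_ne_zero'.mpr (by linarith [hrpos t])).smul h2
  have hγS : ∀ t, ρ t • c t ∈ S3 := fun t => by
    rw [mem_S3_iff, euclInner_smul_left, euclInner_smul_right, hr, ← hρr t]
    ring
  have hr1 : ∀ t ∈ Set.Icc (0 : ℝ) 1, r t ≤ 1 := fun t ht => by
    have : 0 ≤ t * (1 - t) * k := mul_nonneg (mul_nonneg ht.1 (by linarith [ht.2])) hk0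
    simp only [r]; linarith
  have hr1' : ∀ t, 1 - k / 4 ≤ r t := by
    intro t
    have : t * (1 - t) ≤ 1 / 4 := by nlinarith [sq_nonneg (t - 1 / 2)]
    have : t * (1 - t) * k ≤ 1 / 4 * k := by gcongr
    simp only [r]
    linarith
  have hρ0 : ∀ t, 0 ≤ ρ t := fun t => inv_nonneg.mpr (Real.sqrt_nonneg _)
  have hρ1 : ∀ t ∈ Set.Icc (0 : ℝ) 1, 1 ≤ ρ t ∧ ρ t ≤ 1 + k / 3 := by
    intro t ht
    have h1 : 1 ≤ ρ t := by
      by_contra h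
      push Not at h
      have : ρ t ^ 2 < 1 := by nlinarith [hρ0 t]
      have := hr1 t ht
      nlinarith [hρr t, hrpos t]
    refine ⟨h1, ?_⟩
    have h2 : ρ t * r t ≤ 1 := by nlinarith [hρr t, hrpos t]
    have h3 := hr1' t
    have h4 := hrpos t
    nlinarith
  have hcn : ∀ t ∈ Set.Icc (0 : ℝ) 1, ‖c t‖ ≤ 1 := by
    intro t ht
    have h1 := norm_sq_le_euclInner (c t)
    rw [hr] at h1
    have h2 := hr1 t ht
    nlinarith [norm_nonneg (c t)]
  have hd0 := norm_nonneg d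
  have hspeed : ∀ t ∈ Set.Icc (0 : ℝ) 1, bergerNorm ε (ρ t • c t) (deriv (fun t => ρ t • c t) t)
      ≤ bergerNorm ε x d + 8 * C * ‖d‖ ^ 2 := by
    intro t ht
    rw [(hγd t).deriv]
    set w := ((1 - 2 * t) * k / 2 * ρ t ^ 3) • c t + ρ t • d with hw
    obtain ⟨h1, h2⟩ := hρ1 t ht
    have hρ43 : ρ t ≤ 4 / 3 := by linarith
    have hρ3 : ρ t ^ 3 ≤ (4 / 3) ^ 3 := by gcongr
    have hρ30 : 0 ≤ ρ t ^ 3 := pow_nonneg (hρ0 t) 3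
    have h3 : ‖w - d‖ ≤ 6 * ‖d‖ ^ 2 := by
      have e : w - d = ((1 - 2 * t) * k / 2 * ρ t ^ 3) • c t + (ρ t - 1) • d := by
        rw [hw]; module
      rw [e]
      refine (norm_add_le _ _).trans ?_
      rw [norm_smul, norm_smul, Real.norm_eq_abs, Real.norm_eq_abs,
        abs_of_nonneg (by linarith : 0 ≤ ρ t - 1),
        abs_mul, abs_of_nonneg hρ30, abs_div, abs_mul, abs_of_nonneg hk0]
      have h5 : |1 - 2 * t| ≤ 1 := abs_le.mpr ⟨by linarith [ht.2], by linarith [ht.1]⟩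
      have h6 : |1 - 2 * t| * k / |(2 : ℝ)| * ρ t ^ 3 * ‖c t‖ ≤ 1 * k / 2 * (4 / 3) ^ 3 * 1 := by
        rw [abs_two]
        have := hcn t ht
        gcongr
      have h7 : (ρ t - 1) * ‖d‖ ≤ k / 3 * (1 / 2) := by
        have : ρ t - 1 ≤ k / 3 := by linarith
        gcongr
      linarith
    have h4 : ‖ρ t • c t - x‖ ≤ 2 * ‖d‖ := by
      have e : ρ t • c t - x = (ρ t - 1) • c t + t • d := by simp only [c]; module
      rw [e]
      refine (norm_add_le _ _).trans ?_
      rw [norm_smul, norm_smul, Real.norm_eq_abs, Real.norm_eq_abs,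
        abs_of_nonneg (by linarith : 0 ≤ ρ t - 1),
        abs_of_nonneg ht.1]
      have h6 : (ρ t - 1) * ‖c t‖ ≤ k / 3 * 1 := by
        have := hcn t ht
        have : ρ t - 1 ≤ k / 3 := by linarith
        gcongr
      have h7 : t * ‖d‖ ≤ 1 * ‖d‖ := by gcongr; exact ht.2
      nlinarith
    have h5 : bergerNorm ε (ρ t • c t) w
        ≤ bergerNorm ε (ρ t • c t) d + bergerNorm ε (ρ t • c t) (w - d) := by
      have := bergerNorm_add_le hε.le (hγS t) d (w - d)
      rwa [add_sub_cancel] at this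
    have h6 := (hC _ (hγS t) d).2.2 x hx
    have h7 := (hC _ (hγS t) (w - d)).2.1
    have h8 : C * ‖ρ t • c t - x‖ * ‖d‖ ≤ C * (2 * ‖d‖) * ‖d‖ := by gcongr
    have h9 : C * ‖w - d‖ ≤ C * (6 * ‖d‖ ^ 2) := by gcongr
    linarith
  refine ⟨_, ⟨fun t => ρ t • c t, hγs, fun t _ => hγS t, ?_, ?_, rfl⟩, ?_⟩
  · simp [ρ, r, c]
  · simp [ρ, r, c, hd]
  · calc length ε (fun t => ρ t • c t)
        ≤ ∫ _ in (0 : ℝ)..1, (bergerNorm ε x d + 8 * C * ‖d‖ ^ 2) :=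
          intervalIntegral.integral_mono_on zero_le_one
            ((continuous_speed hγs).intervalIntegrable _ _)
            (continuous_const.intervalIntegrable _ _) hspeed
      _ = _ := by simp

lemma dist_le {C : ℝ} (hε : 0 < ε) (hC : NormBounds ε C) (hC1 : 1 ≤ C) {x y : ℂ × ℂ}
    (hx : x ∈ S3) (hy : y ∈ S3) (hxy : ‖y - x‖ ≤ 1 / 2) :
    dist ε x y ≤ bergerNorm ε x (y - x) + 8 * C * ‖y - x‖ ^ 2 :=
  let ⟨_, hl, h⟩ := exists_short_curve hε hC hC1 hx hy hxy
  (csInf_le (bddBelow_lengths x y) hl).trans h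

lemma lengths_nonempty {C : ℝ} (hε : 0 < ε) (hC : NormBounds ε C) (hC1 : 1 ≤ C) {x y : ℂ × ℂ}
    (hx : x ∈ S3) (hy : y ∈ S3) (hxy : ‖y - x‖ ≤ 1 / 2) : (lengths ε x y).Nonempty :=
  let ⟨l, hl, _⟩ := exists_short_curve hε hC hC1 hx hy hxy
  ⟨l, hl⟩

end

/-! ### The flow of a vector field to first order in the initial point -/

section Flow

variable {E : Type*} [NormedAddCommGroup E] [NormedSpace ℝ E]

/-- `σ y` is the integral curve of `W` that starts at `y`, for times in `(-2, 2)`. -/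
structure IsFlow (W : E → E) (σ : E → ℝ → E) : Prop where
  zero : ∀ y, σ y 0 = y
  hasDerivAt : ∀ y, ∀ t ∈ Set.Ioo (-2 : ℝ) 2, HasDerivAt (σ y) (W (σ y t)) t

/-- A bounded Lipschitz vector field has a flow. -/
lemma exists_isFlow [CompleteSpace E] {W : E → E} {K B : ℝ≥0} (hK : LipschitzWith K W)
    (hB : ∀ q, ‖W q‖ ≤ B) : ∃ σ, IsFlow W σ := by
  have h : ∀ y : E, ∃ α : ℝ → E, α 0 = y ∧ ∀ t ∈ Set.Icc (-2 : ℝ) 2,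
      HasDerivWithinAt α (W (α t)) (Set.Icc (-2 : ℝ) 2) t := by
    intro y
    have hp : IsPicardLindelof (fun _ => W) (tmin := -2) (tmax := 2) ⟨0, by norm_num⟩ y
        (2 * B) 0 B K := by
      refine IsPicardLindelof.of_time_independent (fun x _ => hB x) hK.lipschitzOnWith ?_
      simp [mul_comm]
    exact hp.exists_eq_forall_mem_Icc_hasDerivWithinAt₀
  choose σ h0 hσ using h
  exact ⟨σ, h0, fun y t ht =>
    (hσ y t (Set.Ioo_subset_Icc_self ht)).hasDerivAt (Icc_mem_nhds ht.1 ht.2)⟩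

namespace IsFlow

variable {W : E → E} {σ : E → ℝ → E} (h : IsFlow W σ) {K B K' : ℝ≥0}

include h

lemma norm_sub_le (hB : ∀ q, ‖W q‖ ≤ B) (y : E) {t : ℝ} (ht : t ∈ Set.Ioo (-2 : ℝ) 2) :
    ‖σ y t - y‖ ≤ B * |t| := by
  have := (convex_Ioo (-2 : ℝ) 2).norm_image_sub_le_of_norm_hasDerivWithin_le
    (fun s hs => (h.hasDerivAt y s hs).hasDerivWithinAt) (fun s _ => hB _)
    (x := 0) (y := t) (by norm_num) ht
  rwa [h.zero, sub_zero, Real.norm_eq_abs] at this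

lemma continuousOn_Icc (y : E) : ContinuousOn (σ y) (Set.Icc 0 1) := fun t ht =>
  (h.hasDerivAt y t ⟨by linarith [ht.1], by linarith [ht.2]⟩).continuousAt.continuousWithinAt

lemma norm_sub_le_exp (hK : LipschitzWith K W) (x y : E) {t : ℝ} (ht : t ∈ Set.Icc (0 : ℝ) 1) :
    ‖σ y t - σ x t‖ ≤ ‖y - x‖ * Real.exp K := by
  have hd : ∀ y, ∀ s ∈ Set.Ico (0 : ℝ) 1, HasDerivWithinAt (σ y) (W (σ y s)) (Set.Ici s) s :=
    fun y s hs => (h.hasDerivAt y s ⟨by linarith [hs.1], by linarith [hs.2]⟩).hasDerivWithinAt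
  have := dist_le_of_trajectories_ODE (fun _ => hK) (h.continuousOn_Icc y) (hd y)
    (h.continuousOn_Icc x) (hd x) (by rw [h.zero, h.zero]) t ht
  rw [dist_eq_norm, dist_eq_norm] at this
  refine this.trans ?_
  gcongr
  have : (0 : ℝ) ≤ K := K.2
  nlinarith [ht.2]

/-- The flow to first order in time and in the initial point. -/
lemma norm_variation_le (hK : LipschitzWith K W) (hB : ∀ q, ‖W q‖ ≤ B)
    (hW : Differentiable ℝ W) (hK' : LipschitzWith K' (fderiv ℝ W)) (x y : E) {t : ℝ}
    (ht : t ∈ Set.Icc (0 : ℝ) 1) :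
    ‖σ y t - σ x t - (y - x) - t • fderiv ℝ W x (y - x)‖
      ≤ (Real.exp K * (2 * K' * B + K' + K * K)) * (t + ‖y - x‖) * ‖y - x‖ * t := by
  have hmem : ∀ s ∈ Set.Icc (0 : ℝ) t, s ∈ Set.Ioo (-2 : ℝ) 2 := fun s hs =>
    ⟨by linarith [hs.1], by linarith [hs.2, ht.2]⟩
  have hle : ∀ s ∈ Set.Icc (0 : ℝ) t, s ∈ Set.Icc (0 : ℝ) 1 := fun s hs =>
    ⟨hs.1, hs.2.trans ht.2⟩
  have hDx : ‖fderiv ℝ W x‖ ≤ K := norm_fderiv_le_of_lipschitz ℝ hK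
  have hexp : 1 ≤ Real.exp K := Real.one_le_exp K.2
  set δ := ‖y - x‖ with hδ
  have hδ0 : 0 ≤ δ := norm_nonneg _
  -- the displacement of the two curves
  have hdisp : ∀ s ∈ Set.Icc (0 : ℝ) t, ‖σ y s - σ x s - (y - x)‖ ≤ K * (δ * Real.exp K) * s := by
    intro s hs
    have := norm_image_sub_le_of_norm_deriv_le_segment' (f := fun s => σ y s - σ x s) (a := 0)
      (b := t) (C := K * (δ * Real.exp K))
      (fun r hr =>
        ((h.hasDerivAt y r (hmem r hr)).sub (h.hasDerivAt x r (hmem r hr))).hasDerivWithinAt)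
      (fun r hr => (hK.norm_sub_le _ _).trans (by
        gcongr
        exact h.norm_sub_le_exp hK x y (hle r (Set.Ico_subset_Icc_self hr)))) s hs
    simpa [h.zero] using this
  have hbound : ∀ s ∈ Set.Icc (0 : ℝ) t, ‖W (σ y s) - W (σ x s) - fderiv ℝ W x (y - x)‖
      ≤ (Real.exp K * (2 * K' * B + K' + K * K)) * (t + δ) * δ := by
    intro s hs
    have hx := h.norm_sub_le hB x (hmem s hs)
    have hy := h.norm_sub_le hB y (hmem s hs)
    rw [abs_of_nonneg hs.1] at hx hy
    have hR : ∀ z ∈ segment ℝ (σ x s) (σ y s), ‖fderiv ℝ W z - fderiv ℝ W x‖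
        ≤ K' * (B * t + δ) := by
      intro z hz
      refine (hK'.norm_sub_le _ _).trans ?_
      gcongr
      have hball : segment ℝ (σ x s) (σ y s) ⊆ Metric.closedBall x (B * t + δ) := by
        refine (convex_closedBall x _).segment_subset ?_ ?_ <;> rw [mem_closedBall_iff_norm]
        · have : (B : ℝ) * s ≤ B * t := by gcongr; exact hs.2
          linarith
        · have : (B : ℝ) * s ≤ B * t := by gcongr; exact hs.2
          have : ‖σ y s - x‖ ≤ ‖σ y s - y‖ + ‖y - x‖ := norm_sub_le_norm_sub_add_norm_sub _ _ _
          linarith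
      exact mem_closedBall_iff_norm.mp (hball hz)
    have h1 := (convex_segment (σ x s) (σ y s)).norm_image_sub_le_of_norm_fderiv_le'
      (fun z _ => hW z) hR (left_mem_segment ℝ _ _) (right_mem_segment ℝ _ _)
    have h2 := h.norm_sub_le_exp hK x y (hle s hs)
    have h3 : ‖fderiv ℝ W x (σ y s - σ x s) - fderiv ℝ W x (y - x)‖
        ≤ K * (K * (δ * Real.exp K) * t) := by
      rw [← map_sub]
      refine ((fderiv ℝ W x).le_opNorm _).trans ?_
      gcongr
      refine (hdisp s hs).trans ?_
      gcongr
      exact hs.2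
    have h4 : W (σ y s) - W (σ x s) - fderiv ℝ W x (y - x)
        = (W (σ y s) - W (σ x s) - fderiv ℝ W x (σ y s - σ x s))
          + (fderiv ℝ W x (σ y s - σ x s) - fderiv ℝ W x (y - x)) := by abel
    rw [h4]
    refine (norm_add_le _ _).trans ?_
    have h5 : K' * (B * t + δ) * ‖σ y s - σ x s‖ ≤ K' * (B * t + δ) * (δ * Real.exp K) := by
      have : 0 ≤ (K' : ℝ) * (B * t + δ) := by have := ht.1; positivity
      gcongr
    have h6 : (Real.exp K * (2 * K' * B + K' + K * K)) * (t + δ) * δ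
        - (K' * (B * t + δ) * (δ * Real.exp K) + K * (K * (δ * Real.exp K) * t))
        = Real.exp K * δ * (K' * B * t + 2 * K' * B * δ + K' * t + K * K * δ) := by ring
    have h7 : 0 ≤ Real.exp K * δ * (K' * B * t + 2 * K' * B * δ + K' * t + K * K * δ) := by
      have := ht.1
      positivity
    linarith
  have := norm_image_sub_le_of_norm_deriv_le_segment'
    (f := fun s => σ y s - σ x s - s • fderiv ℝ W x (y - x)) (a := 0) (b := t)
    (fun r hr => (((h.hasDerivAt y r (hmem r hr)).sub (h.hasDerivAt x r (hmem r hr))).sub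
      (((hasDerivAt_id' r).smul_const _).congr_deriv (one_smul _ _))).hasDerivWithinAt)
    (fun r hr => hbound r (Set.Ico_subset_Icc_self hr)) t ⟨ht.1, le_rfl⟩
  simp only [h.zero, zero_smul, sub_zero] at this
  refine le_trans (le_of_eq ?_) this
  congr 1
  abel

/-- A curve that runs along `W` with speed the derivative of a function `τ` with values in `(-2, 2)`
is a reparametrized integral curve. -/
lemma eq_of_hasDerivAt (hK : LipschitzWith K W) {γ : ℝ → E} {τ τ' : ℝ → ℝ}
    (hτ : ∀ u ∈ Set.Icc (0 : ℝ) 1, τ u ∈ Set.Ioo (-2 : ℝ) 2) (hτ0 : τ 0 = 0)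
    (hτd : ∀ u ∈ Set.Icc (0 : ℝ) 1, HasDerivAt τ (τ' u) u)
    (hτc : ContinuousOn τ' (Set.Icc 0 1))
    (hγ : ∀ u ∈ Set.Icc (0 : ℝ) 1, HasDerivAt γ (τ' u • W (γ u)) u) :
    γ 1 = σ (γ 0) (τ 1) := by
  obtain ⟨c, hc⟩ := isCompact_Icc.exists_bound_of_continuousOn hτc
  have hc0 : 0 ≤ c := (norm_nonneg _).trans (hc 0 ⟨le_rfl, zero_le_one⟩)
  have hd : ∀ u ∈ Set.Icc (0 : ℝ) 1,
      HasDerivAt (fun u => σ (γ 0) (τ u)) (τ' u • W (σ (γ 0) (τ u))) u := fun u hu =>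
    (h.hasDerivAt (γ 0) (τ u) (hτ u hu)).scomp u (hτd u hu)
  refine ODE_solution_unique_of_mem_Icc_right (v := fun u q => τ' u • W q)
    (s := fun _ => Set.univ) (K := Real.toNNReal c * K) (a := 0) (b := 1) (f := γ)
    (g := fun u => σ (γ 0) (τ u)) ?_ ?_ ?_ (fun _ _ => trivial)
    ?_ ?_ (fun _ _ => trivial) ?_ ⟨zero_le_one, le_rfl⟩
  · intro u hu
    refine LipschitzWith.lipschitzOnWith (LipschitzWith.of_dist_le_mul fun p q => ?_)
    rw [dist_eq_norm, ← smul_sub, norm_smul, dist_eq_norm, NNReal.coe_mul,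
      Real.coe_toNNReal c hc0, mul_assoc]
    exact mul_le_mul (hc u (Set.Ico_subset_Icc_self hu)) (hK.norm_sub_le p q) (norm_nonneg _) hc0
  · exact HasDerivAt.continuousOn hγ
  · exact fun u hu => (hγ u (Set.Ico_subset_Icc_self hu)).hasDerivWithinAt
  · exact HasDerivAt.continuousOn hd
  · exact fun u hu => (hd u (Set.Ico_subset_Icc_self hu)).hasDerivWithinAt
  · simp [hτ0, h.zero]

end IsFlow
end Flow

/-! ### Plaques and their distances -/

section

/-- The field `W` generates the foliation near `x`, where it moves at unit speed in the direction
measured by `φ`; it is tangent to the spheres about the origin and has compact support. -/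
structure LocalGenerator (F : OneDimFoliation) (x : ℂ × ℂ) (W : ℂ × ℂ → ℂ × ℂ)
    (φ : ℂ × ℂ →L[ℝ] ℝ) (ρ : ℝ) : Prop where
  smooth : ContDiff ℝ ∞ W
  compact : HasCompactSupport W
  tangent : ∀ q, euclInner (W q) q = 0
  normalized : ∀ q ∈ Metric.ball x ρ, φ (W q) = 1
  line : ∀ q ∈ Metric.ball x ρ, q ∈ S3 → F.line q = Submodule.span ℝ {W q}

/-- Bounds for a vector field and its first two derivatives. -/
structure FieldBounds (W : ℂ × ℂ → ℂ × ℂ) (K B K' : ℝ≥0) : Prop where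
  lipschitz : LipschitzWith K W
  bound : ∀ q, ‖W q‖ ≤ B
  lipschitz_fderiv : LipschitzWith K' (fderiv ℝ W)

lemma exists_fieldBounds {W : ℂ × ℂ → ℂ × ℂ} (hs : ContDiff ℝ ∞ W) (hc : HasCompactSupport W) :
    ∃ K B K', FieldBounds W K B K' := by
  obtain ⟨K, hK⟩ := hs.lipschitzWith_of_hasCompactSupport hc (by simp)
  obtain ⟨B, hB⟩ := hc.exists_bound_of_continuous hs.continuous
  obtain ⟨K', hK'⟩ := ContDiff.lipschitzWith_of_hasCompactSupport (hc.fderiv ℝ)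
    (hs.fderiv_right (m := 1) (by norm_cast)) (by simp)
  exact ⟨K, B.toNNReal, K', hK, fun q => (hB q).trans (Real.le_coe_toNNReal B), hK'⟩

variable {F : OneDimFoliation} {x : ℂ × ℂ} {W : ℂ × ℂ → ℂ × ℂ} {φ : ℂ × ℂ →L[ℝ] ℝ} {ρ : ℝ}
  {σ : ℂ × ℂ → ℝ → ℂ × ℂ}

lemma IsFlow.mem_S3 (h : IsFlow W σ) (hW : ∀ q, euclInner (W q) q = 0) {y : ℂ × ℂ} (hy : y ∈ S3)
    {t : ℝ} (ht : t ∈ Set.Ioo (-2 : ℝ) 2) : σ y t ∈ S3 := by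
  have hd : ∀ s ∈ Set.Ioo (-2 : ℝ) 2,
      HasDerivAt (fun s => euclInner (σ y s) (σ y s)) 0 s := fun s hs =>
    (hasDerivAt_euclInner (h.hasDerivAt y s hs) (h.hasDerivAt y s hs)).congr_deriv (by
      rw [euclInner_comm (σ y s), hW, add_zero])
  have := isOpen_Ioo.is_const_of_deriv_eq_zero isPreconnected_Ioo
    (fun s hs => (hd s hs).differentiableAt.differentiableWithinAt) (fun s hs => (hd s hs).deriv)
    ht (show (0 : ℝ) ∈ Set.Ioo (-2 : ℝ) 2 by norm_num)
  rw [mem_S3_iff] at hy ⊢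
  rw [this, h.zero, hy]

namespace LocalGenerator

lemma flow_mem_plaque (g : LocalGenerator F x W φ ρ) (h : IsFlow W σ) {U : Set (ℂ × ℂ)}
    (hU : U ⊆ Metric.ball x ρ) {y : ℂ × ℂ} (hy : y ∈ S3) {t : ℝ} (ht : t ∈ Set.Icc (0 : ℝ) 1)
    (hσ : ∀ s ∈ Set.Icc (0 : ℝ) t, σ y s ∈ U) : σ y t ∈ F.plaque U y := by
  -- the time is reparametrized so that the curve is defined on the whole line
  let s : ℝ → ℝ := fun u => t * Real.sin (Real.pi / 2 * u) ^ 2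
  have hs : ∀ u, s u ∈ Set.Icc (0 : ℝ) t := fun u =>
    ⟨mul_nonneg ht.1 (sq_nonneg _), mul_le_of_le_one_right ht.1 (Real.sin_sq_le_one _)⟩
  have hs' : ∀ u, s u ∈ Set.Ioo (-2 : ℝ) 2 := fun u =>
    ⟨by linarith [(hs u).1], by linarith [(hs u).2, ht.2]⟩
  have hsd : ContDiff ℝ 1 s := by simp only [s]; fun_prop
  have hd : ∀ u, HasDerivAt (fun u => σ y (s u)) (deriv s u • W (σ y (s u))) u := fun u =>
    (h.hasDerivAt y (s u) (hs' u)).scomp u (hsd.differentiable (by simp) u).hasDerivAt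
  have hc : Continuous fun u => σ y (s u) :=
    continuous_iff_continuousAt.mpr fun u => (hd u).continuousAt
  have hderiv : deriv (fun u => σ y (s u)) = fun u => deriv s u • W (σ y (s u)) :=
    funext fun u => (hd u).deriv
  refine ⟨fun u => σ y (s u), ?_, ?_, ?_, fun u _ => ⟨⟨hσ _ (hs u), ?_⟩, ?_⟩⟩
  · rw [contDiff_one_iff_deriv]
    refine ⟨fun u => (hd u).differentiableAt, ?_⟩
    rw [hderiv]
    exact (hsd.continuous_deriv le_rfl).smul (g.smooth.continuous.comp hc)
  · simp [s, h.zero]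
  · simp [s]
  · exact h.mem_S3 g.tangent hy (hs' u)
  · rw [hderiv, g.line _ (hU (hσ _ (hs u))) (h.mem_S3 g.tangent hy (hs' u))]
    exact Submodule.smul_mem _ _ (Submodule.mem_span_singleton_self _)

/-- A plaque is an arc of the integral curve, parametrized by `φ`. -/
lemma eq_flow_of_mem_plaque (g : LocalGenerator F x W φ ρ) (h : IsFlow W σ) {K : ℝ≥0}
    (hK : LipschitzWith K W) {U : Set (ℂ × ℂ)}
    (hU : U ⊆ Metric.ball x ρ) {y z : ℂ × ℂ} (hφ : ∀ q ∈ U, |φ q - φ y| < 2)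
    (hz : z ∈ F.plaque U y) : z = σ y (φ z - φ y) := by
  obtain ⟨γ, hγ, rfl, rfl, hγU⟩ := hz
  have hd : ∀ u, HasDerivAt γ (deriv γ u) u := fun u =>
    (hγ.differentiable (by simp) u).hasDerivAt
  refine h.eq_of_hasDerivAt hK (τ := fun u => φ (γ u) - φ (γ 0)) (τ' := fun u => φ (deriv γ u))
    (fun u hu => abs_lt.mp (hφ _ (hγU u hu).1.1)) (sub_self _)
    (fun u _ => (φ.hasFDerivAt.comp_hasDerivAt u (hd u)).sub_const _)
    (φ.continuous.comp (hγ.continuous_deriv le_rfl)).continuousOn fun u hu => ?_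
  refine (hd u).congr_deriv ?_
  obtain ⟨⟨hu1, hu2⟩, hu3⟩ := hγU u hu
  rw [g.line _ (hU hu1) hu2] at hu3
  obtain ⟨c, hc⟩ := Submodule.mem_span_singleton.mp hu3
  rw [← hc, map_smul, g.normalized _ (hU hu1), smul_eq_mul, mul_one]

variable {K B K' : ℝ≥0} {ε C : ℝ}

/-- The plaque of a point `y` near `x` is, to second order, not closer to `x` than `y` is in a
direction orthogonal to the leaves. -/
lemma exists_le_dist (g : LocalGenerator F x W φ ρ) (h : IsFlow W σ) (b : FieldBounds W K B K')
    (hC : NormBounds ε C) (hC1 : 1 ≤ C) (hε : 0 < ε) (hx : x ∈ S3)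
    {l : ℂ × ℂ →L[ℝ] ℝ} (hl : ∀ v, l v ≤ bergerNorm ε x v) (hlW : l (W x) = 0) :
    ∃ c ≥ 0, ∀ U ⊆ Metric.ball x ρ, U ⊆ Metric.closedBall x (1 / 2) →
      (∀ p ∈ U, ∀ q ∈ U, |φ q - φ p| < 2) → ∀ y ∈ U, ∀ z ∈ F.plaque U y,
      l (y - x) - c * ‖y - x‖ ^ 2 ≤ dist ε x z := by
  set m := ‖l‖
  set f := ‖φ‖
  set P := C * m + 1 with hP
  have hC0 : 0 ≤ C := zero_le_one.trans hC1
  have hm0 : 0 ≤ m := norm_nonneg _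
  have hf0 : 0 ≤ f := norm_nonneg _
  have hP0 : 0 ≤ P := by positivity
  refine ⟨f * P * (m * (K * (1 + B * (f * P)))) + C ^ 3 * m ^ 2, by positivity,
    fun U hU hU2 hφ y hy z hz => ?_⟩
  set δ := ‖y - x‖ with hδ
  have hδ0 : 0 ≤ δ := norm_nonneg _
  set D := dist ε x z
  have hD0 : 0 ≤ D := dist_nonneg _ _
  have hlδ : l (y - x) ≤ m * δ := (le_abs_self _).trans (l.le_opNorm _)
  rcases le_or_gt (l (y - x)) D with hcase | hcase
  · refine le_trans (sub_le_self _ (by positivity)) hcase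
  obtain ⟨hzU, hzS⟩ : z ∈ U ∩ S3 := by
    obtain ⟨γ, -, -, rfl, hγ⟩ := hz
    exact (hγ 1 ⟨zero_le_one, le_rfl⟩).1
  have hne := lengths_nonempty hε hC hC1 hx hzS (mem_closedBall_iff_norm.mp (hU2 hzU))
  have hDm : D ≤ m * δ := hcase.le.trans hlδ
  have hzx : ‖z - x‖ ≤ C * (m * δ) := (norm_sub_le_dist hC hC0 hne).trans (by gcongr)
  have hzy : ‖z - y‖ ≤ P * δ := by
    have := norm_sub_le_norm_sub_add_norm_sub z x y
    rw [norm_sub_rev x y] at this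
    rw [hP]
    linarith
  set Λ := φ z - φ y with hΛ
  have hΛ2 : |Λ| < 2 := hφ y hy z hzU
  have hΛP : |Λ| ≤ f * (P * δ) := by
    rw [hΛ, ← map_sub]
    exact (φ.le_opNorm _).trans (by gcongr)
  have hzσ : z = σ y Λ := g.eq_flow_of_mem_plaque h b.lipschitz hU (fun q hq => hφ y hy q hq) hz
  have hmem : ∀ s ∈ Set.uIcc 0 Λ, |s| ≤ |Λ| := fun s hs => by
    have := Set.abs_sub_left_of_mem_uIcc hs
    simpa using this
  have hlz : |l (z - y)| ≤ m * (K * (δ + B * (f * (P * δ)))) * |Λ| := by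
    have := (convex_uIcc 0 Λ).norm_image_sub_le_of_norm_hasDerivWithin_le
      (f := fun s => l (σ y s)) (f' := fun s => l (W (σ y s)))
      (C := m * (K * (δ + B * (f * (P * δ))))) (x := 0) (y := Λ)
      (fun s hs => (l.hasFDerivAt.comp_hasDerivAt s (h.hasDerivAt y s
        (abs_lt.mp ((hmem s hs).trans_lt hΛ2)))).hasDerivWithinAt) (fun s hs => by
        have e : l (W (σ y s)) = l (W (σ y s) - W x) := by rw [map_sub, hlW, sub_zero]
        rw [e]
        refine (l.le_opNorm _).trans ?_
        gcongr
        refine (b.lipschitz.norm_sub_le _ _).trans ?_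
        gcongr
        have h1 := h.norm_sub_le b.bound y (abs_lt.mp ((hmem s hs).trans_lt hΛ2))
        have h2 : (B : ℝ) * |s| ≤ B * (f * (P * δ)) := by
          gcongr; exact (hmem s hs).trans hΛP
        have h3 := norm_sub_le_norm_sub_add_norm_sub (σ y s) y x
        linarith) Set.left_mem_uIcc Set.right_mem_uIcc
    rw [hzσ, map_sub]
    simpa [h.zero] using this
  have hcal := calibration_le_dist hC hC0 hne l hl
  have hsplit : l (z - x) = l (z - y) + l (y - x) := by rw [← map_add]; congr 1; abel
  have h1 : |l (z - y)| ≤ m * (K * (δ + B * (f * (P * δ)))) * (f * (P * δ)) :=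
    hlz.trans (by gcongr)
  have h2 : C ^ 3 * D * D ≤ C ^ 3 * (m * δ) * (m * δ) := by gcongr
  have h3 := neg_abs_le (l (z - y))
  change l (z - x) ≤ (1 + C ^ 3 * D) * D at hcal
  nlinarith

/-- The distance between two integral curves to first order. -/
lemma exists_dist_le (h : IsFlow W σ) (b : FieldBounds W K B K') (hW : Differentiable ℝ W)
    (hWt : ∀ q, euclInner (W q) q = 0)
    (hC : NormBounds ε C) (hC1 : 1 ≤ C) (hε : 0 < ε) (hx : x ∈ S3) :
    ∃ c ≥ 0, ∀ y ∈ S3, ∀ t ∈ Set.Icc (0 : ℝ) 1, ‖σ y t - σ x t‖ ≤ 1 / 2 →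
      dist ε (σ x t) (σ y t) ≤ bergerNorm ε (σ x t) (y - x + t • fderiv ℝ W x (y - x))
        + c * (t ^ 2 + ‖y - x‖) * ‖y - x‖ := by
  set V := Real.exp K * (2 * K' * B + K' + K * K) with hV
  have hC0 : 0 ≤ C := zero_le_one.trans hC1
  have hV0 : 0 ≤ V := by positivity
  refine ⟨C * V + 8 * C * Real.exp K ^ 2, by positivity, fun y hy t ht hyx => ?_⟩
  set δ := ‖y - x‖ with hδ
  have hδ0 : 0 ≤ δ := norm_nonneg _
  have ht2 : t ∈ Set.Ioo (-2 : ℝ) 2 := ⟨by linarith [ht.1], by linarith [ht.2]⟩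
  have hx' := h.mem_S3 hWt hx ht2
  have hy' := h.mem_S3 hWt hy ht2
  have h1 := dist_le hε hC hC1 hx' hy' hyx
  have h2 := h.norm_variation_le b.lipschitz b.bound hW b.lipschitz_fderiv x y ht
  set J := y - x + t • fderiv ℝ W x (y - x) with hJ
  have h3 : ‖σ y t - σ x t - J‖ ≤ V * (t ^ 2 + δ) * δ := by
    rw [hJ, ← sub_sub]
    refine h2.trans ?_
    have : (t + δ) * t ≤ t ^ 2 + δ := by nlinarith [ht.1, ht.2]
    calc V * (t + δ) * δ * t = V * ((t + δ) * t) * δ := by ring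
      _ ≤ _ := by gcongr
  have h4 := bergerNorm_add_le hε.le hx' J (σ y t - σ x t - J)
  rw [add_sub_cancel] at h4
  have h5 := (hC _ hx' (σ y t - σ x t - J)).2.1
  have h6 : C * ‖σ y t - σ x t - J‖ ≤ C * (V * (t ^ 2 + δ) * δ) := by gcongr
  have h7 : ‖σ y t - σ x t‖ ^ 2 ≤ (δ * Real.exp K) ^ 2 := by
    gcongr
    exact h.norm_sub_le_exp b.lipschitz x y ht
  have h8 : (δ * Real.exp K) ^ 2 ≤ Real.exp K ^ 2 * ((t ^ 2 + δ) * δ) := by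
    rw [mul_pow, mul_comm]
    gcongr
    nlinarith [sq_nonneg t]
  have h9 : 8 * C * ‖σ y t - σ x t‖ ^ 2 ≤ 8 * C * (Real.exp K ^ 2 * ((t ^ 2 + δ) * δ)) := by
    gcongr
    exact h7.trans h8
  linarith

end LocalGenerator

end

/-! ### Local equidistance to first order -/

section

variable {F : OneDimFoliation} {x : ℂ × ℂ} {W : ℂ × ℂ → ℂ × ℂ} {φ : ℂ × ℂ →L[ℝ] ℝ} {ρ : ℝ}
  {σ : ℂ × ℂ → ℝ → ℂ × ℂ} {K B K' : ℝ≥0} {ε C : ℝ}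

namespace LocalGenerator

/-- In a metric foliation, the flow along the leaves does not shrink distances orthogonal to the
leaf of `x`, to first order in the distance and up to an error quadratic in time. -/
lemma exists_le_bergerNorm (g : LocalGenerator F x W φ ρ) (hF : F.IsMetric ε) (hρ : 0 < ρ)
    (h : IsFlow W σ) (b : FieldBounds W K B K')
    (hC : NormBounds ε C) (hC1 : 1 ≤ C) (hε : 0 < ε) (hx : x ∈ S3)
    {l : ℂ × ℂ →L[ℝ] ℝ} (hl : ∀ v, l v ≤ bergerNorm ε x v) (hlW : l (W x) = 0) :
    ∃ c ≥ 0, ∃ t₀ > 0, t₀ ≤ 1 ∧ ∀ t ∈ Set.Icc 0 t₀, ∀ᶠ y in 𝓝 x, y ∈ S3 →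
      l (y - x) ≤ bergerNorm ε (σ x t) (y - x + t • fderiv ℝ W x (y - x))
        + c * (t ^ 2 + ‖y - x‖) * ‖y - x‖ := by
  obtain ⟨c₁, hc₁, h₁⟩ := g.exists_le_dist h b hC hC1 hε hx hl hlW
  obtain ⟨c₂, hc₂, h₂⟩ := exists_dist_le (σ := σ) h b (g.smooth.differentiable (by simp)) g.tangent
    hC hC1 hε hx
  set ρ₁ := min ρ (min (1 / 4) (1 / (‖φ‖ + 1))) with hρ₁
  have hρ₁0 : 0 < ρ₁ := lt_min hρ (lt_min (by norm_num) (by positivity))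
  obtain ⟨U, U', hUo, hUo', hxU', hUU', hUN, hmetric⟩ :=
    hF x hx (Metric.ball x ρ₁) (Metric.ball_mem_nhds x hρ₁0)
  have hUρ : U ⊆ Metric.ball x ρ := hUN.trans (Metric.ball_subset_ball (min_le_left _ _))
  have hU4 : U ⊆ Metric.ball x (1 / 4) :=
    hUN.trans (Metric.ball_subset_ball ((min_le_right _ _).trans (min_le_left _ _)))
  have hU2 : U ⊆ Metric.closedBall x (1 / 2) := hU4.trans
    (Metric.ball_subset_closedBall.trans (Metric.closedBall_subset_closedBall (by norm_num)))
  have hφ : ∀ p ∈ U, ∀ q ∈ U, |φ q - φ p| < 2 := by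
    intro p hp q hq
    have hp' := mem_ball_iff_norm'.mp (hUN hp)
    have hq' := mem_ball_iff_norm.mp (hUN hq)
    have hle : ρ₁ ≤ 1 / (‖φ‖ + 1) := (min_le_right _ _).trans (min_le_right _ _)
    rw [le_div_iff₀ (by positivity)] at hle
    rw [← map_sub]
    have h3 := norm_sub_le_norm_sub_add_norm_sub q x p
    have h4 := φ.le_opNorm (q - p)
    rw [Real.norm_eq_abs] at h4
    have h5 : ‖φ‖ * ‖q - p‖ ≤ ‖φ‖ * (2 * ρ₁) := by gcongr; linarith
    linarith
  obtain ⟨r, hr, hrU'⟩ := Metric.isOpen_iff.mp hUo' x hxU'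
  set t₀ := min 1 (r / (2 * (B + 1))) with ht₀
  have hB0 : (0 : ℝ) ≤ B := B.2
  have ht₀0 : 0 < t₀ := lt_min one_pos (by positivity)
  have hBt : B * t₀ < r / 2 := by
    have : t₀ ≤ r / (2 * (B + 1)) := min_le_right _ _
    rw [le_div_iff₀ (by positivity)] at this
    linarith
  refine ⟨c₁ + c₂, by positivity, t₀, ht₀0, min_le_left _ _, fun t ht => ?_⟩
  have ht1 : t ∈ Set.Icc (0 : ℝ) 1 := ⟨ht.1, ht.2.trans (min_le_left _ _)⟩
  filter_upwards [Metric.ball_mem_nhds x (half_pos hr)] with y hy hyS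
  have hstay : ∀ y ∈ Metric.ball x (r / 2), ∀ s ∈ Set.Icc (0 : ℝ) t, σ y s ∈ U' := by
    intro y hy s hs
    refine hrU' (mem_ball_iff_norm.mpr ?_)
    have h3 := h.norm_sub_le b.bound y (t := s) ⟨by linarith [hs.1], by linarith [hs.2, ht1.2]⟩
    rw [abs_of_nonneg hs.1] at h3
    have h4 : (B : ℝ) * s ≤ B * t₀ := by gcongr; exact hs.2.trans ht.2
    have h5 := norm_sub_le_norm_sub_add_norm_sub (σ y s) y x
    have h6 := mem_ball_iff_norm.mp hy
    linarith
  have hxb : x ∈ Metric.ball x (r / 2) := Metric.mem_ball_self (half_pos hr)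
  have hyU' : y ∈ U' := by
    have := hstay y hy 0 ⟨le_rfl, ht.1⟩
    rwa [h.zero] at this
  have hx'p := g.flow_mem_plaque h (hUU'.trans hUρ) hx ht1 (hstay x hxb)
  have hyp := g.flow_mem_plaque h hUρ hyS ht1 fun s hs => hUU' (hstay y hy s hs)
  have heq := hmetric x ⟨hxU', hx⟩ y ⟨hyU', hyS⟩ _ hx'p
  have hup : distTo ε (σ x t) (F.plaque U y) ≤ dist ε (σ x t) (σ y t) :=
    csInf_le ⟨0, by rintro _ ⟨z, -, rfl⟩; exact dist_nonneg _ _⟩ ⟨_, hyp, rfl⟩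
  have hlow : l (y - x) - c₁ * ‖y - x‖ ^ 2 ≤ distTo ε x (F.plaque U y) := by
    refine le_csInf ⟨_, ⟨_, hyp, rfl⟩⟩ ?_
    rintro _ ⟨z, hz, rfl⟩
    exact h₁ U hUρ hU2 hφ y (hUU' hyU') z hz
  have h6 : ‖σ y t - σ x t‖ ≤ 1 / 2 := by
    have e1 := mem_ball_iff_norm.mp (hU4 (hUU' (hstay y hy t ⟨ht.1, le_rfl⟩)))
    have e2 := mem_ball_iff_norm'.mp (hU4 (hUU' (hstay x hxb t ⟨ht.1, le_rfl⟩)))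
    have := norm_sub_le_norm_sub_add_norm_sub (σ y t) x (σ x t)
    linarith
  have h7 := h₂ y hyS t ht1 h6
  have h8 : 0 ≤ c₁ * t ^ 2 * ‖y - x‖ := by positivity
  rw [heq] at hup
  nlinarith

end LocalGenerator

/-- A curve on the sphere with given initial velocity. -/
lemma exists_sphere_curve {A : ℂ × ℂ} (hx : x ∈ S3) (hA : IsTangent x A) :
    ∃ y : ℝ → ℂ × ℂ, y 0 = x ∧ HasDerivAt y A 0 ∧ ∀ s, y s ∈ S3 := by
  set a := euclInner A A with ha
  have ha0 : 0 ≤ a := (sq_nonneg _).trans (norm_sq_le_euclInner A)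
  have hpos : ∀ s : ℝ, 0 < 1 + s ^ 2 * a := fun s => by positivity
  refine ⟨fun s => (Real.sqrt (1 + s ^ 2 * a))⁻¹ • (x + s • A), by simp, ?_, fun s => ?_⟩
  · have h1 : HasDerivAt (fun s : ℝ => 1 + s ^ 2 * a) 0 0 :=
      ((((hasDerivAt_id' (0 : ℝ)).fun_pow 2).mul_const a).const_add 1).congr_deriv (by simp)
    have h2 := (h1.sqrt (hpos 0).ne').fun_inv (Real.sqrt_ne_zero'.mpr (hpos 0))
    have h3 : HasDerivAt (fun s : ℝ => x + s • A) A 0 :=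
      (((hasDerivAt_id' (0 : ℝ)).smul_const A).const_add x).congr_deriv (one_smul _ _)
    exact (h2.fun_smul h3).congr_deriv (by simp)
  · have h1 : euclInner (x + s • A) (x + s • A) = 1 + s ^ 2 * a := by
      have hxx := mem_S3_iff.mp hx
      have hA' : euclInner A x = 0 := hA
      simp only [euclInner_add_left, euclInner_add_right, euclInner_smul_left,
        euclInner_smul_right, hxx, euclInner_comm x A, hA', ← ha]
      ring
    rw [mem_S3_iff, euclInner_smul_left, euclInner_smul_right, h1]
    have h2 := Real.mul_self_sqrt (hpos s).le
    have h3 : Real.sqrt (1 + s ^ 2 * a) ≠ 0 := Real.sqrt_ne_zero'.mpr (hpos s)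
    set w := Real.sqrt (1 + s ^ 2 * a)
    rw [← h2]
    field_simp

lemma deriv_nonneg_of_nonneg_right {f : ℝ → ℝ} {f' t₀ : ℝ} (hf : HasDerivAt f f' 0)
    (h0 : f 0 = 0) (ht₀ : 0 < t₀) (h : ∀ t ∈ Set.Icc 0 t₀, 0 ≤ f t) : 0 ≤ f' := by
  refine ge_of_tendsto hf.tendsto_slope_zero_right ?_
  filter_upwards [Ioo_mem_nhdsGT ht₀] with t ht
  rw [zero_add, h0, sub_zero]
  exact smul_nonneg (inv_nonneg.mpr ht.1.le) (h t ⟨ht.1.le, ht.2.le⟩)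

namespace LocalGenerator

lemma fderiv_nonneg (g : LocalGenerator F x W φ ρ) (hF : F.IsMetric ε) (hρ : 0 < ρ)
    (hε : 0 < ε) (hx : x ∈ S3) {A : ℂ × ℂ} (hA : IsTangent x A) (hAW : metric ε x (W x) A = 0) :
    0 ≤ euclInner (fderiv ℝ W x A) A + (ε - 1) * euclInner A (hopf x)
      * (euclInner (fderiv ℝ W x A) (hopf x) + euclInner A (hopf (W x))) := by
  rcases eq_or_ne A 0 with rfl | hA0
  · simp [euclInner]
  obtain ⟨K, B, K', b⟩ := exists_fieldBounds g.smooth g.compact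
  obtain ⟨C, hC1, hC⟩ := exists_bergerNorm_bounds hε
  obtain ⟨σ, h⟩ := exists_isFlow b.lipschitz b.bound
  set n := bergerNorm ε x A with hn
  have hn0 : 0 < n := by
    have h1 := (hC x hx A).1
    have h2 : 0 < ‖A‖ := norm_pos_iff.mpr hA0
    by_contra h3
    push Not at h3
    nlinarith
  have hnn : n ^ 2 = metric ε x A A := Real.sq_sqrt (metric_self_nonneg hε.le hx A)
  have hmet : ∃ l : ℂ × ℂ →L[ℝ] ℝ, ∀ v, l v = n⁻¹ * metric ε x v A := by
    refine ⟨LinearMap.toContinuousLinearMap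
      { toFun := fun v => n⁻¹ * metric ε x v A
        map_add' := fun u v => ?_
        map_smul' := fun r v => ?_ }, fun v => rfl⟩
    · simp only [metric_eq ε hx, euclInner_add_left]; ring
    · simp only [metric_eq ε hx, euclInner_smul_left, smul_eq_mul, RingHom.id_apply]; ring
  obtain ⟨l, hl⟩ := hmet
  have hl1 : ∀ v, l v ≤ bergerNorm ε x v := fun v => by
    rw [hl, inv_mul_le_iff₀ hn0, mul_comm]
    exact metric_le hε.le hx v A
  have hlA : l A = n := by
    rw [hl, ← hnn]; field_simp
  have hlW : l (W x) = 0 := by rw [hl, hAW, mul_zero]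
  obtain ⟨c, hc, t₀, ht₀, ht₁, hineq⟩ := g.exists_le_bergerNorm hF hρ h b hC hC1 hε hx hl1 hlW
  obtain ⟨y, hy0, hyd, hyS⟩ := exists_sphere_curve hx hA
  set J : ℝ → ℂ × ℂ := fun t => A + t • fderiv ℝ W x A with hJ
  have hmain : ∀ t ∈ Set.Icc 0 t₀, n ≤ bergerNorm ε (σ x t) (J t) + c * t ^ 2 * ‖A‖ := by
    intro t ht
    have hslope := hyd.tendsto_slope_zero_right
    simp only [zero_add, hy0] at hslope
    have hyc : Filter.Tendsto y (𝓝[>] 0) (𝓝 x) := by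
      have := hyd.continuousAt.tendsto.mono_left (nhdsWithin_le_nhds (s := Set.Ioi 0))
      rwa [hy0] at this
    have hcont : Continuous fun v : (ℂ × ℂ) × (ℂ × ℂ) =>
        bergerNorm ε (σ x t) (v.1 + t • fderiv ℝ W x v.1)
          + c * (t ^ 2 + ‖v.2 - x‖) * ‖v.1‖ - l v.1 := by
      have h1 : Continuous fun v : (ℂ × ℂ) × (ℂ × ℂ) =>
          bergerNorm ε (σ x t) (v.1 + t • fderiv ℝ W x v.1) :=
        continuous_bergerNorm continuous_const (by fun_prop)
      fun_prop
    have hlim := (hcont.tendsto (A, x)).comp (hslope.prodMk_nhds hyc)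
    have h0 : 0 ≤ bergerNorm ε (σ x t) (A + t • fderiv ℝ W x A)
          + c * (t ^ 2 + ‖x - x‖) * ‖A‖ - l A := by
      refine ge_of_tendsto hlim ?_
      filter_upwards [hyc.eventually (hineq t ht), self_mem_nhdsWithin] with s hs hs0
      have hs0 : 0 < s := hs0
      have h1 := hs (hyS s)
      have hσS := h.mem_S3 g.tangent hx (t := t) ⟨by linarith [ht.1], by linarith [ht.2]⟩
      have h2 : s⁻¹ • (y s - x) + t • fderiv ℝ W x (s⁻¹ • (y s - x))
          = s⁻¹ • (y s - x + t • fderiv ℝ W x (y s - x)) := by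
        rw [map_smul]; module
      simp only [Function.comp_apply]
      rw [h2, bergerNorm_smul hε.le hσS, norm_smul, map_smul, Real.norm_eq_abs,
        abs_of_pos (inv_pos.mpr hs0), smul_eq_mul]
      have h3 := mul_le_mul_of_nonneg_left h1 (inv_pos.mpr hs0).le
      linarith
    rw [sub_self, norm_zero, add_zero, hlA] at h0
    linarith
  set Q := C * (‖A‖ + ‖fderiv ℝ W x A‖) with hQ
  have hQ0 : 0 ≤ Q := by have := zero_le_one.trans hC1; positivity
  set c₃ := 2 * Q * (c * ‖A‖) + (c * ‖A‖) ^ 2 with hc₃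
  let f : ℝ → ℝ := fun t => ε * (euclInner (J t) (J t) + (ε - 1) *
    (euclInner (J t) (hopf (σ x t)) * euclInner (J t) (hopf (σ x t)))) + c₃ * t ^ 2 - n ^ 2
  have hJd : HasDerivAt J (fderiv ℝ W x A) 0 :=
    (((hasDerivAt_id' (0 : ℝ)).smul_const _).const_add A).congr_deriv (one_smul _ _)
  have hσd : HasDerivAt (fun t => hopf (σ x t)) (hopf (W x)) 0 := by
    have := h.hasDerivAt x 0 (by norm_num)
    rw [h.zero] at this
    exact frame₁.hasFDerivAt.comp_hasDerivAt 0 this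
  have hJ0 : J 0 = A := by simp [hJ]
  have hi := hasDerivAt_euclInner hJd hσd
  have hfd :=
    ((((hasDerivAt_euclInner hJd hJd).add ((hi.mul hi).const_mul (ε - 1))).const_mul ε).add
      (((hasDerivAt_id' (0 : ℝ)).fun_pow 2).const_mul c₃)).sub_const (n ^ 2)
  have hf0 : f 0 = 0 := by
    simp only [f, hJ0, h.zero]
    rw [hnn, metric_eq ε hx]
    ring
  have hfpos : ∀ t ∈ Set.Icc 0 t₀, 0 ≤ f t := by
    intro t ht
    have hσS := h.mem_S3 g.tangent hx (t := t) ⟨by linarith [ht.1], by linarith [ht.2]⟩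
    have h1 := hmain t ht
    set N := bergerNorm ε (σ x t) (J t) with hN
    have hN0 : 0 ≤ N := bergerNorm_nonneg _ _
    have hN2 : N ^ 2 = metric ε (σ x t) (J t) (J t) :=
      Real.sq_sqrt (metric_self_nonneg hε.le hσS _)
    rw [metric_eq ε hσS] at hN2
    have ht1 : t ≤ 1 := ht.2.trans ht₁
    have hNQ : N ≤ Q := by
      refine (hC _ hσS _).2.1.trans ?_
      rw [hQ]
      have hJn : ‖J t‖ ≤ ‖A‖ + ‖fderiv ℝ W x A‖ := by
        refine (norm_add_le _ _).trans ?_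
        rw [norm_smul, Real.norm_eq_abs, abs_of_nonneg ht.1]
        gcongr
        exact mul_le_of_le_one_left (norm_nonneg _) ht1
      have := zero_le_one.trans hC1
      gcongr
    have h2 : n ^ 2 ≤ (N + c * t ^ 2 * ‖A‖) ^ 2 := by gcongr
    have h3 : N * (c * ‖A‖) * t ^ 2 ≤ Q * (c * ‖A‖) * t ^ 2 := by gcongr
    have h4 : (c * ‖A‖) ^ 2 * (t ^ 2 * t ^ 2) ≤ (c * ‖A‖) ^ 2 * (t ^ 2 * 1) := by
      gcongr
      exact pow_le_one₀ ht.1 ht1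
    simp only [f]
    rw [← hN2]
    nlinarith
  have := deriv_nonneg_of_nonneg_right (f := f) hfd hf0 ht₀ hfpos
  rw [hJ0, h.zero, euclInner_comm A] at this
  have h5 : 0 ≤ 2 * ε * (euclInner (fderiv ℝ W x A) A + (ε - 1) * euclInner A (hopf x)
      * (euclInner (fderiv ℝ W x A) (hopf x) + euclInner A (hopf (W x)))) := by
    refine this.trans (le_of_eq ?_)
    simp
    ring
  exact nonneg_of_mul_nonneg_right h5 (by positivity)

lemma neg (g : LocalGenerator F x W φ ρ) : LocalGenerator F x (-W) (-φ) ρ where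
  smooth := g.smooth.neg
  compact := g.compact.neg
  tangent q := by
    have := g.tangent q
    rw [Pi.neg_apply, ← neg_one_smul ℝ, euclInner_smul_left, this, mul_zero]
  normalized q hq := by simp [g.normalized q hq]
  line q hq hS := by rw [g.line q hq hS, Pi.neg_apply, ← Set.neg_singleton, Submodule.span_neg]

/-- The generator of a metric foliation satisfies `⟨∇_A W, A⟩ = 0` for `A` orthogonal to `W`. -/
lemma fderiv_eq_zero (g : LocalGenerator F x W φ ρ) (hF : F.IsMetric ε) (hρ : 0 < ρ)
    (hε : 0 < ε) (hx : x ∈ S3) {A : ℂ × ℂ} (hA : IsTangent x A) (hAW : metric ε x (W x) A = 0) :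
    euclInner (fderiv ℝ W x A) A + (ε - 1) * euclInner A (hopf x)
      * (euclInner (fderiv ℝ W x A) (hopf x) + euclInner A (hopf (W x))) = 0 := by
  refine le_antisymm ?_ (g.fderiv_nonneg hF hρ hε hx hA hAW)
  have hn : ∀ v w, euclInner (-v) w = -euclInner v w := fun v w => by
    rw [← neg_one_smul ℝ, euclInner_smul_left]; ring
  have hn' : ∀ v w, euclInner v (-w) = -euclInner v w := fun v w => by
    rw [← neg_one_smul ℝ, euclInner_smul_right]; ring
  have hh : hopf (-(W x)) = -hopf (W x) := map_neg frame₁ _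
  have := g.neg.fderiv_nonneg hF hρ hε hx hA (by
    rw [metric_eq ε hx] at hAW ⊢
    rw [Pi.neg_apply, hn, hn]
    linarith)
  rw [fderiv_neg, Pi.neg_apply, _root_.neg_apply, hn, hn, hh, hn'] at this
  linarith

end LocalGenerator

end

/-- A local generator of a metric foliation satisfies `⟨∇_A V, A⟩ = 0` for `A` orthogonal to `V`. -/
theorem OneDimFoliation.IsMetric.fderiv_eq_zero {ε : ℝ} {F : OneDimFoliation} (hF : F.IsMetric ε)
    (hε : 0 < ε) {x : ℂ × ℂ} (hx : x ∈ S3) {O : Set (ℂ × ℂ)} (hO : IsOpen O) (hxO : x ∈ O)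
    {V : ℂ × ℂ → ℂ × ℂ} (hV : ContDiffOn ℝ ∞ V O) (hVt : ∀ q ∈ O, euclInner (V q) q = 0)
    (hVx : V x ≠ 0) (hVl : ∀ q ∈ O, q ∈ S3 → F.line q = Submodule.span ℝ {V q})
    {A : ℂ × ℂ} (hA : IsTangent x A) (hAV : metric ε x (V x) A = 0) :
    euclInner (fderiv ℝ V x A) A + (ε - 1) * euclInner A (hopf x)
      * (euclInner (fderiv ℝ V x A) (hopf x) + euclInner A (hopf (V x))) = 0 := by
  have he := euclInner_self_pos hVx
  obtain ⟨φ, hφ⟩ : ∃ φ : ℂ × ℂ →L[ℝ] ℝ, φ (V x) = 1 := by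
    refine ⟨LinearMap.toContinuousLinearMap
      { toFun := fun v => (euclInner (V x) (V x))⁻¹ * euclInner v (V x)
        map_add' := fun u v => ?_
        map_smul' := fun r v => ?_ }, inv_mul_cancel₀ he.ne'⟩
    · simp only [euclInner_add_left]; ring
    · simp only [euclInner_smul_left, smul_eq_mul, RingHom.id_apply]; ring
  have hVc : ContinuousAt V x := (hV.contDiffAt (hO.mem_nhds hxO)).continuousAt
  have hev : ∀ᶠ q in 𝓝 x, q ∈ O ∧ φ (V q) ≠ 0 :=
    (Filter.eventually_mem_set.mpr (hO.mem_nhds hxO)).and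
      ((φ.continuous.continuousAt.comp hVc).eventually_ne (by simp [hφ]))
  obtain ⟨R, hR, hball⟩ := Metric.eventually_nhds_iff_ball.mp hev
  let χ : ContDiffBump x := ⟨R / 3, R / 2, by positivity, by linarith⟩
  let f : ℂ × ℂ → ℝ := fun q => χ q * (φ (V q))⁻¹
  let W : ℂ × ℂ → ℂ × ℂ := fun q => f q • V q
  have hχ0 : ∀ q, q ∉ Metric.ball x R → f q = 0 := fun q hq => by
    simp only [f]
    rw [χ.zero_of_le_dist, zero_mul]
    rw [Metric.mem_ball, not_lt] at hq
    change R / 2 ≤ _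
    linarith
  have hVat : ∀ q ∈ Metric.ball x R, ContDiffAt ℝ ∞ V q := fun q hq =>
    hV.contDiffAt (hO.mem_nhds (hball q hq).1)
  have hfs : ∀ q ∈ Metric.ball x R, ContDiffAt ℝ ∞ f q := fun q hq =>
    χ.contDiffAt.mul ((φ.contDiff.contDiffAt.comp q (hVat q hq)).inv (hball q hq).2)
  have hfx : ∀ q ∈ Metric.ball x (R / 3), f q = (φ (V q))⁻¹ := fun q hq => by
    simp only [f]
    rw [χ.one_of_mem_closedBall (Metric.ball_subset_closedBall hq), one_mul]
  have g : LocalGenerator F x W φ (R / 3) :=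
    { smooth := by
        refine contDiff_iff_contDiffAt.mpr fun q => ?_
        by_cases hq : q ∈ Metric.ball x R
        · exact (hfs q hq).smul (hVat q hq)
        · have hq' : q ∉ tsupport χ := by
            rw [χ.tsupport_eq, Metric.mem_closedBall, not_le]
            rw [Metric.mem_ball, not_lt] at hq
            change R / 2 < _
            linarith
          have : W =ᶠ[𝓝 q] fun _ => 0 := by
            filter_upwards [notMem_tsupport_iff_eventuallyEq.mp hq'] with z hz
            simp [W, f, hz]
          exact contDiffAt_const.congr_of_eventuallyEq this
      compact := χ.hasCompactSupport.mul_right.smul_right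
      tangent := fun q => by
        simp only [W]
        rw [euclInner_smul_left]
        by_cases hq : q ∈ Metric.ball x R
        · rw [hVt q (hball q hq).1, mul_zero]
        · rw [hχ0 q hq, zero_mul]
      normalized := fun q hq => by
        simp only [W]
        rw [map_smul, hfx q hq, smul_eq_mul,
          inv_mul_cancel₀ (hball q (Metric.ball_subset_ball (by linarith) hq)).2]
      line := fun q hq hS => by
        have hq' := hball q (Metric.ball_subset_ball (by linarith) hq)
        simp only [W]
        rw [hVl q hq'.1 hS, hfx q hq,
          Submodule.span_singleton_smul_eq (IsUnit.mk0 _ (inv_ne_zero hq'.2))] }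
  have hxR : x ∈ Metric.ball x R := Metric.mem_ball_self hR
  have hf1 : f x = 1 := by rw [hfx x (Metric.mem_ball_self (by positivity)), hφ, inv_one]
  have hWx : W x = V x := by simp [W, hf1]
  have hfd := ((hfs x hxR).differentiableAt (by simp)).hasFDerivAt
  have hVd := ((hVat x hxR).differentiableAt (by simp)).hasFDerivAt
  have hWd : fderiv ℝ W x A = fderiv ℝ V x A + fderiv ℝ f x A • V x := by
    have : HasFDerivAt W _ x := hfd.fun_smul hVd
    rw [this.fderiv]
    simp [hf1]
  have key := g.fderiv_eq_zero hF (by positivity) hε hx hA (by rwa [hWx])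
  rw [hWx, hWd] at key
  simp only [euclInner_add_left, euclInner_smul_left] at key
  rw [metric_eq ε hx] at hAV
  have h0 := (mul_eq_zero.mp hAV).resolve_left hε.ne'
  linear_combination key - fderiv ℝ f x A * h0

/-! ### Metric foliations of Berger spheres are Riemannian flows -/

/-- The radial projection to the sphere. -/
def radial (q : ℂ × ℂ) : ℂ × ℂ := (Real.sqrt (euclInner q q))⁻¹ • q

lemma radial_mem_S3 {q : ℂ × ℂ} (hq : q ≠ 0) : radial q ∈ S3 := by
  have h := euclInner_self_pos hq
  rw [mem_S3_iff, radial, euclInner_smul_left, euclInner_smul_right]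
  have h2 := Real.mul_self_sqrt h.le
  have h3 := (Real.sqrt_pos.mpr h).ne'
  set w := Real.sqrt (euclInner q q)
  rw [← h2]
  field_simp

lemma radial_of_mem_S3 {q : ℂ × ℂ} (hq : q ∈ S3) : radial q = q := by
  rw [radial, mem_S3_iff.mp hq]; simp

lemma radial_smul {r : ℝ} (hr : 0 < r) (q : ℂ × ℂ) : radial (r • q) = radial q := by
  rw [radial, radial, euclInner_smul_left, euclInner_smul_right, ← mul_assoc,
    Real.sqrt_mul (mul_self_nonneg r), Real.sqrt_mul_self hr.le, smul_smul]
  congr 1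
  rw [mul_inv]
  field_simp

lemma contDiffAt_radial {q : ℂ × ℂ} (hq : q ≠ 0) : ContDiffAt ℝ ∞ radial q := by
  have h1 : ContDiffAt ℝ ∞ (fun q : ℂ × ℂ => euclInner q q) q :=
    (contDiff_euclInner.comp (contDiff_id.prodMk contDiff_id)).contDiffAt
  have h2 := euclInner_self_pos hq
  exact ((h1.sqrt h2.ne').inv (Real.sqrt_ne_zero'.mpr h2)).smul contDiffAt_id

lemma ne_zero_of_mem_S3 {q : ℂ × ℂ} (hq : q ∈ S3) : q ≠ 0 := by
  rintro rfl
  have := mem_S3_iff.mp hq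
  simp [euclInner] at this

/-- A function that is constant on rays has vanishing radial derivative. -/
lemma lieDeriv_id_of_radial {f : ℂ × ℂ → ℝ} (hf : ∀ q, ∀ r : ℝ, 0 < r → f (r • q) = f q)
    (q : ℂ × ℂ) (hd : DifferentiableAt ℝ f q) : lieDeriv (.id ℝ _) f q = 0 := by
  have h1 : HasDerivAt (fun s : ℝ => s • q) q 1 :=
    ((hasDerivAt_id' (1 : ℝ)).smul_const q).congr_deriv (one_smul _ _)
  have hd' : HasFDerivAt f (fderiv ℝ f q) ((1 : ℝ) • q) := by
    rw [one_smul]; exact hd.hasFDerivAt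
  have h2 := hd'.comp_hasDerivAt (1 : ℝ) h1
  have h3 : HasDerivAt (fun s : ℝ => f (s • q)) 0 1 :=
    (hasDerivAt_const 1 (f q)).congr_of_eventuallyEq (by
      filter_upwards [lt_mem_nhds one_pos] with s hs
      exact hf q s hs)
  exact h2.unique h3

/-- The derivatives along linear fields of a function that is constant on rays are constant on
rays. -/
lemma lieDeriv_smul_of_radial {f : ℂ × ℂ → ℝ} (hf : ∀ q, ∀ r : ℝ, 0 < r → f (r • q) = f q)
    (L : ℂ × ℂ →L[ℝ] ℂ × ℂ) {r : ℝ} (hr : 0 < r) (q : ℂ × ℂ)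
    (hd : DifferentiableAt ℝ f (r • q)) : lieDeriv L f (r • q) = lieDeriv L f q := by
  have h1 : HasFDerivAt (fun z => f (r • z))
      ((fderiv ℝ f (r • q)).comp (r • ContinuousLinearMap.id ℝ (ℂ × ℂ))) q :=
    hd.hasFDerivAt.comp q ((hasFDerivAt_id q).const_smul r)
  have h2 : (fun z => f (r • z)) = f := funext fun z => hf z r hr
  rw [h2] at h1
  rw [lieDeriv, lieDeriv, h1.fderiv]
  simp

/-- The field with coefficients `v` in the frame. -/
def frameField (v₁ v₂ v₃ : ℂ × ℂ → ℝ) (q : ℂ × ℂ) : ℂ × ℂ :=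
  v₁ q • frame₁ q + v₂ q • frame₂ q + v₃ q • frame₃ q

lemma euclInner_frameField_self (v₁ v₂ v₃ : ℂ × ℂ → ℝ) (q : ℂ × ℂ) :
    euclInner (frameField v₁ v₂ v₃ q) q = 0 := by
  simp only [frameField, euclInner_eq, frame₁_apply, frame₂_apply, frame₃_apply]
  simp
  ring

/-- The first order condition on a field tangent to a metric foliation, in coordinates. -/
lemma frameField_condition {ε : ℝ} {v₁ v₂ v₃ : ℂ × ℂ → ℝ} {x : ℂ × ℂ} (hx : x ∈ S3)
    (h₁ : DifferentiableAt ℝ v₁ x) (h₂ : DifferentiableAt ℝ v₂ x) (h₃ : DifferentiableAt ℝ v₃ x)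
    {a₁ a₂ a₃ : ℝ} {A : ℂ × ℂ} (hA : A = a₁ • frame₁ x + a₂ • frame₂ x + a₃ • frame₃ x) :
    euclInner (fderiv ℝ (frameField v₁ v₂ v₃) x A) A + (ε - 1) * euclInner A (hopf x)
      * (euclInner (fderiv ℝ (frameField v₁ v₂ v₃) x A) (hopf x)
        + euclInner A (hopf (frameField v₁ v₂ v₃ x))) =
    ε * a₁ * (a₁ * lieDeriv frame₁ v₁ x + a₂ * lieDeriv frame₂ v₁ x + a₃ * lieDeriv frame₃ v₁ x)
      + a₂ * (a₁ * lieDeriv frame₁ v₂ x + a₂ * lieDeriv frame₂ v₂ x + a₃ * lieDeriv frame₃ v₂ x)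
      + a₃ * (a₁ * lieDeriv frame₁ v₃ x + a₂ * lieDeriv frame₂ v₃ x + a₃ * lieDeriv frame₃ v₃ x)
      + (2 * ε - 2) * a₁ * (v₂ x * a₃ - v₃ x * a₂) := by
  have hd : HasFDerivAt (frameField v₁ v₂ v₃) _ x :=
    ((h₁.hasFDerivAt.fun_smul frame₁.hasFDerivAt).fun_add
      (h₂.hasFDerivAt.fun_smul frame₂.hasFDerivAt)).fun_add
      (h₃.hasFDerivAt.fun_smul frame₃.hasFDerivAt)
  have hD : ∀ f, fderiv ℝ f x A = a₁ * lieDeriv frame₁ f x + a₂ * lieDeriv frame₂ f x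
      + a₃ * lieDeriv frame₃ f x := fun f => by simp [hA, lieDeriv]
  have hVA : fderiv ℝ (frameField v₁ v₂ v₃) x A
      = (v₁ x • frame₁ A + fderiv ℝ v₁ x A • frame₁ x)
      + (v₂ x • frame₂ A + fderiv ℝ v₂ x A • frame₂ x)
      + (v₃ x • frame₃ A + fderiv ℝ v₃ x A • frame₃ x) := by
    rw [hd.fderiv]; simp
  rw [← hD, ← hD, ← hD, hVA]
  generalize fderiv ℝ v₁ x A = d₁
  generalize fderiv ℝ v₂ x A = d₂
  generalize fderiv ℝ v₃ x A = d₃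
  clear hD hVA hd
  subst hA
  set A := a₁ • frame₁ x + a₂ • frame₂ x + a₃ • frame₃ x with hA
  have hxx := mem_S3_iff.mp hx
  have k0 : euclInner ((v₁ x • frame₁ A + d₁ • frame₁ x) + (v₂ x • frame₂ A + d₂ • frame₂ x)
      + (v₃ x • frame₃ A + d₃ • frame₃ x)) A = (d₁ * a₁ + d₂ * a₂ + d₃ * a₃) * euclInner x x := by
    simp only [hA, euclInner_eq, frame₁_apply, frame₂_apply, frame₃_apply]
    simp
    ring
  have k1 : euclInner A (hopf x) = a₁ * euclInner x x := by
    simp only [hA, hopf_eq, euclInner_eq, frame₁_apply, frame₂_apply, frame₃_apply]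
    simp
    ring
  have k2 : euclInner ((v₁ x • frame₁ A + d₁ • frame₁ x) + (v₂ x • frame₂ A + d₂ • frame₂ x)
      + (v₃ x • frame₃ A + d₃ • frame₃ x)) (hopf x) + euclInner A (hopf (frameField v₁ v₂ v₃ x))
      = (d₁ + 2 * (v₂ x * a₃ - v₃ x * a₂)) * euclInner x x := by
    simp only [hA, frameField, hopf_eq, euclInner_eq, frame₁_apply, frame₂_apply, frame₃_apply]
    simp
    ring
  rw [k0, k1, k2, hxx]
  ring

/-- Near each point, a metric foliation of a Berger sphere is spanned by a Riemannian flow that is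
constant on rays. -/
theorem OneDimFoliation.IsMetric.exists_isRiemannianFlow {ε : ℝ} (hε : 0 < ε) {F : OneDimFoliation}
    (hF : F.IsMetric ε) {p : ℂ × ℂ} (hp : p ∈ S3) :
    ∃ (Ω : TopologicalSpace.Opens (ℂ × ℂ)) (v₁ v₂ v₃ : ℂ × ℂ → ℝ), p ∈ Ω ∧
      IsRiemannianFlow (Real.sqrt ε) Ω v₁ v₂ v₃ ∧
      (∀ q ∈ Ω, lieDeriv (.id ℝ _) v₁ q = 0) ∧ (∀ q ∈ Ω, lieDeriv (.id ℝ _) v₂ q = 0) ∧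
      (∀ q ∈ Ω, lieDeriv (.id ℝ _) v₃ q = 0) ∧
      ∀ q ∈ Ω, q ∈ S3 → frameField v₁ v₂ v₃ q ≠ 0 ∧
        F.line q = Submodule.span ℝ {frameField v₁ v₂ v₃ q} := by
  obtain ⟨O, hO, hpO, V, hV, hline⟩ := F.smooth p hp
  have hεs : Real.sqrt ε ^ 2 = ε := Real.sq_sqrt hε.le
  let Ω : TopologicalSpace.Opens (ℂ × ℂ) := ⟨{q | q ≠ 0 ∧ radial q ∈ O}, by
    rw [isOpen_iff_mem_nhds]
    rintro q ⟨hq0, hq⟩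
    filter_upwards [isOpen_ne.mem_nhds hq0,
      (contDiffAt_radial hq0).continuousAt.preimage_mem_nhds (hO.mem_nhds hq)] with z h1 h2
    exact ⟨h1, h2⟩⟩
  -- the coefficients of the field at the radial projection
  let u : (ℂ × ℂ →L[ℝ] ℂ × ℂ) → ℂ × ℂ → ℝ := fun L q => euclInner (V (radial q)) (L (radial q))
  let N : ℂ × ℂ → ℝ := fun q => Real.sqrt (ε * u frame₁ q ^ 2 + u frame₂ q ^ 2 + u frame₃ q ^ 2)
  let v : (ℂ × ℂ →L[ℝ] ℂ × ℂ) → ℂ × ℂ → ℝ := fun L q => (N q)⁻¹ * u L q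
  have hrad : ∀ L q, ∀ r : ℝ, 0 < r → v L (r • q) = v L q := fun L q r hr => by
    simp only [v, N, u, radial_smul hr]
  have hus : ∀ L, ContDiffOn ℝ ∞ (u L) Ω := by
    rintro L q ⟨hq0, hq⟩
    have h1 := contDiffAt_radial hq0
    have h2 : ContDiffAt ℝ ∞ (fun q => V (radial q)) q :=
      ContDiffAt.comp q (hV.contDiffAt (hO.mem_nhds hq)) h1
    have h3 : ContDiffAt ℝ ∞ (fun q => L (radial q)) q := L.contDiff.contDiffAt.comp q h1
    exact (contDiff_euclInner.contDiffAt.comp q (h2.prodMk h3)).contDiffWithinAt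
  have hVexp : ∀ q ∈ Ω, V (radial q) = frameField (u frame₁) (u frame₂) (u frame₃) (radial q) := by
    rintro q ⟨hq0, hq⟩
    have hS := radial_mem_S3 hq0
    have h1 := frame_expansion (radial q) (V (radial q))
    have h2 : euclInner (V (radial q)) (radial q) = 0 := (hline _ ⟨hq, hS⟩).2.1
    rw [mem_S3_iff.mp hS, one_smul, h2, zero_smul, zero_add] at h1
    simp only [frameField, u, radial_of_mem_S3 hS]
    exact h1
  have hN : ∀ q ∈ Ω, 0 < ε * u frame₁ q ^ 2 + u frame₂ q ^ 2 + u frame₃ q ^ 2 := by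
    rintro q hq
    have hS := radial_mem_S3 hq.1
    have h1 := hVexp q hq
    have h2 := (hline _ ⟨hq.2, hS⟩).1
    rw [h1] at h2
    by_contra h
    have e1 : 0 ≤ ε * u frame₁ q ^ 2 := by positivity
    have e2 := sq_nonneg (u frame₂ q)
    have e3 := sq_nonneg (u frame₃ q)
    have z1 : u frame₁ q = 0 := by
      have : ε * u frame₁ q ^ 2 = 0 := by linarith
      exact pow_eq_zero_iff (two_ne_zero) |>.mp ((mul_eq_zero.mp this).resolve_left hε.ne')
    have z2 : u frame₂ q = 0 := pow_eq_zero_iff (two_ne_zero) |>.mp (by linarith)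
    have z3 : u frame₃ q = 0 := pow_eq_zero_iff (two_ne_zero) |>.mp (by linarith)
    have hu : ∀ L, u L (radial q) = u L q := fun L => by simp only [u, radial_of_mem_S3 hS]
    apply h2
    simp only [frameField, hu, z1, z2, z3]
    simp
  have hNs : ContDiffOn ℝ ∞ N Ω := ContDiffOn.sqrt
    (((contDiffOn_const.mul ((hus _).pow 2)).add ((hus _).pow 2)).add ((hus _).pow 2))
    fun q hq => (hN q hq).ne'
  have hN0 : ∀ q ∈ Ω, N q ≠ 0 := fun q hq => Real.sqrt_ne_zero'.mpr (hN q hq)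
  have hvs : ∀ L, ContDiffOn ℝ ∞ (v L) Ω := fun L => (hNs.inv hN0).mul (hus L)
  have hvd : ∀ L, ∀ q ∈ Ω, DifferentiableAt ℝ (v L) q := fun L q hq =>
    differentiableAt_of_mem (hvs L) ⟨q, hq⟩
  have hS3 : ∀ q ∈ Ω, q ∈ S3 → frameField (v frame₁) (v frame₂) (v frame₃) q = (N q)⁻¹ • V q := by
    intro q hq hS
    have h1 := hVexp q hq
    rw [radial_of_mem_S3 hS] at h1
    rw [h1]
    simp only [frameField, v]
    module
  have hfl : ∀ q ∈ Ω, q ∈ S3 → frameField (v frame₁) (v frame₂) (v frame₃) q ≠ 0 ∧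
      F.line q = Submodule.span ℝ {frameField (v frame₁) (v frame₂) (v frame₃) q} := by
    intro q hq hS
    have hqO : q ∈ O := by have := hq.2; rwa [radial_of_mem_S3 hS] at this
    obtain ⟨h1, -, h2⟩ := hline q ⟨hqO, hS⟩
    have hi := inv_ne_zero (hN0 q hq)
    rw [hS3 q hq hS, h2, Submodule.span_singleton_smul_eq (IsUnit.mk0 _ hi)]
    exact ⟨smul_ne_zero hi h1, rfl⟩
  have hfs : ContDiffOn ℝ ∞ (frameField (v frame₁) (v frame₂) (v frame₃)) Ω :=
    (((hvs _).smul frame₁.contDiff.contDiffOn).add ((hvs _).smul frame₂.contDiff.contDiffOn)).add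
      ((hvs _).smul frame₃.contDiff.contDiffOn)
  refine ⟨Ω, v frame₁, v frame₂, v frame₃, ⟨ne_zero_of_mem_S3 hp, ?_⟩,
    ⟨hvs _, hvs _, hvs _, fun q hq => ?_, fun q hq a₁ a₂ a₃ ha => ?_⟩,
    fun q hq => lieDeriv_id_of_radial (hrad _) q (hvd _ q hq),
    fun q hq => lieDeriv_id_of_radial (hrad _) q (hvd _ q hq),
    fun q hq => lieDeriv_id_of_radial (hrad _) q (hvd _ q hq), hfl⟩
  · rwa [radial_of_mem_S3 hp]
  · have h1 : N q ^ 2 = _ := Real.sq_sqrt (hN q hq).le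
    have h2 := hN0 q hq
    simp only [v]
    rw [hεs]
    field_simp
    rw [h1]
  · rw [hεs] at ha ⊢
    have hr : 0 < (Real.sqrt (euclInner q q))⁻¹ :=
      inv_pos.mpr (Real.sqrt_pos.mpr (euclInner_self_pos hq.1))
    have hx : radial q ∈ S3 := radial_mem_S3 hq.1
    have hxΩ : radial q ∈ Ω :=
      ⟨ne_zero_of_mem_S3 hx, by rw [radial_of_mem_S3 hx]; exact hq.2⟩
    have hv : ∀ L, v L q = v L (radial q) := fun L => (hrad L q _ hr).symm
    have hl : ∀ L M, lieDeriv L (v M) q = lieDeriv L (v M) (radial q) := fun L M =>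
      (lieDeriv_smul_of_radial (hrad M) L hr q (hvd M _ hxΩ)).symm
    simp only [hl]
    rw [hv frame₁, hv frame₂, hv frame₃] at ha
    rw [hv frame₂, hv frame₃]
    set x := radial q
    have hxx := mem_S3_iff.mp hx
    rw [← frameField_condition hx (hvd _ x hxΩ) (hvd _ x hxΩ) (hvd _ x hxΩ) rfl]
    refine hF.fderiv_eq_zero hε hx Ω.isOpen hxΩ hfs (fun q _ => euclInner_frameField_self _ _ _ q)
      (hfl x hxΩ hx).1 (fun q hq hS => (hfl q hq hS).2) ?_ ?_
    · rw [IsTangent]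
      simp only [euclInner_eq, frame₁_apply, frame₂_apply, frame₃_apply]
      simp
      ring
    · have k : euclInner (frameField (v frame₁) (v frame₂) (v frame₃) x)
          (a₁ • frame₁ x + a₂ • frame₂ x + a₃ • frame₃ x)
          = (a₁ * v frame₁ x + a₂ * v frame₂ x + a₃ * v frame₃ x) * euclInner x x := by
        simp only [frameField, euclInner_eq, frame₁_apply, frame₂_apply, frame₃_apply]
        simp
        ring
      have k1 : ∀ b₁ b₂ b₃ : ℝ, euclInner (b₁ • frame₁ x + b₂ • frame₂ x + b₃ • frame₃ x) (hopf x)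
          = b₁ * euclInner x x := fun b₁ b₂ b₃ => by
        simp only [hopf_eq, euclInner_eq, frame₁_apply, frame₂_apply, frame₃_apply]
        simp
        ring
      have k2 : euclInner (frameField (v frame₁) (v frame₂) (v frame₃) x) (hopf x)
          = v frame₁ x * euclInner x x := k1 _ _ _
      rw [metric_eq ε hx, k, k1, k2, hxx]
      linear_combination ε * ha

end Berger

end

theorem theorem2 (ε : ℝ) (hε : 0 < ε) (hε1 : ε ≠ 1) (F : Berger.OneDimFoliation)
    (hF : F.IsMetric ε) : F.IsHomogeneous ε := by
  intro p hp
  obtain ⟨Ω, v₁, v₂, v₃, hpΩ, hflow, h₁, h₂, h₃, hline⟩ := hF.exists_isRiemannianFlow hε hp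
  have hτ1 : Real.sqrt ε ≠ 1 := by rwa [Ne, Real.sqrt_eq_one]
  obtain ⟨y, hy⟩ := hflow.exists_killingField (Real.sqrt_pos.mpr hε) hτ1 h₁ h₂ h₃ hpΩ
    (Berger.ne_zero_of_mem_S3 hp)
  refine Berger.exists_localAction (y := y) ?_
  filter_upwards [hy, Ω.isOpen.mem_nhds hpΩ] with q hq hqΩ hqS
  obtain ⟨r, hr, hr'⟩ := hq
  obtain ⟨hne, hspan⟩ := hline q hqΩ hqS
  have hr' : Berger.frameField v₁ v₂ v₃ q = r • Berger.killingField y q := hr'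
  rw [hr'] at hne hspan
  exact ⟨(smul_ne_zero_iff.mp hne).2, by
    rw [hspan, Submodule.span_singleton_smul_eq (IsUnit.mk0 r hr)]⟩
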